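/- Let $n\ge 2$, let $\mathbb T=\mathbb R^n/\mathbb Z^n$ be the flat torus; all functions and distributions on $\mathbb T$ are real-valued, and summation over repeated indices from $1$ to $n$ is understood. For a torus distribution $h$ with Fourier coefficients $\hat h(\xi)=\langle h,e^{-2\pi i x\cdot\xi}\rangle$, $\xi\in\mathbb Z^n$, and $s\in\mathbb R$ put $\|h\|_{H^s_\#}^2=\sum_{\xi}(1+|\xi|^2)^{s}|\hat h(\xi)|^2$. Let $H^s_\#$ be the space of distributions for which this is finite, $\dot H^s_\#=\{h\in H^s_\#:\hat h(0)=0\}$, $\dot{\mathbf H}^s_\#=(\dot H^s_\#)^n$ with $\|\mathbf u\|^2_{\dot{\mathbf H}^s_\#}=\sum_k\|u_k\|^2_{H^s_\#}$, and let $\dot L_{2\#}$ be the space of functions in $L_2(\mathbb T)$ with zero mean. Write $\langle h,w\rangle_{\mathbb T}=\sum_\xi\hat h(\xi)\hat w(-\xi)$ (summed over components for vector and matrix fields) and $E_{j\beta}(\mathbf u)=\frac12(\partial_ju_\beta+\partial_\beta u_j)$. Let $\mathbb A=(a_{kj}^{\alpha\beta})$ be a constant real tensor with $a_{kj}^{\alpha\beta}=a_{\alpha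 j}^{k\beta}=a_{k\beta}^{\alpha j}$, for which there is a constant $C_{\mathbb A}>0$ such that $$C_{\mathbb A}\,a_{kj}^{\alpha\beta}\zeta_{k\alpha}\zeta_{j\beta}\ge|\zeta|^2\quad\text{for all symmetric }\zeta\in\mathbb R^{n\times n}\text{ with zero trace},$$ where $|\zeta|^2=\zeta_{k\alpha}\zeta_{k\alpha}$; put $\|\mathbb A\|=\max|a_{kj}^{\alpha\beta}|$. Let $\mathbf U\in L_\theta(\mathbb T)^n$ with $\operatorname{div}\mathbf U=0$ in the sense of distributions, where $\theta\in(2,\infty)$ if $n=2$ and $\theta\in[n,\infty)$ if $n\ge3$. For $\mathbf u,\mathbf v\in\dot{\mathbf H}^1_\#$ and $q\in\dot L_{2\#}$ let $$a_{\mathbf U}(\mathbf u,\mathbf v)=\langle a_{ij}^{\alpha\beta}E_{j\beta}(\mathbf u),E_{i\alpha}(\mathbf v)\rangle_{\mathbb T}+\langle(\mathbf U\cdot\nabla)\mathbf u,\mathbf v\rangle_{\mathbb T},\qquad b(\mathbf v,q)=-\langle\operatorname{div}\mathbf v,q\rangle_{\mathbb T},$$ and let $(\mathfrak L\mathbf u)_k=\partial_\alpha(a_{kj}^{\alpha\beta}E_{j\beta}(\mathbf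 u))$. (i) For all $\mathbf f\in\dot{\mathbf H}^{-1}_\#$ and $g\in\dot L_{2\#}$ there is a unique $(\mathbf u,p)\in\dot{\mathbf H}^1_\#\times\dot L_{2\#}$ such that $$a_{\mathbf U}(\mathbf u,\mathbf v)+b(\mathbf v,p)=\langle\mathbf f,\mathbf v\rangle_{\mathbb T}\ \ \forall\mathbf v\in\dot{\mathbf H}^1_\#,\qquad b(\mathbf u,q)=-\langle g,q\rangle_{\mathbb T}\ \ \forall q\in\dot L_{2\#},$$ and it satisfies $$\|\mathbf u\|_{\dot{\mathbf H}^1_\#}\le\pi^{-2}C_{\mathbb A}\|\mathbf f\|_{\dot{\mathbf H}^{-1}_\#}+C_1\|g\|_{L_2},\qquad\|p\|_{L_2}\le C_1\|\mathbf f\|_{\dot{\mathbf H}^{-1}_\#}+C_2\|g\|_{L_2},$$ where the constants $C_1,C_2$ depend only on $C_{\mathbb A}$, $\|\mathbb A\|$, $n$ and $\mathbf U$ (and $C_1$ is the same in both estimates). (ii) For all $\mathbf f\in\dot{\mathbf H}^{-1}_\#$ and $g\in\dot L_{2\#}$ the Oseen system $$-\mathfrak L\mathbf u+\nabla p+(\mathbf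 U\cdot\nabla)\mathbf u=\mathbf f,\qquad\operatorname{div}\mathbf u=g,$$ understood in the sense of distributions, is well-posed: it has a unique solution $(\mathbf u,p)\in\dot{\mathbf H}^1_\#\times\dot L_{2\#}$, this solution satisfies the estimates of (i), and a pair in $\dot{\mathbf H}^1_\#\times\dot L_{2\#}$ solves the system if and only if it solves the variational problem of (i). (iii) The operator $S_{\mathbf U}(\mathbf u,p)=(-\mathfrak L\mathbf u+\nabla p+(\mathbf U\cdot\nabla)\mathbf u,\ \operatorname{div}\mathbf u)$ maps $\dot{\mathbf H}^1_\#\times\dot L_{2\#}$ into $\dot{\mathbf H}^{-1}_\#\times\dot L_{2\#}$ and is an isomorphism: it is linear, bijective, bounded, and has a bounded inverse. -/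

import Mathlib

open MeasureTheory
open scoped ENNReal ContDiff

noncomputable section

namespace PeriodicOseen

/-! ### The flat torus, test functions and real torus distributions -/

/-- The flat torus `ℝⁿ / ℤⁿ`. -/
abbrev Torus (n : ℕ) : Type := UnitAddTorus (Fin n)

/-- Lebesgue measure on the torus (total mass one). -/
abbrev torusMeasure (n : ℕ) : Measure (Torus n) :=
  Measure.pi fun _ => (AddCircle.haarAddCircle : Measure UnitAddCircle)

/-- The `ℤⁿ`-periodic function on `ℝⁿ` corresponding to a function on the torus. -/
def lift {n : ℕ} (φ : Torus n → ℝ) : (Fin n → ℝ) → ℝ :=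
  fun x => φ fun i => (x i : UnitAddCircle)

/-- Real-valued smooth functions on the torus. -/
def TestFun (n : ℕ) : Submodule ℝ (Torus n → ℝ) where
  carrier := {φ | ContDiff ℝ ∞ (lift φ)}
  add_mem' := fun {a b} ha hb => by
    have h : ContDiff ℝ ∞ (fun x => lift a x + lift b x) := ContDiff.add ha hb
    exact h
  zero_mem' := by
    have h : ContDiff ℝ ∞ (fun _ : Fin n → ℝ => (0 : ℝ)) := contDiff_const
    exact h
  smul_mem' := fun c a ha => by
    have h : ContDiff ℝ ∞ (fun x => c • lift a x) := ContDiff.const_smul c ha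
    exact h

/-- The partial derivative of a function on the torus in the `j`-th coordinate direction. -/
def torusDeriv {n : ℕ} (j : Fin n) (φ : Torus n → ℝ) : Torus n → ℝ :=
  fun t => deriv (fun h : ℝ => φ (t + Pi.single j (h : UnitAddCircle))) 0

theorem lift_torusDeriv {n : ℕ} (j : Fin n) (φ : Torus n → ℝ) :
    lift (torusDeriv j φ) = fun x => lineDeriv ℝ (lift φ) x (Pi.single j 1) := by
  funext x
  unfold lift torusDeriv lineDeriv
  congr 1
  funext h
  congr 1
  funext i
  by_cases hij : i = j
  · subst hij
    simp
  · simp [hij]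

theorem lift_torusDeriv_of_contDiff {n : ℕ} (j : Fin n) {φ : Torus n → ℝ}
    (hφ : ContDiff ℝ ∞ (lift φ)) :
    lift (torusDeriv j φ) = fun x => fderiv ℝ (lift φ) x (Pi.single j 1) := by
  rw [lift_torusDeriv]
  funext x
  exact ((hφ.differentiable (by simp)) x).lineDeriv_eq_fderiv

theorem contDiff_lift_torusDeriv {n : ℕ} (j : Fin n) {φ : Torus n → ℝ}
    (hφ : ContDiff ℝ ∞ (lift φ)) : ContDiff ℝ ∞ (lift (torusDeriv j φ)) := by
  rw [lift_torusDeriv_of_contDiff j hφ]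
  exact (hφ.fderiv_right (m := ∞) (by simp)).clm_apply contDiff_const

theorem eq_of_lift_eq {n : ℕ} {φ ψ : Torus n → ℝ} (h : lift φ = lift ψ) : φ = ψ := by
  funext t
  choose x hx using fun i => QuotientAddGroup.mk_surjective (t i)
  have := congrFun h x
  have ht : (fun i => ((x i : ℝ) : UnitAddCircle)) = t := funext hx
  simpa [lift, ht] using this

/-- The partial derivative `∂_j` on test functions. -/
def TestFun.pderiv {n : ℕ} (j : Fin n) : TestFun n →ₗ[ℝ] TestFun n where
  toFun φ := ⟨torusDeriv j φ.1, contDiff_lift_torusDeriv j φ.2⟩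
  map_add' φ ψ := by
    apply Subtype.ext
    apply eq_of_lift_eq
    have hφ : ContDiff ℝ ∞ (lift φ.1) := φ.2
    have hψ : ContDiff ℝ ∞ (lift ψ.1) := ψ.2
    have hs : ContDiff ℝ ∞ (lift (φ.1 + ψ.1)) := (φ + ψ).2
    change lift (torusDeriv j (φ.1 + ψ.1)) =
      fun x => lift (torusDeriv j φ.1) x + lift (torusDeriv j ψ.1) x
    rw [lift_torusDeriv_of_contDiff j hs, lift_torusDeriv_of_contDiff j hφ,
      lift_torusDeriv_of_contDiff j hψ]
    funext x
    change fderiv ℝ (lift φ.1 + lift ψ.1) x _ = _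
    rw [fderiv_add ((hφ.differentiable (by simp)) x) ((hψ.differentiable (by simp)) x)]
    rfl
  map_smul' c φ := by
    apply Subtype.ext
    apply eq_of_lift_eq
    have hφ : ContDiff ℝ ∞ (lift φ.1) := φ.2
    have hs : ContDiff ℝ ∞ (lift (c • φ.1)) := (c • φ).2
    change lift (torusDeriv j (c • φ.1)) = fun x => c • lift (torusDeriv j φ.1) x
    rw [lift_torusDeriv_of_contDiff j hs, lift_torusDeriv_of_contDiff j hφ]
    funext x
    change fderiv ℝ (c • lift φ.1) x _ = _
    rw [fderiv_const_smul ((hφ.differentiable (by simp)) x)]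
    rfl

/-- Iterated partial derivatives of a test function. -/
def TestFun.iterDeriv {n : ℕ} (l : List (Fin n)) (φ : TestFun n) : TestFun n :=
  l.foldr (fun j ψ => TestFun.pderiv j ψ) φ

/-- A linear functional on the test functions is bounded if it is controlled by the supremum norms
of the partial derivatives up to some finite order; this is continuity for the usual Fréchet
topology of smooth functions on the torus. -/
def IsBoundedFunctional {n : ℕ} (T : TestFun n →ₗ[ℝ] ℝ) : Prop :=
  ∃ (N : ℕ) (C : ℝ), ∀ (φ : TestFun n) (M : ℝ),
    (∀ l : List (Fin n), l.length ≤ N → ∀ t, |(TestFun.iterDeriv l φ).1 t| ≤ M) →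
      |T φ| ≤ C * M

/-- Real torus distributions: the continuous linear functionals on smooth functions. -/
def Distr (n : ℕ) : Submodule ℝ (TestFun n →ₗ[ℝ] ℝ) where
  carrier := {T | IsBoundedFunctional T}
  add_mem' := by
    rintro S T ⟨N, C, hS⟩ ⟨N', C', hT⟩
    refine ⟨max N N', C + C', fun φ M h => ?_⟩
    have h1 := hS φ M fun l hl => h l (hl.trans (le_max_left _ _))
    have h2 := hT φ M fun l hl => h l (hl.trans (le_max_right _ _))
    calc |(S + T) φ| ≤ |S φ| + |T φ| := abs_add_le _ _
      _ ≤ C * M + C' * M := add_le_add h1 h2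
      _ = (C + C') * M := by ring
  zero_mem' := ⟨0, 0, fun φ M _ => by simp⟩
  smul_mem' := by
    rintro c T ⟨N, C, hT⟩
    refine ⟨N, |c| * C, fun φ M h => ?_⟩
    have h1 := hT φ M h
    calc |(c • T) φ| = |c| * |T φ| := by simp [abs_mul]
      _ ≤ |c| * (C * M) := by gcongr
      _ = |c| * C * M := by ring

/-- The distributional derivative `(∂_j T)(φ) = -T(∂_j φ)`. -/
def Distr.pderiv {n : ℕ} (j : Fin n) : Distr n →ₗ[ℝ] Distr n where
  toFun T := ⟨-(T.1.comp (TestFun.pderiv j)), by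
    obtain ⟨N, C, hT⟩ := T.2
    refine ⟨N + 1, C, fun φ M h => ?_⟩
    have h1 := hT (TestFun.pderiv j φ) M fun l hl t => by
      have h2 : TestFun.iterDeriv (l ++ [j]) φ = TestFun.iterDeriv l (TestFun.pderiv j φ) := by
        unfold TestFun.iterDeriv
        rw [List.foldr_append]
        rfl
      rw [← h2]
      exact h (l ++ [j]) (by rw [List.length_append]; exact Nat.add_le_add_right hl 1) t
    change |-(T.1 (TestFun.pderiv j φ))| ≤ C * M
    rwa [abs_neg]⟩
  map_add' S T := Subtype.ext (LinearMap.ext fun φ =>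
    neg_add (S.1 (TestFun.pderiv j φ)) (T.1 (TestFun.pderiv j φ)))
  map_smul' c T := Subtype.ext (LinearMap.ext fun φ =>
    (mul_neg c (T.1 (TestFun.pderiv j φ))).symm)

theorem continuous_testFun {n : ℕ} (φ : TestFun n) : Continuous φ.1 := by
  have h : Continuous (lift φ.1) := (show ContDiff ℝ ∞ (lift φ.1) from φ.2).continuous
  have hq : IsOpenQuotientMap
      (fun (x : Fin n → ℝ) (i : Fin n) => ((x i : ℝ) : UnitAddCircle)) :=
    IsOpenQuotientMap.piMap fun _ => QuotientAddGroup.isOpenQuotientMap_mk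
  exact hq.isQuotientMap.continuous_iff.2 h

theorem integrable_mul_testFun {n : ℕ} {g : Torus n → ℝ} (hg : Integrable g (torusMeasure n))
    (φ : TestFun n) : Integrable (fun t => g t * φ.1 t) (torusMeasure n) := by
  obtain ⟨C, hC⟩ := isCompact_univ.exists_bound_of_continuousOn
    (continuous_testFun φ).continuousOn
  exact hg.mul_bdd (c := C) (continuous_testFun φ).aestronglyMeasurable
    (Filter.Eventually.of_forall fun t => hC t (Set.mem_univ t))

open Classical in
/-- The distribution `φ ↦ ∫ g φ` of an integrable function `g` on the torus
(and `0` if `g` is not integrable). -/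
def ofFun {n : ℕ} (g : Torus n → ℝ) : Distr n :=
  if hg : Integrable g (torusMeasure n) then
    ⟨{ toFun := fun φ => ∫ t, g t * φ.1 t ∂torusMeasure n
       map_add' := fun φ ψ => by
        rw [← integral_add (integrable_mul_testFun hg φ) (integrable_mul_testFun hg ψ)]
        simp [mul_add]
       map_smul' := fun c φ => by
        simp only [RingHom.id_apply, smul_eq_mul]
        rw [← integral_const_mul]
        refine integral_congr_ae (Filter.Eventually.of_forall fun t => ?_)
        simp
        ring },
      by
        refine ⟨0, ∫ t, |g t| ∂torusMeasure n, fun φ M h => ?_⟩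
        have h0 : ∀ t, |φ.1 t| ≤ M := fun t => h [] (by simp) t
        change |∫ t, g t * φ.1 t ∂torusMeasure n| ≤ _
        rw [← integral_mul_const]
        refine (abs_integral_le_integral_abs).trans ?_
        refine integral_mono_ae (integrable_mul_testFun hg φ).abs (hg.abs.mul_const M)
          (Filter.Eventually.of_forall fun t => ?_)
        change |g t * φ.1 t| ≤ |g t| * M
        rw [abs_mul]
        exact mul_le_mul_of_nonneg_left (h0 t) (abs_nonneg _)⟩
  else 0

/-! ### Fourier coefficients and periodic Sobolev spaces -/

theorem contDiff_mFourier {n : ℕ} (ξ : Fin n → ℤ) :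
    ContDiff ℝ ∞ fun x : Fin n → ℝ =>
      UnitAddTorus.mFourier ξ (fun i => (x i : UnitAddCircle)) := by
  change ContDiff ℝ ∞ fun x : Fin n → ℝ => ∏ i, fourier (ξ i) (x i : UnitAddCircle)
  refine contDiff_prod fun i _ => ?_
  simp only [fourier_coe_apply]
  refine ContDiff.cexp ?_
  refine ContDiff.div_const (ContDiff.mul contDiff_const ?_) _
  exact Complex.ofRealCLM.contDiff.comp (contDiff_apply ℝ ℝ i)

/-- `x ↦ cos (2π x·ξ)`, the real part of `exp (2πi x·ξ)`. -/
def cosTest {n : ℕ} (ξ : Fin n → ℤ) : TestFun n :=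
  ⟨fun t => (UnitAddTorus.mFourier ξ t).re,
    (Complex.reCLM.contDiff.comp (contDiff_mFourier ξ) : ContDiff ℝ ∞ _)⟩

/-- `x ↦ sin (2π x·ξ)`, the imaginary part of `exp (2πi x·ξ)`. -/
def sinTest {n : ℕ} (ξ : Fin n → ℤ) : TestFun n :=
  ⟨fun t => (UnitAddTorus.mFourier ξ t).im,
    (Complex.imCLM.contDiff.comp (contDiff_mFourier ξ) : ContDiff ℝ ∞ _)⟩

/-- The Fourier coefficient `T̂(ξ) = T(exp (-2πi x·ξ))`, `T` being extended complex-linearly. -/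
def fourierCoef {n : ℕ} (T : Distr n) (ξ : Fin n → ℤ) : ℂ :=
  (T.1 (cosTest (-ξ)) : ℂ) + Complex.I * (T.1 (sinTest (-ξ)) : ℂ)

/-- `ρ(ξ) = (1 + |ξ|²)^{1/2}`. -/
def rho {n : ℕ} (ξ : Fin n → ℤ) : ℝ := Real.sqrt (1 + ∑ j, (ξ j : ℝ) ^ 2)

/-- Membership in the Bessel-potential space `H^s` of the torus. -/
def MemSobolev {n : ℕ} (s : ℝ) (T : Distr n) : Prop :=
  Summable fun ξ : Fin n → ℤ => rho ξ ^ (2 * s) * ‖fourierCoef T ξ‖ ^ 2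

/-- The norm of `H^s` (meaningful for members of `H^s`). -/
def sobolevNorm {n : ℕ} (s : ℝ) (T : Distr n) : ℝ :=
  Real.sqrt (∑' ξ : Fin n → ℤ, rho ξ ^ (2 * s) * ‖fourierCoef T ξ‖ ^ 2)

theorem rho_nonneg {n : ℕ} (ξ : Fin n → ℤ) : 0 ≤ rho ξ := Real.sqrt_nonneg _

theorem fourierCoef_add {n : ℕ} (S T : Distr n) (ξ : Fin n → ℤ) :
    fourierCoef (S + T) ξ = fourierCoef S ξ + fourierCoef T ξ := by
  simp [fourierCoef]
  ring

theorem fourierCoef_smul {n : ℕ} (c : ℝ) (T : Distr n) (ξ : Fin n → ℤ) :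
    fourierCoef (c • T) ξ = c * fourierCoef T ξ := by
  simp [fourierCoef]
  ring

theorem MemSobolev.add {n : ℕ} {s : ℝ} {S T : Distr n} (hS : MemSobolev s S)
    (hT : MemSobolev s T) : MemSobolev s (S + T) := by
  refine Summable.of_nonneg_of_le (fun ξ => ?_) (fun ξ => ?_)
    ((Summable.add hS hT).mul_left 2)
  · have := Real.rpow_nonneg (rho_nonneg ξ) (2 * s)
    positivity
  · have h0 := Real.rpow_nonneg (rho_nonneg ξ) (2 * s)
    have h1 : ‖fourierCoef (S + T) ξ‖ ^ 2
        ≤ 2 * (‖fourierCoef S ξ‖ ^ 2 + ‖fourierCoef T ξ‖ ^ 2) := by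
      rw [fourierCoef_add]
      have h2 := norm_add_le (fourierCoef S ξ) (fourierCoef T ξ)
      have h3 := norm_nonneg (fourierCoef S ξ + fourierCoef T ξ)
      nlinarith [sq_nonneg (‖fourierCoef S ξ‖ - ‖fourierCoef T ξ‖)]
    calc rho ξ ^ (2 * s) * ‖fourierCoef (S + T) ξ‖ ^ 2
        ≤ rho ξ ^ (2 * s) * (2 * (‖fourierCoef S ξ‖ ^ 2 + ‖fourierCoef T ξ‖ ^ 2)) :=
          mul_le_mul_of_nonneg_left h1 h0
      _ = _ := by ring

/-- The space `Ḣ^s` of distributions in `H^s` with `⟨T, 1⟩ = 0`. -/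
def HDot (n : ℕ) (s : ℝ) : Submodule ℝ (Distr n) where
  carrier := {T | MemSobolev s T ∧ fourierCoef T 0 = 0}
  add_mem' := fun {S T} hS hT => ⟨hS.1.add hT.1, by rw [fourierCoef_add, hS.2, hT.2, add_zero]⟩
  zero_mem' := by
    have h : ∀ ξ, fourierCoef (0 : Distr n) ξ = 0 := fun ξ => by simp [fourierCoef]
    exact ⟨by simp [MemSobolev, h, summable_zero], h 0⟩
  smul_mem' := fun c T hT => by
    refine ⟨?_, by rw [fourierCoef_smul, hT.2, mul_zero]⟩
    refine (Summable.mul_left (c ^ 2) hT.1).congr fun ξ => ?_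
    rw [fourierCoef_smul, norm_mul, mul_pow, Complex.norm_real, Real.norm_eq_abs, sq_abs]
    ring

/-- The norm of the space of vector fields with components in `Ḣ^s`. -/
def vecNorm {n : ℕ} (s : ℝ) (u : Fin n → HDot n s) : ℝ :=
  Real.sqrt (∑ k, sobolevNorm s (u k : Distr n) ^ 2)

/-- The space of real square integrable functions on the torus with zero mean. -/
def L2Dot (n : ℕ) : Submodule ℝ (Lp ℝ 2 (torusMeasure n)) where
  carrier := {g | ∫ t, g t ∂torusMeasure n = 0}
  add_mem' := fun {f g} hf hg => by
    have hf' : Integrable f (torusMeasure n) := (Lp.memLp f).integrable (by norm_num)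
    have hg' : Integrable g (torusMeasure n) := (Lp.memLp g).integrable (by norm_num)
    have : ∫ t, (f + g) t ∂torusMeasure n = ∫ t, (f t + g t) ∂torusMeasure n :=
      integral_congr_ae (Lp.coeFn_add f g)
    change ∫ t, (f + g) t ∂torusMeasure n = 0
    rw [this, integral_add hf' hg', show ∫ t, f t ∂torusMeasure n = 0 from hf,
      show ∫ t, g t ∂torusMeasure n = 0 from hg, add_zero]
  zero_mem' := by
    change ∫ t, (0 : Lp ℝ 2 (torusMeasure n)) t ∂torusMeasure n = 0
    rw [integral_congr_ae (Lp.coeFn_zero ℝ 2 (torusMeasure n))]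
    simp
  smul_mem' := fun c g hg => by
    change ∫ t, (c • g) t ∂torusMeasure n = 0
    rw [integral_congr_ae (Lp.coeFn_smul c g)]
    simp only [Pi.smul_apply]
    rw [integral_smul, show ∫ t, g t ∂torusMeasure n = 0 from hg, smul_zero]

/-- The torus distribution of an element of `L2Dot`. -/
def l2Distr {n : ℕ} (p : L2Dot n) : Distr n :=
  ofFun (p : Lp ℝ 2 (torusMeasure n))

/-- The dual product `⟨g, f⟩ = ∑_ξ ĝ(ξ) f̂(-ξ)` (for real distributions in dual Sobolev spaces the
series converges absolutely and its sum is real). -/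
def dualPair {n : ℕ} (g f : Distr n) : ℝ :=
  (∑' ξ : Fin n → ℤ, fourierCoef g ξ * fourierCoef f (-ξ)).re

open Classical in
/-- The square integrable function that represents a distribution
(and `0` if there is none). -/
def toL2 {n : ℕ} (T : Distr n) : Lp ℝ 2 (torusMeasure n) :=
  if h : ∃ g : Lp ℝ 2 (torusMeasure n), ofFun g = T then h.choose else 0

/-! ### The viscosity tensor; `A k j α β` stands for `a_{kj}^{αβ}` -/

/-- A constant viscosity tensor. -/
abbrev Tensor (n : ℕ) : Type := Fin n → Fin n → Fin n → Fin n → ℝ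

/-- The symmetry conditions `a_{kj}^{αβ} = a_{αj}^{kβ} = a_{kβ}^{αj}`. -/
def Tensor.IsSymm {n : ℕ} (A : Tensor n) : Prop :=
  ∀ k j α β, A k j α β = A α j k β ∧ A k j α β = A k β α j

/-- The relaxed ellipticity condition with constant `CA`, on symmetric trace-free matrices. -/
def Tensor.IsElliptic {n : ℕ} (A : Tensor n) (CA : ℝ) : Prop :=
  ∀ ζ : Matrix (Fin n) (Fin n) ℝ, ζ.IsSymm → ζ.trace = 0 →
    ∑ k, ∑ α, ζ k α ^ 2 ≤ CA * ∑ k, ∑ j, ∑ α, ∑ β, A k j α β * ζ k α * ζ j β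

/-- `‖A‖ = max |a_{kj}^{αβ}|`. -/
def Tensor.maxNorm {n : ℕ} (A : Tensor n) : ℝ :=
  ⨆ i : Fin n × Fin n × Fin n × Fin n, |A i.1 i.2.1 i.2.2.1 i.2.2.2|

/-! ### The Oseen system -/

/-- Divergence of a vector of distributions. -/
def divergence {n : ℕ} (u : Fin n → Distr n) : Distr n := ∑ j, Distr.pderiv j (u j)

/-- The entries `E_{jβ}(u) = (∂_j u_β + ∂_β u_j) / 2` of the symmetric gradient. -/
def strain {n : ℕ} (u : Fin n → Distr n) (j β : Fin n) : Distr n :=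
  (1 / 2 : ℝ) • (Distr.pderiv j (u β) + Distr.pderiv β (u j))

/-- `(𝔏 u)_k = ∂_α (a_{kj}^{αβ} E_{jβ}(u))`. -/
def viscosityOp {n : ℕ} (A : Tensor n) (u : Fin n → Distr n) (k : Fin n) : Distr n :=
  ∑ α, Distr.pderiv α (∑ j, ∑ β, A k j α β • strain u j β)

/-- The distribution of the function `((U·∇)u)_k = U_j ∂_j u_k`, the derivatives `∂_j u_k` being
square integrable functions. -/
def advection {n : ℕ} (U : Fin n → Torus n → ℝ) (u : Fin n → Distr n) (k : Fin n) : Distr n :=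
  ofFun fun t => ∑ j, U j t * toL2 (Distr.pderiv j (u k)) t

/-- A real vector field on the torus in `L_θ` with zero distributional divergence. -/
def IsSolenoidalLp {n : ℕ} (θ : ℝ) (U : Fin n → Torus n → ℝ) : Prop :=
  (∀ j, MemLp (U j) (ENNReal.ofReal θ) (torusMeasure n)) ∧
    divergence (fun j => ofFun (U j)) = 0

/-- Components of a vector field in `Ḣ^s` as distributions. -/
def comps {n : ℕ} {s : ℝ} (u : Fin n → HDot n s) : Fin n → Distr n := fun k => (u k : Distr n)

/-- The left-hand side `-𝔏 u + ∇p + (U·∇)u` of the momentum equation. -/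
def oseenMomentum {n : ℕ} (A : Tensor n) (U : Fin n → Torus n → ℝ) (u : Fin n → HDot n 1)
    (p : L2Dot n) (k : Fin n) : Distr n :=
  -viscosityOp A (comps u) k + Distr.pderiv k (l2Distr p) + advection U (comps u) k

/-- `(u, p)` solves the Oseen system in the sense of distributions. -/
def IsOseenSolution {n : ℕ} (A : Tensor n) (U : Fin n → Torus n → ℝ) (f : Fin n → HDot n (-1))
    (g : L2Dot n) (u : Fin n → HDot n 1) (p : L2Dot n) : Prop :=
  (∀ k, oseenMomentum A U u p k = comps f k) ∧ divergence (comps u) = l2Distr g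

/-- `a_U(u, v) = ⟨a_{ij}^{αβ} E_{jβ}(u), E_{iα}(v)⟩ + ⟨(U·∇)u, v⟩`. -/
def formA {n : ℕ} (A : Tensor n) (U : Fin n → Torus n → ℝ) (u v : Fin n → HDot n 1) : ℝ :=
  ∑ i, ∑ α, dualPair (∑ j, ∑ β, A i j α β • strain (comps u) j β) (strain (comps v) i α) +
    ∑ k, dualPair (advection U (comps u) k) (comps v k)

/-- `b(v, q) = -⟨div v, q⟩`. -/
def formB {n : ℕ} (v : Fin n → HDot n 1) (q : L2Dot n) : ℝ :=
  -dualPair (divergence (comps v)) (l2Distr q)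

/-- `(u, p)` solves the mixed variational problem. -/
def IsVariationalSolution {n : ℕ} (A : Tensor n) (U : Fin n → Torus n → ℝ)
    (f : Fin n → HDot n (-1)) (g : L2Dot n) (u : Fin n → HDot n 1) (p : L2Dot n) : Prop :=
  (∀ v : Fin n → HDot n 1, formA A U u v + formB v p = ∑ k, dualPair (comps f k) (comps v k)) ∧
    ∀ q : L2Dot n, formB u q = -dualPair (l2Distr g) (l2Distr q)

end PeriodicOseen

end

open PeriodicOseen

noncomputable section

namespace PeriodicOseen

open scoped ComplexConjugate NNReal

variable {n : ℕ}

/-! ### Trigonometric test functions and Fourier coefficients -/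

/-! Everything is read off Fourier coefficients. A real distribution is determined by its
coefficients (`distr_ext_fourierCoef`), Hermitian square summable sequences are realised by real
functions (`exists_Lp_fourierCoef_eq`), and derivatives become multiplication by `2πi ξ_j`. The
viscous part and the pressure are thus treated frequency by frequency. The advection term is not a
multiplier and needs the following input.

Advection. By the Sobolev inequality `H¹` embeds into `L_q` with `1/q = 1/2 - 1/θ`, so
multiplication by `U_j` maps `H¹` into `L²` (`exists_eLpNorm_mul_testFun_le`). By duality `v ↦
(U·∇)v` is bounded from `H¹` to `H⁻¹` (`advectScalar_bound`). The condition `div U = 0` gives it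
zero mean (`fourierCoef_advectScalar_zero`) and, after approximation by trigonometric polynomials,
`⟨(U·∇)v, v⟩ = 0` (`dualPair_advectScalar_self`).

Coercivity. If `div u = 0`, each coefficient of the strain is a symmetric complex matrix with zero
trace, so the relaxed ellipticity applies to its real and imaginary parts. Korn's identity evaluates
the squared norm of this matrix as `2π²|ξ|²|û(ξ)|²`, and `2|ξ|² ≥ 1 + |ξ|²` away from the zero
frequency. Hence `π² ‖u‖² ≤ C_A a_U(u, u)` on solenoidal fields (`pi_sq_mul_fieldNorm_sq_le`), the
source of the constant `π⁻² C_A`.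

Solvability. The divergence has a right inverse of norm at most one (`exists_divergence_eq`), which
reduces the problem to solenoidal fields; there the Lax–Milgram theorem applies
(`exists_solenoidal_solution`). The residual annihilates all solenoidal fields and is therefore a
pressure gradient (`exists_pressure`). Writing `u = v + w` with `v` solenoidal and `div w = g`
yields the estimate for `u`; the one for `p` follows since `‖p‖ ≤ ‖∇p‖` in `H⁻¹`. The estimates give
uniqueness and the bounded inverse. The distributional and variational formulations agree because a
residual in `Ḣ⁻¹` can be tested against its own Riesz representative in `Ḣ¹`. -/

theorem cosTest_neg (ξ : Fin n → ℤ) : cosTest (-ξ) = cosTest ξ := by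
  apply Subtype.ext
  funext t
  simp [cosTest, UnitAddTorus.mFourier_neg]

theorem sinTest_neg (ξ : Fin n → ℤ) : sinTest (-ξ) = -sinTest ξ := by
  apply Subtype.ext
  funext t
  simp [sinTest, UnitAddTorus.mFourier_neg]

theorem fourierCoef_eq (T : Distr n) (ξ : Fin n → ℤ) :
    fourierCoef T ξ = (T.1 (cosTest ξ) : ℂ) - Complex.I * (T.1 (sinTest ξ) : ℂ) := by
  simp [fourierCoef, cosTest_neg, sinTest_neg, sub_eq_add_neg]

/-- Real values of `T` make the coefficients Hermitian. This is the only trace of reality on the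
Fourier side, and it returns as the hypothesis `c (-ξ) = conj (c ξ)` whenever a real object is built
from coefficients. -/
theorem fourierCoef_neg (T : Distr n) (ξ : Fin n → ℤ) :
    fourierCoef T (-ξ) = conj (fourierCoef T ξ) := by
  rw [fourierCoef_eq T ξ, fourierCoef, neg_neg]
  simp

theorem fourierCoef_zero_distr (ξ : Fin n → ℤ) : fourierCoef (0 : Distr n) ξ = 0 := by
  simp [fourierCoef]

theorem fourierCoef_neg_distr (T : Distr n) (ξ : Fin n → ℤ) :
    fourierCoef (-T) ξ = -fourierCoef T ξ := by
  simp [fourierCoef]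
  ring

theorem fourierCoef_sub (S T : Distr n) (ξ : Fin n → ℤ) :
    fourierCoef (S - T) ξ = fourierCoef S ξ - fourierCoef T ξ := by
  simp [fourierCoef]
  ring

theorem fourierCoef_sum {ι : Type*} (s : Finset ι) (T : ι → Distr n) (ξ : Fin n → ℤ) :
    fourierCoef (∑ i ∈ s, T i) ξ = ∑ i ∈ s, fourierCoef (T i) ξ := by
  classical
  induction s using Finset.induction_on with
  | empty => simp [fourierCoef_zero_distr]
  | insert i s hi ih => rw [Finset.sum_insert hi, Finset.sum_insert hi, fourierCoef_add, ih]

theorem mFourier_add_point (ξ : Fin n → ℤ) (t s : Torus n) :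
    UnitAddTorus.mFourier ξ (t + s) = UnitAddTorus.mFourier ξ t * UnitAddTorus.mFourier ξ s := by
  simp [UnitAddTorus.mFourier, smul_add, AddCircle.toCircle_add, Finset.prod_mul_distrib]

theorem mFourier_pi_single (ξ : Fin n → ℤ) (j : Fin n) (h : ℝ) :
    UnitAddTorus.mFourier ξ (Pi.single j (h : UnitAddCircle)) =
      Complex.exp (2 * Real.pi * Complex.I * ξ j * h) := by
  have h1 : UnitAddTorus.mFourier ξ (Pi.single j (h : UnitAddCircle)) =
      fourier (ξ j) (h : UnitAddCircle) := by
    simp only [UnitAddTorus.mFourier, ContinuousMap.coe_mk]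
    rw [Finset.prod_eq_single j]
    · simp
    · intro i _ hij
      simp [Pi.single_eq_of_ne hij]
    · simp
  rw [h1, fourier_coe_apply]
  simp

theorem hasDerivAt_mFourier (ξ : Fin n → ℤ) (j : Fin n) (t : Torus n) :
    HasDerivAt (fun h : ℝ => UnitAddTorus.mFourier ξ (t + Pi.single j (h : UnitAddCircle)))
      (2 * Real.pi * Complex.I * ξ j * UnitAddTorus.mFourier ξ t) 0 := by
  simp only [mFourier_add_point, mFourier_pi_single]
  have h1 : HasDerivAt (fun h : ℝ => Complex.exp (2 * Real.pi * Complex.I * ξ j * h))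
      (Complex.exp (2 * Real.pi * Complex.I * ξ j * (0 : ℝ)) * (2 * Real.pi * Complex.I * ξ j))
      0 := by
    have h2 : HasDerivAt (fun h : ℝ => (2 * Real.pi * Complex.I * ξ j : ℂ) * (h : ℂ))
        (2 * Real.pi * Complex.I * ξ j * 1) 0 :=
      (Complex.ofRealCLM.hasDerivAt (x := (0 : ℝ))).const_mul _
    simpa using h2.cexp
  convert! h1.const_mul (UnitAddTorus.mFourier ξ t) using 1
  simp
  ring

theorem pderiv_cosTest (ξ : Fin n → ℤ) (j : Fin n) :
    TestFun.pderiv j (cosTest ξ) = (-(2 * Real.pi * ξ j)) • sinTest ξ := by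
  apply Subtype.ext
  funext t
  have h := (Complex.reCLM.hasFDerivAt.comp_hasDerivAt (0 : ℝ) (hasDerivAt_mFourier ξ j t)).deriv
  refine h.trans ?_
  simp [sinTest]

theorem pderiv_sinTest (ξ : Fin n → ℤ) (j : Fin n) :
    TestFun.pderiv j (sinTest ξ) = (2 * Real.pi * ξ j) • cosTest ξ := by
  apply Subtype.ext
  funext t
  have h := (Complex.imCLM.hasFDerivAt.comp_hasDerivAt (0 : ℝ) (hasDerivAt_mFourier ξ j t)).deriv
  refine h.trans ?_
  simp [cosTest]

theorem fourierCoef_pderiv (j : Fin n) (T : Distr n) (ξ : Fin n → ℤ) :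
    fourierCoef (Distr.pderiv j T) ξ = 2 * Real.pi * Complex.I * ξ j * fourierCoef T ξ := by
  have h : ∀ φ, (Distr.pderiv j T).1 φ = -T.1 (TestFun.pderiv j φ) := fun φ => rfl
  rw [fourierCoef_eq, fourierCoef_eq, h, h, pderiv_cosTest, pderiv_sinTest]
  simp only [map_smul, smul_eq_mul]
  push_cast
  linear_combination (2 * Real.pi * ξ j * T.1 (sinTest ξ) : ℂ) * Complex.I_sq

/-! ### Calculus of test functions -/

/-- `torusDeriv` only records a derivative at shift zero. Differentiation under the integral needs
the derivative at every shift, which is obtained by moving to the lift on `ℝⁿ`. -/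
theorem hasDerivAt_testFun (φ : TestFun n) (j : Fin n) (t : Torus n) (h : ℝ) :
    HasDerivAt (fun h : ℝ => φ.1 (t + Pi.single j (h : UnitAddCircle)))
      (torusDeriv j φ.1 (t + Pi.single j (h : UnitAddCircle))) h := by
  choose x hx using fun i => QuotientAddGroup.mk_surjective (t i)
  have ht : t = fun i => ((x i : ℝ) : UnitAddCircle) := (funext hx).symm
  have hl : ∀ (ψ : Torus n → ℝ) (h : ℝ), ψ (t + Pi.single j (h : UnitAddCircle)) =
      PeriodicOseen.lift ψ (x + h • Pi.single j (1 : ℝ)) := by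
    intro ψ h
    unfold PeriodicOseen.lift
    congr 1
    funext i
    by_cases hij : i = j
    · subst hij
      simp [ht]
    · simp [ht, hij]
  have hc : ContDiff ℝ ∞ (PeriodicOseen.lift φ.1) := φ.2
  rw [hl (torusDeriv j φ.1) h, lift_torusDeriv_of_contDiff j hc]
  simp only [hl]
  have h1 : HasDerivAt (fun h : ℝ => x + h • (Pi.single j (1 : ℝ) : Fin n → ℝ))
      ((1 : ℝ) • (Pi.single j (1 : ℝ) : Fin n → ℝ)) h :=
    ((hasDerivAt_id h).smul_const _).const_add x
  rw [one_smul] at h1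
  exact ((hc.differentiable (by simp)) _).hasFDerivAt.comp_hasDerivAt h h1

/-- The product of two test functions. -/
def TestFun.mul (φ ψ : TestFun n) : TestFun n :=
  ⟨φ.1 * ψ.1, ContDiff.mul (show ContDiff ℝ ∞ (PeriodicOseen.lift φ.1) from φ.2) ψ.2⟩

theorem torusDeriv_mul (φ ψ : TestFun n) (j : Fin n) (t : Torus n) :
    torusDeriv j (φ.1 * ψ.1) t = torusDeriv j φ.1 t * ψ.1 t + φ.1 t * torusDeriv j ψ.1 t := by
  have h := ((hasDerivAt_testFun φ j t 0).mul (hasDerivAt_testFun ψ j t 0)).deriv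
  simp only [AddCircle.coe_zero, Pi.single_zero, add_zero] at h
  exact h

theorem exists_bound_testFun (φ : TestFun n) : ∃ C, ∀ t, |φ.1 t| ≤ C := by
  obtain ⟨C, hC⟩ := isCompact_univ.exists_bound_of_continuousOn
    (continuous_testFun φ).continuousOn
  exact ⟨C, fun t => hC t (Set.mem_univ t)⟩

theorem integrable_testFun (φ : TestFun n) : Integrable φ.1 (torusMeasure n) := by
  simpa using integrable_mul_testFun (integrable_const (1 : ℝ)) φ

/-- By translation invariance `h ↦ ∫ φ(t + h e_j)` is constant; its derivative at zero, taken under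
the integral, is the integral of `∂_j φ`. -/
theorem integral_pderiv (φ : TestFun n) (j : Fin n) :
    ∫ t, (TestFun.pderiv j φ).1 t ∂torusMeasure n = 0 := by
  obtain ⟨C, hC⟩ := exists_bound_testFun (TestFun.pderiv j φ)
  have hmeas : ∀ (ψ : TestFun n) (h : ℝ), AEStronglyMeasurable
      (fun t => ψ.1 (t + Pi.single j (h : UnitAddCircle))) (torusMeasure n) := fun ψ h =>
    ((continuous_testFun ψ).comp (continuous_add_const _)).aestronglyMeasurable
  have hint : Integrable (fun t => φ.1 (t + Pi.single j ((0 : ℝ) : UnitAddCircle)))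
      (torusMeasure n) := by
    simpa using integrable_testFun φ
  have hb : ∀ᵐ t ∂torusMeasure n, ∀ h ∈ (Set.univ : Set ℝ),
      ‖(TestFun.pderiv j φ).1 (t + Pi.single j (h : UnitAddCircle))‖ ≤ C :=
    Filter.Eventually.of_forall fun t h _ => hC _
  have hd : ∀ᵐ t ∂torusMeasure n, ∀ h ∈ (Set.univ : Set ℝ),
      HasDerivAt (fun h : ℝ => φ.1 (t + Pi.single j (h : UnitAddCircle)))
        ((TestFun.pderiv j φ).1 (t + Pi.single j (h : UnitAddCircle))) h :=
    Filter.Eventually.of_forall fun t h _ => hasDerivAt_testFun φ j t h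
  have h := (hasDerivAt_integral_of_dominated_loc_of_deriv_le (x₀ := (0 : ℝ))
    Filter.univ_mem (Filter.Eventually.of_forall (hmeas φ))
    hint (hmeas (TestFun.pderiv j φ) 0) hb (integrable_const C) hd).2
  have hconst : (fun h : ℝ => ∫ t, φ.1 (t + Pi.single j (h : UnitAddCircle)) ∂torusMeasure n) =
      fun _ => ∫ t, φ.1 t ∂torusMeasure n := by
    funext h
    exact integral_add_right_eq_self φ.1 (Pi.single j (h : UnitAddCircle))
  rw [hconst] at h
  have h0 := h.unique (hasDerivAt_const (0 : ℝ) _)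
  simp only [AddCircle.coe_zero, Pi.single_zero, add_zero] at h0
  exact h0

theorem ofFun_apply {g : Torus n → ℝ} (hg : Integrable g (torusMeasure n)) (φ : TestFun n) :
    (ofFun g).1 φ = ∫ t, g t * φ.1 t ∂torusMeasure n := by
  unfold ofFun
  rw [dif_pos hg]
  rfl

theorem pderiv_ofFun (φ : TestFun n) (j : Fin n) :
    Distr.pderiv j (ofFun φ.1) = ofFun (TestFun.pderiv j φ).1 := by
  apply Subtype.ext
  apply LinearMap.ext
  intro ψ
  change -((ofFun φ.1).1 (TestFun.pderiv j ψ)) = _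
  -- Integration by parts: the two integrals add up to the integral of `∂_j(φψ)`, which vanishes.
  rw [ofFun_apply (integrable_testFun _), ofFun_apply (integrable_testFun _),
    neg_eq_iff_add_eq_zero, ← integral_add, ← integral_pderiv (TestFun.mul φ ψ) j]
  · refine integral_congr_ae (Filter.Eventually.of_forall fun t => ?_)
    change _ = torusDeriv j (φ.1 * ψ.1) t
    rw [torusDeriv_mul]
    exact add_comm _ _
  · exact integrable_mul_testFun (integrable_testFun _) _
  · exact integrable_mul_testFun (integrable_testFun _) _

theorem ofFun_congr {g h : Torus n → ℝ} (hgh : g =ᵐ[torusMeasure n] h) : ofFun g = ofFun h := by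
  by_cases hg : Integrable g (torusMeasure n)
  · apply Subtype.ext
    apply LinearMap.ext
    intro φ
    rw [ofFun_apply hg, ofFun_apply (hg.congr hgh)]
    exact integral_congr_ae (hgh.mul (Filter.EventuallyEq.refl _ _))
  · have hh : ¬ Integrable h (torusMeasure n) := fun hh => hg (hh.congr hgh.symm)
    simp [ofFun, hg, hh]

theorem ofFun_add {g h : Torus n → ℝ} (hg : Integrable g (torusMeasure n))
    (hh : Integrable h (torusMeasure n)) : ofFun (fun t => g t + h t) = ofFun g + ofFun h := by
  apply Subtype.ext
  apply LinearMap.ext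
  intro φ
  change _ = (ofFun g).1 φ + (ofFun h).1 φ
  rw [ofFun_apply (g := fun t => g t + h t) (hg.add hh), ofFun_apply hg, ofFun_apply hh,
    ← integral_add (integrable_mul_testFun hg φ) (integrable_mul_testFun hh φ)]
  simp [add_mul]

theorem ofFun_smul {g : Torus n → ℝ} (hg : Integrable g (torusMeasure n)) (c : ℝ) :
    ofFun (fun t => c * g t) = c • ofFun g := by
  apply Subtype.ext
  apply LinearMap.ext
  intro φ
  change _ = c * (ofFun g).1 φ
  rw [ofFun_apply (hg.const_mul c), ofFun_apply hg, ← integral_const_mul]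
  simp [mul_assoc]

theorem fourierCoef_ofFun {g : Torus n → ℝ} (hg : Integrable g (torusMeasure n))
    (ξ : Fin n → ℤ) : fourierCoef (ofFun g) ξ =
      ∫ t, UnitAddTorus.mFourier (-ξ) t • (g t : ℂ) ∂torusMeasure n := by
  rw [fourierCoef, ofFun_apply hg, ofFun_apply hg, ← integral_complex_ofReal,
    ← integral_complex_ofReal, ← integral_const_mul, ← integral_add]
  · refine integral_congr_ae (Filter.Eventually.of_forall fun t => ?_)
    change ((g t * (UnitAddTorus.mFourier (-ξ) t).re : ℝ) : ℂ) + Complex.I *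
      ((g t * (UnitAddTorus.mFourier (-ξ) t).im : ℝ) : ℂ) = UnitAddTorus.mFourier (-ξ) t * g t
    conv_rhs => rw [← Complex.re_add_im (UnitAddTorus.mFourier (-ξ) t)]
    push_cast
    ring
  · exact (integrable_mul_testFun hg _).ofReal
  · exact (integrable_mul_testFun hg _).ofReal.const_mul _

/-! ### Fourier series of test functions -/

/-- The Fourier coefficients of a test function. -/
def testCoef (φ : TestFun n) (ξ : Fin n → ℤ) : ℂ := fourierCoef (ofFun φ.1) ξ

theorem testCoef_pderiv (φ : TestFun n) (j : Fin n) (ξ : Fin n → ℤ) :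
    testCoef (TestFun.pderiv j φ) ξ = 2 * Real.pi * Complex.I * ξ j * testCoef φ ξ := by
  unfold testCoef
  rw [← pderiv_ofFun, fourierCoef_pderiv]

theorem norm_mFourier_apply (ξ : Fin n → ℤ) (t : Torus n) :
    ‖UnitAddTorus.mFourier ξ t‖ = 1 := by
  simp [UnitAddTorus.mFourier, Circle.norm_coe]

theorem exists_norm_testCoef_le (φ : TestFun n) : ∃ C, ∀ ξ, ‖testCoef φ ξ‖ ≤ C := by
  obtain ⟨C, hC⟩ := exists_bound_testFun φ
  refine ⟨C, fun ξ => ?_⟩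
  unfold testCoef
  rw [fourierCoef_ofFun (integrable_testFun φ)]
  refine (norm_integral_le_of_norm_le_const (C := C)
    (Filter.Eventually.of_forall fun t => ?_)).trans (by simp)
  rw [norm_smul, norm_mFourier_apply, one_mul, Complex.norm_real]
  exact hC t

/-- Induction over coordinates: applying the bound to `∂_j²φ` gains a factor `ξ_j²`. The weight is a
product over coordinates so that the sum of its inverses over `ℤⁿ` factorises into one-dimensional
sums. -/
theorem exists_prod_mul_norm_testCoef_le (s : Finset (Fin n)) (φ : TestFun n) :
    ∃ C, ∀ ξ : Fin n → ℤ, (∏ j ∈ s, (1 + (ξ j : ℝ) ^ 2)) * ‖testCoef φ ξ‖ ≤ C := by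
  classical
  induction s using Finset.induction_on generalizing φ with
  | empty => simpa using exists_norm_testCoef_le φ
  | insert j s hj ih =>
    obtain ⟨C₁, h₁⟩ := ih φ
    obtain ⟨C₂, h₂⟩ := ih (TestFun.pderiv j (TestFun.pderiv j φ))
    refine ⟨C₁ + C₂, fun ξ => ?_⟩
    rw [Finset.prod_insert hj]
    have h3 := h₁ ξ
    have h4 := h₂ ξ
    rw [testCoef_pderiv, testCoef_pderiv] at h4
    simp only [norm_mul, Complex.norm_real, Complex.norm_I, Complex.norm_intCast,
      Complex.norm_ofNat, Real.norm_eq_abs, abs_of_pos Real.pi_pos, mul_one] at h4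
    set P := ∏ i ∈ s, (1 + (ξ i : ℝ) ^ 2)
    have hP : 0 ≤ P := Finset.prod_nonneg fun i _ => by positivity
    have h5 : P * ((ξ j : ℝ) ^ 2 * ‖testCoef φ ξ‖) ≤ C₂ := by
      refine le_trans (mul_le_mul_of_nonneg_left ?_ hP) h4
      have h6 : 1 ≤ 2 * Real.pi := by linarith [Real.pi_gt_three]
      have h7 : 1 ≤ (2 * Real.pi) ^ 2 := one_le_pow₀ h6
      have h8 : 0 ≤ (ξ j : ℝ) ^ 2 * ‖testCoef φ ξ‖ := by positivity
      calc _ ≤ (2 * Real.pi) ^ 2 * ((ξ j : ℝ) ^ 2 * ‖testCoef φ ξ‖) :=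
            le_mul_of_one_le_left h8 h7
        _ = _ := by rw [← sq_abs (ξ j : ℝ)]; ring
    calc _ = P * ‖testCoef φ ξ‖ + P * ((ξ j : ℝ) ^ 2 * ‖testCoef φ ξ‖) := by ring
      _ ≤ _ := add_le_add h3 h5

theorem summable_inv_prod_one_add_sq :
    Summable fun ξ : Fin n → ℤ => (∏ j, (1 + (ξ j : ℝ) ^ 2))⁻¹ := by
  classical
  have h1 : Summable fun k : ℤ => (1 + (k : ℝ) ^ 2)⁻¹ := by
    -- In Lean `1 / 0 ^ 2 = 0`, so the majorant needs an extra `1` at `k = 0`.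
    refine Summable.of_nonneg_of_le (fun k => by positivity) (fun k => ?_)
      (((Real.summable_one_div_int_pow (p := 2)).2 one_lt_two).add
        ((hasSum_ite_eq (0 : ℤ) (1 : ℝ)).summable))
    by_cases hk : k = 0
    · simp [hk]
    · have : (0 : ℝ) < (k : ℝ) ^ 2 := by positivity
      simp only [hk, if_false, add_zero, one_div]
      exact inv_anti₀ this (by linarith)
  -- A finite set of frequencies lies in the product of its coordinate projections, and the sum over
  -- that product is a product of partial sums.
  refine summable_of_sum_le (c := ∏ _j : Fin n, ∑' k : ℤ, (1 + (k : ℝ) ^ 2)⁻¹)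
    (fun ξ => by positivity) fun F => ?_
  calc ∑ ξ ∈ F, (∏ j, (1 + (ξ j : ℝ) ^ 2))⁻¹
      ≤ ∑ ξ ∈ Fintype.piFinset fun j => F.image fun ξ : Fin n → ℤ => ξ j,
          (∏ j, (1 + (ξ j : ℝ) ^ 2))⁻¹ := by
        refine Finset.sum_le_sum_of_subset_of_nonneg (fun ξ hξ => ?_)
          (fun ξ _ _ => by positivity)
        rw [Fintype.mem_piFinset]
        exact fun j => Finset.mem_image_of_mem _ hξ
    _ = ∏ j, ∑ k ∈ F.image fun ξ : Fin n → ℤ => ξ j, (1 + (k : ℝ) ^ 2)⁻¹ := by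
        rw [Finset.prod_univ_sum]
        simp_rw [Finset.prod_inv_distrib]
    _ ≤ _ := Finset.prod_le_prod (fun j _ => Finset.sum_nonneg fun k _ => by positivity)
        fun j _ => h1.sum_le_tsum _ fun k _ => by positivity

theorem summable_norm_testCoef (φ : TestFun n) : Summable fun ξ => ‖testCoef φ ξ‖ := by
  obtain ⟨C, hC⟩ := exists_prod_mul_norm_testCoef_le Finset.univ φ
  refine Summable.of_nonneg_of_le (fun ξ => norm_nonneg _) (fun ξ => ?_)
    (summable_inv_prod_one_add_sq.mul_left C)
  have hP : 0 < ∏ j, (1 + (ξ j : ℝ) ^ 2) := Finset.prod_pos fun i _ => by positivity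
  rw [← div_eq_mul_inv, le_div_iff₀ hP, mul_comm]
  exact hC ξ

/-- A test function as a continuous complex function. -/
def testContinuousMap (φ : TestFun n) : C(Torus n, ℂ) :=
  ⟨fun t => (φ.1 t : ℂ), Complex.continuous_ofReal.comp (continuous_testFun φ)⟩

theorem testCoef_eq (φ : TestFun n) (ξ : Fin n → ℤ) :
    testCoef φ ξ = UnitAddTorus.mFourierCoeff (testContinuousMap φ) ξ :=
  fourierCoef_ofFun (integrable_testFun φ) ξ

theorem hasSum_testCoef_smul_mFourier (φ : TestFun n) :
    HasSum (fun ξ => testCoef φ ξ • (UnitAddTorus.mFourier ξ : C(Torus n, ℂ)))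
      (testContinuousMap φ) := by
  have h := UnitAddTorus.hasSum_mFourier_series_of_summable (f := (testContinuousMap φ))
    ((summable_norm_testCoef φ).of_norm.congr (testCoef_eq φ))
  simpa only [← testCoef_eq φ] using h

/-- The real trigonometric polynomial `Re ∑_{ξ ∈ F} c(ξ) exp (2πi x·ξ)`. -/
def trigPoly (F : Finset (Fin n → ℤ)) (c : (Fin n → ℤ) → ℂ) : TestFun n :=
  ∑ ξ ∈ F, ((c ξ).re • cosTest ξ - (c ξ).im • sinTest ξ)

theorem trigPoly_apply (F : Finset (Fin n → ℤ)) (c : (Fin n → ℤ) → ℂ) (t : Torus n) :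
    (trigPoly F c).1 t = (∑ ξ ∈ F, c ξ * UnitAddTorus.mFourier ξ t).re := by
  simp [trigPoly, cosTest, sinTest]

theorem pderiv_trigPoly (F : Finset (Fin n → ℤ)) (c : (Fin n → ℤ) → ℂ) (j : Fin n) :
    TestFun.pderiv j (trigPoly F c) =
      trigPoly F fun ξ => 2 * Real.pi * Complex.I * ξ j * c ξ := by
  simp only [trigPoly, map_sum, map_sub, map_smul, pderiv_cosTest, pderiv_sinTest]
  refine Finset.sum_congr rfl fun ξ _ => ?_
  simp only [smul_smul, Complex.mul_re, Complex.mul_im, Complex.I_re, Complex.I_im,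
    Complex.ofReal_re, Complex.ofReal_im, Complex.intCast_re, Complex.intCast_im, Complex.re_ofNat,
    Complex.im_ofNat]
  module

/-- Taking partial Fourier sums commutes with differentiation. Uniform convergence of the Fourier
series of every derivative therefore gives convergence of the partial sums in the topology of test
functions. -/
theorem iterDeriv_trigPoly_coef (F : Finset (Fin n → ℤ)) (φ : TestFun n) (l : List (Fin n)) :
    TestFun.iterDeriv l (trigPoly F (testCoef φ)) = trigPoly F (testCoef (TestFun.iterDeriv l φ)) := by
  induction l with
  | nil => rfl
  | cons j l ih =>
    change TestFun.pderiv j (TestFun.iterDeriv l (trigPoly F (testCoef φ))) =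
      trigPoly F (testCoef (TestFun.pderiv j (TestFun.iterDeriv l φ)))
    rw [ih, pderiv_trigPoly]
    congr 1
    funext ξ
    rw [testCoef_pderiv]

theorem iterDeriv_sub (φ ψ : TestFun n) (l : List (Fin n)) :
    TestFun.iterDeriv l (φ - ψ) = TestFun.iterDeriv l φ - TestFun.iterDeriv l ψ := by
  induction l with
  | nil => rfl
  | cons j l ih =>
    change TestFun.pderiv j (TestFun.iterDeriv l (φ - ψ)) =
      TestFun.pderiv j (TestFun.iterDeriv l φ) - TestFun.pderiv j (TestFun.iterDeriv l ψ)
    rw [ih, map_sub]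

theorem distr_trigPoly (T : Distr n) (F : Finset (Fin n → ℤ)) (c : (Fin n → ℤ) → ℂ) :
    T.1 (trigPoly F c) = ∑ ξ ∈ F, (fourierCoef T ξ * conj (c ξ)).re := by
  simp only [trigPoly, map_sum, map_sub, map_smul, fourierCoef_eq]
  refine Finset.sum_congr rfl fun ξ _ => ?_
  simp
  ring

/-- The value of a distribution at a test function through Fourier coefficients. -/
theorem hasSum_distr_apply (T : Distr n) (φ : TestFun n) :
    HasSum (fun ξ => (fourierCoef T ξ * conj (testCoef φ ξ)).re) (T.1 φ) := by
  obtain ⟨N, C, hT⟩ := T.2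
  -- The definition of boundedness does not fix the sign of `C`; testing with `φ = 0` and `M = 1`
  -- does.
  have hC : 0 ≤ C := by
    have h1 := hT 0 1 fun l _ t => by
      have : TestFun.iterDeriv l (0 : TestFun n) = 0 := by
        simpa using iterDeriv_sub (0 : TestFun n) 0 l
      rw [this]
      simp
    simpa using h1
  unfold HasSum
  simp_rw [← distr_trigPoly]
  rw [SummationFilter.unconditional_filter, Metric.tendsto_nhds]
  intro ε hε
  -- Only finitely many derivatives of order at most `N` occur, so one finite set of frequencies
  -- serves them all. The denominator `C + 1` covers the case `C = 0`.
  have hev : ∀ᶠ F : Finset (Fin n → ℤ) in Filter.atTop, ∀ l ∈ {l : List (Fin n) | l.length ≤ N},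
      ‖∑ ξ ∈ F, testCoef (TestFun.iterDeriv l φ) ξ • (UnitAddTorus.mFourier ξ : C(Torus n, ℂ)) -
        (testContinuousMap (TestFun.iterDeriv l φ))‖ < ε / (C + 1) := by
    rw [Filter.eventually_all_finite (List.finite_length_le (Fin n) N)]
    intro l _
    have h := hasSum_testCoef_smul_mFourier (TestFun.iterDeriv l φ)
    unfold HasSum at h
    rw [SummationFilter.unconditional_filter, Metric.tendsto_nhds] at h
    simpa [dist_eq_norm] using h (ε / (C + 1)) (by positivity)
  filter_upwards [hev] with F hF
  rw [Real.dist_eq, ← map_sub]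
  refine lt_of_le_of_lt (hT (trigPoly F (testCoef φ) - φ) (ε / (C + 1)) fun l hl t => ?_) ?_
  · rw [iterDeriv_sub, iterDeriv_trigPoly_coef]
    change |(trigPoly F (testCoef (TestFun.iterDeriv l φ))).1 t - (TestFun.iterDeriv l φ).1 t| ≤ _
    rw [trigPoly_apply]
    refine le_trans ?_ (hF l hl).le
    refine le_trans ?_ (ContinuousMap.norm_coe_le_norm _ t)
    refine le_trans (le_of_eq ?_) (Complex.abs_re_le_norm _)
    simp [testContinuousMap]
  · rw [mul_div_assoc', div_lt_iff₀ (by positivity)]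
    nlinarith

theorem distr_ext_fourierCoef {S T : Distr n} (h : ∀ ξ, fourierCoef S ξ = fourierCoef T ξ) :
    S = T := by
  apply Subtype.ext
  apply LinearMap.ext
  intro φ
  refine (hasSum_distr_apply S φ).unique ?_
  simp_rw [h]
  exact hasSum_distr_apply T φ

/-! ### Square integrable functions -/

theorem integrable_of_memLp_two {g : Torus n → ℝ} (hg : MemLp g 2 (torusMeasure n)) :
    Integrable g (torusMeasure n) := hg.integrable (by norm_num)

theorem memLp_complex_ofReal {g : Torus n → ℝ} {p : ℝ≥0∞} (hg : MemLp g p (torusMeasure n)) :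
    MemLp (fun t => (g t : ℂ)) p (torusMeasure n) := hg.ofReal

theorem fourierCoef_ofFun_eq_mFourierCoeff {g : Torus n → ℝ} (hg : MemLp g 2 (torusMeasure n))
    (ξ : Fin n → ℤ) : fourierCoef (ofFun g) ξ =
      UnitAddTorus.mFourierCoeff (MemLp.toLp (fun t => (g t : ℂ)) (memLp_complex_ofReal hg)) ξ := by
  rw [fourierCoef_ofFun (integrable_of_memLp_two hg)]
  refine integral_congr_ae ?_
  filter_upwards [MemLp.coeFn_toLp (memLp_complex_ofReal hg)] with t ht
  rw [ht]

/-- Parseval's identity. -/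
theorem hasSum_conj_fourierCoef_mul {g h : Torus n → ℝ} (hg : MemLp g 2 (torusMeasure n))
    (hh : MemLp h 2 (torusMeasure n)) :
    HasSum (fun ξ => conj (fourierCoef (ofFun g) ξ) * fourierCoef (ofFun h) ξ)
      ((∫ t, g t * h t ∂torusMeasure n : ℝ) : ℂ) := by
  simp_rw [fourierCoef_ofFun_eq_mFourierCoeff hg, fourierCoef_ofFun_eq_mFourierCoeff hh]
  convert! UnitAddTorus.hasSum_prod_mFourierCoeff (MemLp.toLp (fun t => (g t : ℂ)) (memLp_complex_ofReal hg))
    (MemLp.toLp (fun t => (h t : ℂ)) (memLp_complex_ofReal hh)) using 1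
  rw [← integral_complex_ofReal]
  refine integral_congr_ae ?_
  filter_upwards [MemLp.coeFn_toLp (memLp_complex_ofReal hg), MemLp.coeFn_toLp (memLp_complex_ofReal hh)]
    with t ht ht'
  rw [ht, ht']
  simp

theorem hasSum_norm_sq_fourierCoef {g : Torus n → ℝ} (hg : MemLp g 2 (torusMeasure n)) :
    HasSum (fun ξ => ‖fourierCoef (ofFun g) ξ‖ ^ 2) (∫ t, g t ^ 2 ∂torusMeasure n) := by
  have h := Complex.hasSum_re (hasSum_conj_fourierCoef_mul hg hg)
  simp only [Complex.ofReal_re, ← Complex.normSq_eq_conj_mul_self, Complex.normSq_eq_norm_sq]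
    at h
  simpa [sq] using h

theorem hasSum_norm_sq_fourierCoef_Lp (g : Lp ℝ 2 (torusMeasure n)) :
    HasSum (fun ξ => ‖fourierCoef (ofFun g) ξ‖ ^ 2) (‖g‖ ^ 2) := by
  convert! hasSum_norm_sq_fourierCoef (Lp.memLp g) using 1
  rw [← real_inner_self_eq_norm_sq, L2.inner_def]
  refine integral_congr_ae (Filter.Eventually.of_forall fun t => ?_)
  simp [sq]

theorem ofFun_sub_Lp (g h : Lp ℝ 2 (torusMeasure n)) :
    ofFun ((g - h : Lp ℝ 2 (torusMeasure n)) : Torus n → ℝ) = ofFun g - ofFun h := by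
  have hg := integrable_of_memLp_two (Lp.memLp g)
  have hh := integrable_of_memLp_two (Lp.memLp h)
  have h1 := ofFun_add hg (hh.const_mul (-1))
  rw [ofFun_smul hh] at h1
  rw [show ofFun g - ofFun h = ofFun g + (-1 : ℝ) • ofFun h by module, ← h1]
  apply ofFun_congr
  filter_upwards [Lp.coeFn_sub g h] with t ht
  rw [ht, Pi.sub_apply]
  ring

theorem ofFun_add_Lp (g h : Lp ℝ 2 (torusMeasure n)) :
    ofFun ((g + h : Lp ℝ 2 (torusMeasure n)) : Torus n → ℝ) = ofFun g + ofFun h := by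
  rw [← ofFun_add (integrable_of_memLp_two (Lp.memLp g)) (integrable_of_memLp_two (Lp.memLp h))]
  exact ofFun_congr (Lp.coeFn_add g h)

theorem ofFun_smul_Lp (c : ℝ) (g : Lp ℝ 2 (torusMeasure n)) :
    ofFun ((c • g : Lp ℝ 2 (torusMeasure n)) : Torus n → ℝ) = c • ofFun g := by
  rw [← ofFun_smul (integrable_of_memLp_two (Lp.memLp g))]
  exact ofFun_congr (Lp.coeFn_smul c g)

theorem ofFun_Lp_injective {g h : Lp ℝ 2 (torusMeasure n)}
    (hgh : ofFun (g : Torus n → ℝ) = ofFun h) : g = h := by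
  have h1 := hasSum_norm_sq_fourierCoef_Lp (g - h)
  simp only [ofFun_sub_Lp, hgh, fourierCoef_sub, sub_self, norm_zero, ne_eq, OfNat.ofNat_ne_zero, not_false_eq_true,
    zero_pow] at h1
  have h2 := h1.unique hasSum_zero
  exact sub_eq_zero.1 (norm_eq_zero.1 (pow_eq_zero_iff two_ne_zero |>.1 h2))

/-- The Riesz–Fischer theorem for real functions. -/
theorem exists_Lp_fourierCoef_eq {c : (Fin n → ℤ) → ℂ} (hc : ∀ ξ, c (-ξ) = conj (c ξ))
    (hs : Summable fun ξ => ‖c ξ‖ ^ 2) :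
    ∃ g : Lp ℝ 2 (torusMeasure n), ∀ ξ, fourierCoef (ofFun g) ξ = c ξ := by
  have hmem : Memℓp c 2 := memℓp_gen (by simpa using hs)
  let f : Lp ℂ 2 (torusMeasure n) := UnitAddTorus.mFourierBasis.repr.symm ⟨c, hmem⟩
  have hf : ∀ ξ, ∫ t, UnitAddTorus.mFourier (-ξ) t • f t ∂torusMeasure n = c ξ := by
    intro ξ
    have h1 := UnitAddTorus.mFourierBasis_repr f ξ
    rw [show UnitAddTorus.mFourierBasis.repr f = ⟨c, hmem⟩ from
      LinearIsometryEquiv.apply_symm_apply _ _] at h1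
    exact h1.symm
  have hfi : Integrable f (torusMeasure n) := (Lp.memLp f).integrable (by norm_num)
  have hfm : ∀ ξ, Integrable (fun t => UnitAddTorus.mFourier ξ t * f t) (torusMeasure n) := by
    intro ξ
    refine hfi.bdd_mul (c := 1) (UnitAddTorus.mFourier ξ).continuous.aestronglyMeasurable
      (Filter.Eventually.of_forall fun t => ?_)
    rw [norm_mFourier_apply]
  -- The coefficients of `Re f` are `(c(ξ) + conj c(-ξ)) / 2`, and this equals `c(ξ)` by the
  -- Hermitian symmetry.
  have hre : MemLp (fun t => (f t).re) 2 (torusMeasure n) := (Lp.memLp f).re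
  refine ⟨hre.toLp _, fun ξ => ?_⟩
  rw [ofFun_congr hre.coeFn_toLp, fourierCoef_ofFun (integrable_of_memLp_two hre)]
  have h2 : ∫ t, conj (UnitAddTorus.mFourier ξ t * f t) ∂torusMeasure n = c ξ := by
    rw [integral_conj]
    have h3 := hf (-ξ)
    simp only [neg_neg, smul_eq_mul, hc] at h3
    rw [h3, Complex.conj_conj]
  have h4 : ∫ t, (1 / 2 : ℂ) * (UnitAddTorus.mFourier (-ξ) t * f t) +
      (1 / 2 : ℂ) * conj (UnitAddTorus.mFourier ξ t * f t) ∂torusMeasure n = c ξ := by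
    rw [integral_add ((hfm (-ξ)).const_mul _), integral_const_mul, integral_const_mul, h2]
    · have h5 := hf ξ
      simp only [smul_eq_mul] at h5
      rw [h5]
      ring
    · exact (Complex.conjCLE.toContinuousLinearMap.integrable_comp (hfm ξ)).const_mul _
  rw [← h4]
  refine integral_congr_ae (Filter.Eventually.of_forall fun t => ?_)
  simp only [smul_eq_mul, map_mul, ← UnitAddTorus.mFourier_neg, Complex.re_eq_add_conj]
  ring

theorem exists_ofFun_eq {T : Distr n} (hT : Summable fun ξ => ‖fourierCoef T ξ‖ ^ 2) :
    ∃ g : Lp ℝ 2 (torusMeasure n), ofFun g = T := by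
  obtain ⟨g, hg⟩ := exists_Lp_fourierCoef_eq (fourierCoef_neg T) hT
  exact ⟨g, distr_ext_fourierCoef hg⟩

theorem ofFun_toL2 {T : Distr n} (hT : Summable fun ξ => ‖fourierCoef T ξ‖ ^ 2) :
    ofFun (toL2 T) = T := by
  have h := exists_ofFun_eq hT
  unfold toL2
  rw [dif_pos h]
  exact h.choose_spec

theorem toL2_ofFun (g : Lp ℝ 2 (torusMeasure n)) : toL2 (ofFun g) = g :=
  ofFun_Lp_injective (ofFun_toL2 (hasSum_norm_sq_fourierCoef_Lp g).summable)

theorem norm_toL2_sq {T : Distr n} (hT : Summable fun ξ => ‖fourierCoef T ξ‖ ^ 2) :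
    ‖toL2 T‖ ^ 2 = ∑' ξ, ‖fourierCoef T ξ‖ ^ 2 := by
  have h := (hasSum_norm_sq_fourierCoef_Lp (toL2 T)).tsum_eq
  rw [ofFun_toL2 hT] at h
  exact h.symm

theorem toL2_add {S T : Distr n} (hS : Summable fun ξ => ‖fourierCoef S ξ‖ ^ 2)
    (hT : Summable fun ξ => ‖fourierCoef T ξ‖ ^ 2) : toL2 (S + T) = toL2 S + toL2 T := by
  rw [← toL2_ofFun (toL2 S + toL2 T), ofFun_add_Lp, ofFun_toL2 hS, ofFun_toL2 hT]

theorem toL2_smul {T : Distr n} (c : ℝ)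
    (hT : Summable fun ξ => ‖fourierCoef T ξ‖ ^ 2) : toL2 (c • T) = c • toL2 T := by
  rw [← toL2_ofFun (c • toL2 T), ofFun_smul_Lp, ofFun_toL2 hT]

/-! ### Elements of Sobolev spaces with prescribed Fourier coefficients -/

theorem rho_sq (ξ : Fin n → ℤ) : rho ξ ^ 2 = 1 + ∑ j, (ξ j : ℝ) ^ 2 :=
  Real.sq_sqrt (by positivity)

theorem one_le_rho (ξ : Fin n → ℤ) : 1 ≤ rho ξ := by
  rw [rho, Real.one_le_sqrt]
  have : 0 ≤ ∑ j, (ξ j : ℝ) ^ 2 := by positivity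
  linarith

theorem rho_pos (ξ : Fin n → ℤ) : 0 < rho ξ := zero_lt_one.trans_le (one_le_rho ξ)

theorem rho_neg (ξ : Fin n → ℤ) : rho (-ξ) = rho ξ := by simp [rho]

theorem memSobolev_one_iff {T : Distr n} :
    MemSobolev 1 T ↔ Summable fun ξ => rho ξ ^ 2 * ‖fourierCoef T ξ‖ ^ 2 := by
  simp [MemSobolev]

theorem rho_rpow_neg_one (ξ : Fin n → ℤ) : rho ξ ^ (2 * (-1) : ℝ) = (rho ξ ^ 2)⁻¹ := by
  rw [show (2 * (-1) : ℝ) = -((2 : ℕ) : ℝ) by norm_num, Real.rpow_neg (rho_nonneg ξ),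
    Real.rpow_natCast]

theorem memSobolev_neg_one_iff {T : Distr n} :
    MemSobolev (-1) T ↔ Summable fun ξ => (rho ξ ^ 2)⁻¹ * ‖fourierCoef T ξ‖ ^ 2 := by
  unfold MemSobolev
  simp_rw [rho_rpow_neg_one]

theorem sobolevNorm_one_sq (T : Distr n) :
    sobolevNorm 1 T ^ 2 = ∑' ξ, rho ξ ^ 2 * ‖fourierCoef T ξ‖ ^ 2 := by
  unfold sobolevNorm
  rw [Real.sq_sqrt]
  · simp
  · exact tsum_nonneg fun ξ => by have := rho_nonneg ξ; positivity

theorem sobolevNorm_neg_one_sq (T : Distr n) :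
    sobolevNorm (-1) T ^ 2 = ∑' ξ, (rho ξ ^ 2)⁻¹ * ‖fourierCoef T ξ‖ ^ 2 := by
  unfold sobolevNorm
  rw [Real.sq_sqrt]
  · simp_rw [rho_rpow_neg_one]
  · exact tsum_nonneg fun ξ => by have := rho_nonneg ξ; positivity

theorem sobolevNorm_nonneg (s : ℝ) (T : Distr n) : 0 ≤ sobolevNorm s T := Real.sqrt_nonneg _

theorem exists_HDot_one {c : (Fin n → ℤ) → ℂ} (hc : ∀ ξ, c (-ξ) = conj (c ξ)) (h0 : c 0 = 0)
    (hs : Summable fun ξ => rho ξ ^ 2 * ‖c ξ‖ ^ 2) :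
    ∃ u : HDot n 1, ∀ ξ, fourierCoef (u : Distr n) ξ = c ξ := by
  obtain ⟨g, hg⟩ := exists_Lp_fourierCoef_eq hc (Summable.of_nonneg_of_le
    (fun ξ => by positivity) (fun ξ => le_mul_of_one_le_left (by positivity)
      (one_le_pow₀ (one_le_rho ξ))) hs)
  refine ⟨⟨ofFun g, ?_, ?_⟩, hg⟩
  · rw [memSobolev_one_iff]
    simpa only [hg] using hs
  · rw [hg, h0]

theorem fourierCoef_zero_ofFun {g : Torus n → ℝ} (hg : Integrable g (torusMeasure n)) :
    fourierCoef (ofFun g) 0 = ((∫ t, g t ∂torusMeasure n : ℝ) : ℂ) := by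
  rw [fourierCoef_ofFun hg, neg_zero, UnitAddTorus.mFourier_zero, ← integral_complex_ofReal]
  simp

theorem fourierCoef_l2Distr_zero (p : L2Dot n) : fourierCoef (l2Distr p) 0 = 0 := by
  unfold l2Distr
  rw [fourierCoef_zero_ofFun (integrable_of_memLp_two (Lp.memLp _))]
  exact_mod_cast p.2

theorem exists_L2Dot {c : (Fin n → ℤ) → ℂ} (hc : ∀ ξ, c (-ξ) = conj (c ξ)) (h0 : c 0 = 0)
    (hs : Summable fun ξ => ‖c ξ‖ ^ 2) :
    ∃ p : L2Dot n, ∀ ξ, fourierCoef (l2Distr p) ξ = c ξ := by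
  obtain ⟨g, hg⟩ := exists_Lp_fourierCoef_eq hc hs
  refine ⟨⟨g, ?_⟩, hg⟩
  have h1 := hg 0
  rw [fourierCoef_zero_ofFun (integrable_of_memLp_two (Lp.memLp _)), h0] at h1
  exact_mod_cast h1

theorem exists_l2Distr_eq {T : Distr n} (h0 : fourierCoef T 0 = 0)
    (hT : Summable fun ξ => ‖fourierCoef T ξ‖ ^ 2) : ∃ p : L2Dot n, l2Distr p = T := by
  obtain ⟨p, hp⟩ := exists_L2Dot (fourierCoef_neg T) h0 hT
  exact ⟨p, distr_ext_fourierCoef hp⟩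

theorem l2Distr_injective {p q : L2Dot n} (h : l2Distr p = l2Distr q) : p = q :=
  Subtype.ext (ofFun_Lp_injective h)

theorem hasSum_l2Distr (p : L2Dot n) :
    HasSum (fun ξ => ‖fourierCoef (l2Distr p) ξ‖ ^ 2) (‖p‖ ^ 2) :=
  hasSum_norm_sq_fourierCoef_Lp (p : Lp ℝ 2 (torusMeasure n))

theorem l2Distr_add (p q : L2Dot n) : l2Distr (p + q) = l2Distr p + l2Distr q :=
  ofFun_add_Lp _ _

theorem l2Distr_smul (c : ℝ) (p : L2Dot n) : l2Distr (c • p) = c • l2Distr p :=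
  ofFun_smul_Lp _ _

/-! ### Fourier coefficients of trigonometric polynomials -/

theorem integral_mFourier (ξ : Fin n → ℤ) :
    ∫ t, UnitAddTorus.mFourier ξ t ∂torusMeasure n = if ξ = 0 then 1 else 0 := by
  have h := orthonormal_iff_ite.1 (UnitAddTorus.orthonormal_mFourier (d := Fin n)) 0 ξ
  simp only [ContinuousMap.inner_toLp] at h
  rw [show (if ξ = 0 then (1 : ℂ) else 0) = if 0 = ξ then 1 else 0 by simp [eq_comm], ← h]
  refine integral_congr_ae (Filter.Eventually.of_forall fun t => ?_)
  simp [UnitAddTorus.mFourier_zero]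

/-- The real part mixes `c(ξ)` with the conjugate of `c(-ξ)`, each with weight one half. For
symmetric `F` and Hermitian `c` the two halves coincide, which is why all truncations below run over
symmetric sets of frequencies. -/
theorem testCoef_trigPoly (F : Finset (Fin n → ℤ)) (c : (Fin n → ℤ) → ℂ) (ξ : Fin n → ℤ) :
    testCoef (trigPoly F c) ξ = ((if ξ ∈ F then c ξ else 0) +
      (if -ξ ∈ F then conj (c (-ξ)) else 0)) / 2 := by
  have hi : ∀ ξ, Integrable (UnitAddTorus.mFourier ξ) (torusMeasure n) := fun ξ =>
    ((integrable_const (1 : ℝ)).mono' (UnitAddTorus.mFourier ξ).continuous.aestronglyMeasurable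
      (Filter.Eventually.of_forall fun t => (norm_mFourier_apply ξ t).le))
  unfold testCoef
  rw [fourierCoef_ofFun (integrable_testFun _)]
  have h1 : ∀ t, UnitAddTorus.mFourier (-ξ) t • (((trigPoly F c).1 t : ℝ) : ℂ) =
      ∑ η ∈ F, (c η / 2 * UnitAddTorus.mFourier (η - ξ) t +
        conj (c η) / 2 * UnitAddTorus.mFourier (-η - ξ) t) := by
    intro t
    rw [trigPoly_apply, Complex.re_eq_add_conj, map_sum, ← Finset.sum_add_distrib, smul_eq_mul,
      Finset.sum_div, Finset.mul_sum]
    refine Finset.sum_congr rfl fun η _ => ?_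
    simp only [sub_eq_add_neg, UnitAddTorus.mFourier_add, map_mul, UnitAddTorus.mFourier_neg]
    ring
  simp_rw [h1]
  have hI : ∀ η ∈ F, Integrable (fun t => c η / 2 * UnitAddTorus.mFourier (η - ξ) t +
      conj (c η) / 2 * UnitAddTorus.mFourier (-η - ξ) t) (torusMeasure n) := fun η _ =>
    ((hi _).const_mul _).add ((hi _).const_mul _)
  rw [integral_finsetSum F hI]
  simp_rw [integral_add ((hi _).const_mul _) ((hi _).const_mul _), integral_const_mul,
    integral_mFourier]
  rw [Finset.sum_add_distrib, add_div]
  congr 1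
  · simp only [mul_ite, mul_one, mul_zero, sub_eq_zero, Finset.sum_ite_eq']
    split_ifs <;> simp
  · simp_rw [show ∀ η : Fin n → ℤ, -η - ξ = 0 ↔ η = -ξ from fun η => by
      rw [sub_eq_zero, neg_eq_iff_eq_neg]]
    simp only [mul_ite, mul_one, mul_zero, Finset.sum_ite_eq']
    split_ifs <;> simp

theorem testCoef_trigPoly_of_symm {F : Finset (Fin n → ℤ)} (hF : ∀ ξ, -ξ ∈ F ↔ ξ ∈ F)
    {c : (Fin n → ℤ) → ℂ} (hc : ∀ ξ, c (-ξ) = conj (c ξ)) (ξ : Fin n → ℤ) :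
    testCoef (trigPoly F c) ξ = if ξ ∈ F then c ξ else 0 := by
  rw [testCoef_trigPoly, hc]
  simp only [hF, Complex.conj_conj]
  ring

theorem exists_symm_finset (F : Finset (Fin n → ℤ)) :
    ∃ G : Finset (Fin n → ℤ), F ⊆ G ∧ ∀ ξ, -ξ ∈ G ↔ ξ ∈ G := by
  classical
  refine ⟨F ∪ F.image Neg.neg, Finset.subset_union_left, fun ξ => ?_⟩
  simp only [Finset.mem_union, Finset.mem_image, neg_inj, exists_eq_right]
  rw [or_comm]
  refine or_congr Iff.rfl ⟨fun h => ⟨-ξ, h, neg_neg ξ⟩, ?_⟩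
  rintro ⟨η, hη, rfl⟩
  simpa using hη

/-! ### Duality of Sobolev spaces -/

theorem summable_mul_of_summable_sq {ι : Type*} {a b : ι → ℝ} (ha : Summable fun i => a i ^ 2)
    (hb : Summable fun i => b i ^ 2) : Summable fun i => a i * b i := by
  refine Summable.of_norm_bounded (ha.add hb) fun i => ?_
  rw [Real.norm_eq_abs, abs_mul]
  nlinarith [sq_nonneg (|a i| - |b i|), sq_abs (a i), sq_abs (b i), abs_nonneg (a i),
    abs_nonneg (b i)]

theorem abs_tsum_mul_le {ι : Type*} {a b : ι → ℝ} (ha : Summable fun i => a i ^ 2)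
    (hb : Summable fun i => b i ^ 2) :
    |∑' i, a i * b i| ≤ √(∑' i, a i ^ 2) * √(∑' i, b i ^ 2) := by
  have h := summable_mul_of_summable_sq ha hb
  have h1 : |∑' i, a i * b i| ≤ ∑' i, |a i * b i| := by
    simpa [Real.norm_eq_abs] using norm_tsum_le_tsum_norm h.norm
  refine h1.trans (h.abs.tsum_le_of_sum_le fun F => ?_)
  calc ∑ i ∈ F, |a i * b i| = ∑ i ∈ F, |a i| * |b i| := by simp [abs_mul]
    _ ≤ √(∑ i ∈ F, |a i| ^ 2) * √(∑ i ∈ F, |b i| ^ 2) := Real.sum_mul_le_sqrt_mul_sqrt _ _ _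
    _ ≤ _ := by
      simp only [sq_abs]
      gcongr
      · exact ha.sum_le_tsum _ fun i _ => sq_nonneg _
      · exact hb.sum_le_tsum _ fun i _ => sq_nonneg _

theorem summable_norm_fourierCoef_mul {s : ℝ} {g f : Distr n} (hg : MemSobolev (-s) g)
    (hf : MemSobolev s f) : Summable fun ξ => ‖fourierCoef g ξ‖ * ‖fourierCoef f ξ‖ := by
  have h1 : ∀ ξ : Fin n → ℤ, rho ξ ^ (2 * s) = (rho ξ ^ s) ^ 2 := fun ξ => by
    rw [← Real.rpow_natCast, ← Real.rpow_mul (rho_nonneg ξ)]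
    congr 1
    push_cast
    ring
  have h2 : ∀ ξ : Fin n → ℤ, rho ξ ^ (2 * -s) = (rho ξ ^ (-s)) ^ 2 := fun ξ => by
    rw [← Real.rpow_natCast, ← Real.rpow_mul (rho_nonneg ξ)]
    congr 1
    push_cast
    ring
  unfold MemSobolev at hg hf
  simp_rw [h1, ← mul_pow] at hf
  simp_rw [h2, ← mul_pow] at hg
  refine (summable_mul_of_summable_sq hg hf).congr fun ξ => ?_
  have h3 : rho ξ ^ (-s) * rho ξ ^ s = 1 := by
    rw [← Real.rpow_add (rho_pos ξ), neg_add_cancel, Real.rpow_zero]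
  linear_combination (‖fourierCoef g ξ‖ * ‖fourierCoef f ξ‖) * h3

/-- `dualPair` is the real part of a `tsum`, which would be zero by default without summability.
Membership in dual Sobolev spaces makes the series absolutely convergent, so the pairing is an
honest sum of real terms. -/
theorem hasSum_dualPair {s : ℝ} {g f : Distr n} (hg : MemSobolev (-s) g)
    (hf : MemSobolev s f) :
    HasSum (fun ξ => (fourierCoef g ξ * conj (fourierCoef f ξ)).re) (dualPair g f) := by
  have h : Summable fun ξ => fourierCoef g ξ * fourierCoef f (-ξ) := by
    refine Summable.of_norm ((summable_norm_fourierCoef_mul hg hf).congr fun ξ => ?_)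
    rw [norm_mul, fourierCoef_neg, Complex.norm_conj]
  have h1 := Complex.hasSum_re h.hasSum
  simp_rw [fourierCoef_neg] at h1
  unfold dualPair
  simp_rw [fourierCoef_neg]
  exact h1

theorem abs_dualPair_le {g f : Distr n} (hg : MemSobolev (-1) g) (hf : MemSobolev 1 f) :
    |dualPair g f| ≤ sobolevNorm (-1) g * sobolevNorm 1 f := by
  have h := hasSum_dualPair hg hf
  have hn := summable_norm_fourierCoef_mul hg hf
  rw [memSobolev_neg_one_iff] at hg
  rw [memSobolev_one_iff] at hf
  have h1 : |dualPair g f| ≤ ∑' ξ, ‖fourierCoef g ξ‖ * ‖fourierCoef f ξ‖ := by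
    rw [← h.tsum_eq]
    refine (norm_tsum_le_tsum_norm h.summable.norm).trans ?_
    refine h.summable.norm.tsum_le_tsum (fun ξ => ?_) hn
    refine (Complex.abs_re_le_norm _).trans (by simp)
  refine h1.trans ?_
  have h2 : ∀ ξ : Fin n → ℤ, ‖fourierCoef g ξ‖ * ‖fourierCoef f ξ‖ =
      ((rho ξ)⁻¹ * ‖fourierCoef g ξ‖) * (rho ξ * ‖fourierCoef f ξ‖) := fun ξ => by
    field_simp [(rho_pos ξ).ne']
  simp_rw [h2]
  refine (le_abs_self _).trans ((abs_tsum_mul_le (by simpa only [mul_pow, inv_pow] using hg)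
    (by simpa only [mul_pow] using hf)).trans (le_of_eq ?_))
  unfold sobolevNorm
  simp_rw [rho_rpow_neg_one, mul_pow, inv_pow]
  simp

/-- Test `T` with a symmetric truncation of its own Riesz representative, with coefficients `ρ⁻²
T̂`. Then `T φ` and `‖φ‖²` in `H¹` are both the truncated sum `S` of the squared `H⁻¹` norm, so `S ≤
K √S` and `S ≤ K²` independently of the truncation. This is how the advection term is placed in
`H⁻¹`. -/
theorem memSobolev_neg_one_of_forall_abs_le {T : Distr n} {K : ℝ} (hK : 0 ≤ K)
    (hT : ∀ φ : TestFun n, |T.1 φ| ≤ K * sobolevNorm 1 (ofFun φ.1)) :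
    MemSobolev (-1) T ∧ sobolevNorm (-1) T ≤ K := by
  have key : ∀ F : Finset (Fin n → ℤ), (∀ ξ, -ξ ∈ F ↔ ξ ∈ F) →
      ∑ ξ ∈ F, (rho ξ ^ 2)⁻¹ * ‖fourierCoef T ξ‖ ^ 2 ≤ K ^ 2 := by
    intro F hF
    let c : (Fin n → ℤ) → ℂ := fun ξ => (((rho ξ ^ 2)⁻¹ : ℝ) : ℂ) * fourierCoef T ξ
    have hc : ∀ ξ, c (-ξ) = conj (c ξ) := fun ξ => by
      simp [c, rho_neg, fourierCoef_neg]
    have h1 : T.1 (trigPoly F c) = ∑ ξ ∈ F, (rho ξ ^ 2)⁻¹ * ‖fourierCoef T ξ‖ ^ 2 := by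
      rw [distr_trigPoly]
      refine Finset.sum_congr rfl fun ξ _ => ?_
      simp only [c, map_mul, Complex.conj_ofReal]
      rw [mul_left_comm, Complex.mul_conj, ← Complex.ofReal_mul, Complex.ofReal_re,
        Complex.normSq_eq_norm_sq]
    have h2 : sobolevNorm 1 (ofFun (trigPoly F c).1) ^ 2 =
        ∑ ξ ∈ F, (rho ξ ^ 2)⁻¹ * ‖fourierCoef T ξ‖ ^ 2 := by
      rw [sobolevNorm_one_sq, tsum_eq_sum (s := F)]
      · refine Finset.sum_congr rfl fun ξ hξ => ?_
        change rho ξ ^ 2 * ‖testCoef (trigPoly F c) ξ‖ ^ 2 = _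
        rw [testCoef_trigPoly_of_symm hF hc, if_pos hξ, norm_mul, mul_pow, Complex.norm_real,
          Real.norm_eq_abs, sq_abs]
        have := (rho_pos ξ).ne'
        field_simp
      · intro ξ hξ
        change rho ξ ^ 2 * ‖testCoef (trigPoly F c) ξ‖ ^ 2 = _
        rw [testCoef_trigPoly_of_symm hF hc, if_neg hξ]
        simp
    have h3 := hT (trigPoly F c)
    set S := ∑ ξ ∈ F, (rho ξ ^ 2)⁻¹ * ‖fourierCoef T ξ‖ ^ 2
    set N := sobolevNorm 1 (ofFun (trigPoly F c).1)
    rw [h1, ← h2] at h3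
    have h4 := (le_abs_self _).trans h3
    have hN : 0 ≤ N := sobolevNorm_nonneg _ _
    have h5 : N ≤ K := by
      rcases hN.eq_or_lt with h | h
      · rw [← h]; exact hK
      · nlinarith
    rw [← h2]
    exact pow_le_pow_left₀ hN h5 2
  have hnn : ∀ ξ : Fin n → ℤ, 0 ≤ (rho ξ ^ 2)⁻¹ * ‖fourierCoef T ξ‖ ^ 2 := fun ξ => by
    positivity
  have key2 : ∀ F : Finset (Fin n → ℤ),
      ∑ ξ ∈ F, (rho ξ ^ 2)⁻¹ * ‖fourierCoef T ξ‖ ^ 2 ≤ K ^ 2 := fun F => by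
    obtain ⟨G, hFG, hG⟩ := exists_symm_finset F
    exact (Finset.sum_le_sum_of_subset_of_nonneg hFG fun ξ _ _ => hnn ξ).trans (key G hG)
  have hs : Summable fun ξ => (rho ξ ^ 2)⁻¹ * ‖fourierCoef T ξ‖ ^ 2 :=
    summable_of_sum_le hnn key2
  refine ⟨memSobolev_neg_one_iff.2 hs, ?_⟩
  refine le_of_sq_le_sq ?_ hK
  rw [sobolevNorm_neg_one_sq]
  exact hs.tsum_le_of_sum_le key2

/-- Trigonometric polynomials are dense in `H¹`. -/
theorem exists_testFun_sobolevNorm_sub_le {u : Distr n} (hu : MemSobolev 1 u) {ε : ℝ}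
    (hε : 0 < ε) : ∃ φ : TestFun n, sobolevNorm 1 (u - ofFun φ.1) ≤ ε ∧
      MemSobolev 1 (ofFun φ.1) ∧ sobolevNorm 1 (ofFun φ.1) ≤ sobolevNorm 1 u := by
  rw [memSobolev_one_iff] at hu
  have h := hu.hasSum
  unfold HasSum at h
  rw [SummationFilter.unconditional_filter, Metric.tendsto_atTop] at h
  obtain ⟨F, hF⟩ := h (ε ^ 2) (by positivity)
  obtain ⟨G, hFG, hG⟩ := exists_symm_finset F
  have hc : ∀ ξ, fourierCoef (ofFun (trigPoly G (fourierCoef u)).1) ξ =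
      if ξ ∈ G then fourierCoef u ξ else 0 := testCoef_trigPoly_of_symm hG (fourierCoef_neg u)
  have hfin : HasSum (fun ξ => rho ξ ^ 2 *
      ‖fourierCoef (ofFun (trigPoly G (fourierCoef u)).1) ξ‖ ^ 2)
      (∑ ξ ∈ G, rho ξ ^ 2 * ‖fourierCoef u ξ‖ ^ 2) := by
    have h1 : ∑ ξ ∈ G, rho ξ ^ 2 * ‖fourierCoef u ξ‖ ^ 2 = ∑ ξ ∈ G, rho ξ ^ 2 *
        ‖fourierCoef (ofFun (trigPoly G (fourierCoef u)).1) ξ‖ ^ 2 :=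
      Finset.sum_congr rfl fun ξ hξ => by rw [hc, if_pos hξ]
    rw [h1]
    refine hasSum_sum_of_ne_finset_zero fun ξ hξ => ?_
    rw [hc, if_neg hξ]
    simp
  have hnn : ∀ ξ, 0 ≤ rho ξ ^ 2 * ‖fourierCoef u ξ‖ ^ 2 := fun ξ => by positivity
  -- Truncating over a symmetric set keeps part of the coefficients and deletes the rest, so the
  -- error is a tail of the series and the norm cannot grow.
  refine ⟨trigPoly G (fourierCoef u), ?_, memSobolev_one_iff.2 hfin.summable, ?_⟩
  · refine le_of_sq_le_sq ?_ hε.le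
    rw [sobolevNorm_one_sq]
    have h2 := (hu.hasSum.sub hfin).tsum_eq
    have h3 := hF G hFG
    rw [Real.dist_eq, abs_sub_comm] at h3
    refine le_trans (le_of_eq ?_) ((le_abs_self _).trans h3.le)
    rw [← h2]
    refine tsum_congr fun ξ => ?_
    rw [fourierCoef_sub, hc]
    split_ifs <;> simp
  · refine le_of_sq_le_sq ?_ (sobolevNorm_nonneg _ _)
    rw [sobolevNorm_one_sq, sobolevNorm_one_sq, hfin.tsum_eq]
    exact hu.sum_le_tsum _ fun ξ _ => hnn ξ

/-! ### The Sobolev inequality on the torus -/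

theorem memLp_testFun (φ : TestFun n) (p : ℝ≥0∞) : MemLp φ.1 p (torusMeasure n) := by
  obtain ⟨C, hC⟩ := exists_bound_testFun φ
  exact MemLp.of_bound (continuous_testFun φ).aestronglyMeasurable C
    (Filter.Eventually.of_forall hC)

theorem hasSum_rho_sq_testFun (φ : TestFun n) :
    HasSum (fun ξ => rho ξ ^ 2 * ‖fourierCoef (ofFun φ.1) ξ‖ ^ 2)
      (∫ t, φ.1 t ^ 2 ∂torusMeasure n +
        ∑ j, (4 * Real.pi ^ 2)⁻¹ * ∫ t, (TestFun.pderiv j φ).1 t ^ 2 ∂torusMeasure n) := by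
  have h0 := hasSum_norm_sq_fourierCoef (memLp_testFun φ 2)
  have h1 : ∀ j ∈ Finset.univ, HasSum (fun ξ : Fin n → ℤ => (ξ j : ℝ) ^ 2 *
      ‖fourierCoef (ofFun φ.1) ξ‖ ^ 2)
      ((4 * Real.pi ^ 2)⁻¹ * ∫ t, (TestFun.pderiv j φ).1 t ^ 2 ∂torusMeasure n) := by
    intro j _
    have h2 := (hasSum_norm_sq_fourierCoef (memLp_testFun (TestFun.pderiv j φ) 2)).mul_left
      (4 * Real.pi ^ 2)⁻¹
    refine h2.congr_fun fun ξ => ?_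
    rw [← pderiv_ofFun, fourierCoef_pderiv]
    simp only [norm_mul, Complex.norm_real, Complex.norm_I, Complex.norm_intCast,
      Complex.norm_ofNat, Real.norm_eq_abs, abs_of_pos Real.pi_pos, mul_one, mul_pow, sq_abs]
    have := Real.pi_pos.ne'
    field_simp
    norm_num
  refine (h0.add (hasSum_sum h1)).congr_fun fun ξ => ?_
  rw [rho_sq, add_mul, one_mul, Finset.sum_mul]

theorem memSobolev_one_testFun (φ : TestFun n) : MemSobolev 1 (ofFun φ.1) :=
  memSobolev_one_iff.2 (hasSum_rho_sq_testFun φ).summable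

theorem integral_sq_testFun_le (φ : TestFun n) :
    ∫ t, φ.1 t ^ 2 ∂torusMeasure n ≤ sobolevNorm 1 (ofFun φ.1) ^ 2 := by
  rw [sobolevNorm_one_sq, (hasSum_rho_sq_testFun φ).tsum_eq]
  refine le_add_of_nonneg_right (Finset.sum_nonneg fun j _ => ?_)
  have : 0 ≤ ∫ t, (TestFun.pderiv j φ).1 t ^ 2 ∂torusMeasure n :=
    integral_nonneg fun t => sq_nonneg _
  positivity

theorem integral_sq_pderiv_le (φ : TestFun n) (j : Fin n) :
    ∫ t, (TestFun.pderiv j φ).1 t ^ 2 ∂torusMeasure n ≤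
      (2 * Real.pi * sobolevNorm 1 (ofFun φ.1)) ^ 2 := by
  rw [mul_pow, sobolevNorm_one_sq, (hasSum_rho_sq_testFun φ).tsum_eq]
  have hI : ∀ j, 0 ≤ ∫ t, (TestFun.pderiv j φ).1 t ^ 2 ∂torusMeasure n :=
    fun j => integral_nonneg fun t => sq_nonneg _
  have h0 : 0 ≤ ∫ t, φ.1 t ^ 2 ∂torusMeasure n := integral_nonneg fun t => sq_nonneg _
  have h1 := Finset.single_le_sum (f := fun j => (4 * Real.pi ^ 2)⁻¹ *
    ∫ t, (TestFun.pderiv j φ).1 t ^ 2 ∂torusMeasure n)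
    (fun j _ => mul_nonneg (by positivity) (hI j)) (Finset.mem_univ j)
  have h2 : 0 < 4 * Real.pi ^ 2 := by positivity
  calc ∫ t, (TestFun.pderiv j φ).1 t ^ 2 ∂torusMeasure n
      = (2 * Real.pi) ^ 2 * ((4 * Real.pi ^ 2)⁻¹ *
          ∫ t, (TestFun.pderiv j φ).1 t ^ 2 ∂torusMeasure n) := by
        have := Real.pi_pos.ne'
        field_simp
        norm_num
    _ ≤ _ := by
        gcongr
        linarith

theorem eLpNorm_two_le_of_integral_sq_le {f : Torus n → ℝ} (hf : MemLp f 2 (torusMeasure n))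
    {C : ℝ} (hC : 0 ≤ C) (h : ∫ t, f t ^ 2 ∂torusMeasure n ≤ C ^ 2) :
    eLpNorm f 2 (torusMeasure n) ≤ ENNReal.ofReal C := by
  rw [hf.eLpNorm_eq_integral_rpow_norm (by norm_num) (by norm_num)]
  apply ENNReal.ofReal_le_ofReal
  rw [show ((2 : ℝ≥0∞).toReal)⁻¹ = 1 / 2 by norm_num, ← Real.sqrt_eq_rpow]
  apply Real.sqrt_le_iff.2 ⟨hC, ?_⟩
  simpa using h

/-- The unit box with lower corner `a`. -/
def unitBox (a : Fin n → ℝ) : Set (Fin n → ℝ) := {x | ∀ i, x i ∈ Set.Ioc (a i) (a i + 1)}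

theorem lintegral_unitBox (f : Torus n → ℝ≥0∞) (a : Fin n → ℝ) :
    ∫⁻ x in unitBox a, f (fun i => x i) = ∫⁻ t, f t ∂torusMeasure n :=
  (UnitAddTorus.lintegral_preimage f a).symm

/-- The metric on `Fin n → ℝ` is the supremum metric, so the ball is the cube with sides `[-1/2,
3/2]`. It is covered by the `3ⁿ` unit boxes with corners in `{-1, 0, 1}ⁿ`, each a copy of the torus.
-/
theorem lintegral_closedBall_le (f : Torus n → ℝ≥0∞) :
    ∫⁻ x in Metric.closedBall (fun _ : Fin n => (1 / 2 : ℝ)) 1, f (fun i => x i) ≤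
      3 ^ n * ∫⁻ t, f t ∂torusMeasure n := by
  have hsub : Metric.closedBall (fun _ : Fin n => (1 / 2 : ℝ)) 1 ⊆
      ⋃ a : Fin n → Fin 3, unitBox fun i => ((a i : ℕ) : ℝ) - 1 := by
    intro x hx
    rw [Metric.mem_closedBall, dist_pi_le_iff zero_le_one] at hx
    have h : ∀ i, ∃ a : Fin 3, x i ∈ Set.Ioc (((a : ℕ) : ℝ) - 1) (((a : ℕ) : ℝ) - 1 + 1) := by
      intro i
      have hi := hx i
      rw [Real.dist_eq, abs_le] at hi
      by_cases h1 : x i ≤ 0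
      · exact ⟨0, by simp; constructor <;> linarith⟩
      by_cases h2 : x i ≤ 1
      · exact ⟨1, by simp; constructor <;> linarith⟩
      · exact ⟨2, by simp; constructor <;> linarith⟩
    choose a ha using h
    exact Set.mem_iUnion.2 ⟨a, ha⟩
  calc _ ≤ ∫⁻ x in ⋃ a : Fin n → Fin 3, unitBox fun i => ((a i : ℕ) : ℝ) - 1,
        f (fun i => x i) := lintegral_mono_set hsub
    _ ≤ ∑' a : Fin n → Fin 3, ∫⁻ x in unitBox fun i => ((a i : ℕ) : ℝ) - 1,
        f (fun i => x i) := lintegral_iUnion_le _ _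
    _ = _ := by
        simp_rw [lintegral_unitBox]
        simp

/-- A smooth cutoff function that is one on the unit box. -/
def cutoff (n : ℕ) : ContDiffBump (fun _ : Fin n => (1 / 2 : ℝ)) := 
  ⟨1 / 2, 1, by norm_num, by norm_num⟩

theorem unitBox_zero_subset : unitBox (0 : Fin n → ℝ) ⊆
    Metric.closedBall (fun _ : Fin n => (1 / 2 : ℝ)) (1 / 2) := by
  intro x hx
  rw [Metric.mem_closedBall, dist_pi_le_iff (by norm_num)]
  intro i
  have := hx i
  simp only [Pi.zero_apply, zero_add, Set.mem_Ioc] at this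
  rw [Real.dist_eq, abs_le]
  constructor <;> linarith

theorem norm_clm_le_sum (f : (Fin n → ℝ) →L[ℝ] ℝ) : ‖f‖ ≤ ∑ j, |f (Pi.single j 1)| := by
  refine f.opNorm_le_bound (Finset.sum_nonneg fun _ _ => abs_nonneg _) fun x => ?_
  have hx : f x = ∑ j, x j * f (Pi.single j 1) := by
    conv_lhs => rw [pi_eq_sum_univ' x]
    simp [map_sum, Pi.single]
  rw [hx, Real.norm_eq_abs, Finset.sum_mul]
  refine (Finset.abs_sum_le_sum_abs _ _).trans (Finset.sum_le_sum fun j _ => ?_)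
  rw [abs_mul, mul_comm]
  exact mul_le_mul_of_nonneg_left (norm_le_pi_norm x j) (abs_nonneg _)

/-- The sum of the absolute values of a test function and its first derivatives. -/
def gradSum (φ : TestFun n) (t : Torus n) : ℝ := |φ.1 t| + ∑ j, |(TestFun.pderiv j φ).1 t|

theorem gradSum_nonneg (φ : TestFun n) (t : Torus n) : 0 ≤ gradSum φ t :=
  add_nonneg (abs_nonneg _) (Finset.sum_nonneg fun _ _ => abs_nonneg _)

theorem eLpNorm_gradSum_le (φ : TestFun n) : eLpNorm (gradSum φ) 2 (torusMeasure n) ≤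
    ENNReal.ofReal ((1 + n * (2 * Real.pi)) * sobolevNorm 1 (ofFun φ.1)) := by
  have hN := sobolevNorm_nonneg 1 (ofFun φ.1)
  have h0 : eLpNorm (fun t => |φ.1 t|) 2 (torusMeasure n) ≤
      ENNReal.ofReal (sobolevNorm 1 (ofFun φ.1)) :=
    eLpNorm_two_le_of_integral_sq_le (memLp_testFun φ 2).abs hN
      (by simpa using integral_sq_testFun_le φ)
  have h1 : ∀ j, eLpNorm (fun t => |(TestFun.pderiv j φ).1 t|) 2 (torusMeasure n) ≤
      ENNReal.ofReal (2 * Real.pi * sobolevNorm 1 (ofFun φ.1)) := fun j =>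
    eLpNorm_two_le_of_integral_sq_le (memLp_testFun _ 2).abs (by positivity)
      (by simpa using integral_sq_pderiv_le φ j)
  have hm : ∀ j ∈ Finset.univ, AEStronglyMeasurable (fun t => |(TestFun.pderiv j φ).1 t|)
      (torusMeasure n) := fun j _ => (memLp_testFun _ 2).abs.aestronglyMeasurable
  have h2 : gradSum φ = (fun t => |φ.1 t|) + ∑ j, fun t => |(TestFun.pderiv j φ).1 t| := by
    funext t
    simp [gradSum]
  rw [h2]
  refine (eLpNorm_add_le (memLp_testFun φ 2).abs.aestronglyMeasurable
    (Finset.aestronglyMeasurable_sum _ hm) (by norm_num)).trans ?_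
  refine (add_le_add h0 ((eLpNorm_sum_le hm (by norm_num)).trans
    (Finset.sum_le_sum fun j _ => h1 j))).trans ?_
  rw [← ENNReal.ofReal_sum_of_nonneg fun j _ => by positivity, ← ENNReal.ofReal_add hN
    (Finset.sum_nonneg fun j _ => by positivity)]
  apply ENNReal.ofReal_le_ofReal
  simp
  linarith

/-- By the product rule, with `M = 1 + C` where `C` bounds the derivative of the cutoff. What
matters is that `M` does not depend on `φ`. -/
theorem exists_norm_fderiv_cutoff_mul_le (n : ℕ) : ∃ M : ℝ≥0, ∀ (φ : TestFun n) (x : Fin n → ℝ),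
    ‖fderiv ℝ (fun x => cutoff n x * PeriodicOseen.lift φ.1 x) x‖ ≤
      M * gradSum φ (fun i => (x i : UnitAddCircle)) := by
  have hχ : ContDiff ℝ ∞ (cutoff n) := (cutoff n).contDiff
  obtain ⟨C, hC⟩ := ((cutoff n).hasCompactSupport.fderiv (𝕜 := ℝ)).exists_bound_of_continuous
    (hχ.continuous_fderiv (by simp))
  have hC0 : 0 ≤ C := (norm_nonneg _).trans (hC 0)
  obtain ⟨M, hM⟩ : ∃ M : ℝ≥0, (M : ℝ) = 1 + C := ⟨⟨_, by positivity⟩, rfl⟩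
  refine ⟨M, fun φ x => ?_⟩
  rw [hM]
  have hφ : ContDiff ℝ ∞ (PeriodicOseen.lift φ.1) := φ.2
  have h1 : fderiv ℝ (fun x => cutoff n x * PeriodicOseen.lift φ.1 x) x = _ :=
    fderiv_mul ((hχ.differentiable (by simp)) x) ((hφ.differentiable (by simp)) x)
  rw [h1]
  have h2 : ‖fderiv ℝ (PeriodicOseen.lift φ.1) x‖ ≤
      ∑ j, |(TestFun.pderiv j φ).1 (fun i => (x i : UnitAddCircle))| := by
    refine (norm_clm_le_sum _).trans (le_of_eq (Finset.sum_congr rfl fun j _ => ?_))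
    rw [← congrFun (lift_torusDeriv_of_contDiff j hφ) x]
    rfl
  have h3 : ‖cutoff n x‖ ≤ 1 := by
    rw [Real.norm_eq_abs, abs_of_nonneg (cutoff n).nonneg]
    exact (cutoff n).le_one
  set D := ∑ j, |(TestFun.pderiv j φ).1 (fun i => (x i : UnitAddCircle))|
  have hD : 0 ≤ D := Finset.sum_nonneg fun _ _ => abs_nonneg _
  change _ ≤ (1 + C) * (|PeriodicOseen.lift φ.1 x| + D)
  set a := PeriodicOseen.lift φ.1 x
  have ha := abs_nonneg a
  calc _ ≤ ‖cutoff n x‖ * ‖fderiv ℝ (PeriodicOseen.lift φ.1) x‖ + |a| * ‖fderiv ℝ (cutoff n) x‖ := by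
        refine (norm_add_le _ _).trans (le_of_eq ?_)
        rw [norm_smul, norm_smul, Real.norm_eq_abs a]
    _ ≤ 1 * D + |a| * C := by
        gcongr
        exact hC x
    _ ≤ _ := by nlinarith

/-- The Gagliardo–Nirenberg–Sobolev inequality requires `p < n`. For `n ≥ 3` the choice `p = 2` is
admissible. For `n = 2` it is critical, and `p = θ/(θ-1) < 2` is used instead: then `1/p - 1/2 = 1/2
- 1/θ` exactly, and `p < 2` is where the strict inequality `θ > 2` enters. -/
theorem exists_sobolev_exponent (hn : 2 ≤ n) {θ : ℝ} (hθ2 : 2 < θ) (hθn : (n : ℝ) ≤ θ) :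
    ∃ p : ℝ≥0, 1 ≤ p ∧ p ≤ 2 ∧ p < n ∧ (p : ℝ)⁻¹ - (n : ℝ)⁻¹ ≤ 1 / 2 - θ⁻¹ := by
  rcases hn.eq_or_lt with h | h
  · subst h
    have h1 : 0 < θ - 1 := by linarith
    obtain ⟨p, hp⟩ : ∃ p : ℝ≥0, (p : ℝ) = θ / (θ - 1) := ⟨⟨_, by positivity⟩, rfl⟩
    refine ⟨p, ?_, ?_, ?_, ?_⟩
    · rw [← NNReal.coe_le_coe, hp, NNReal.coe_one, le_div_iff₀ h1]
      linarith
    · rw [← NNReal.coe_le_coe, hp, NNReal.coe_ofNat, div_le_iff₀ h1]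
      linarith
    · rw [← NNReal.coe_lt_coe, hp, NNReal.coe_natCast, div_lt_iff₀ h1]
      push_cast
      linarith
    · have : 0 < θ := by linarith
      rw [hp, Nat.cast_ofNat, inv_div, sub_div, div_self this.ne']
      apply le_of_eq
      ring
  · refine ⟨2, by norm_num, le_rfl, by exact_mod_cast h, ?_⟩
    have h1 : θ⁻¹ ≤ (n : ℝ)⁻¹ := inv_anti₀ (by positivity) hθn
    norm_num
    linarith

theorem eLpNorm_restrict_of_support_subset {α E : Type*} [MeasurableSpace α] {μ : Measure α}
    [NormedAddCommGroup E] {f : α → E} {s : Set α} {p : ℝ≥0∞} (hf : Function.support f ⊆ s) :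
    eLpNorm f p (μ.restrict s) = eLpNorm f p μ := by
  rw [← eLpNorm_norm, ← eLpNorm_norm f]
  refine eLpNorm_restrict_eq_of_support_subset fun x hx => hf fun h => hx ?_
  simp [h]

/-- Transfer from `ℝⁿ`: the lift times the cutoff has compact support, agrees with `φ` on one unit
box, and satisfies the Gagliardo–Nirenberg–Sobolev inequality. Hölder's inequality on the ball
raises the exponent of the gradient from `p` to `2`, and the gradient over the ball is controlled by
`3ⁿ` copies of the torus. -/
theorem exists_eLpNorm_testFun_le {p q : ℝ≥0} (hp : 1 ≤ p) (hp2 : p ≤ 2) (hpn : p < n)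
    (hq : q ≠ 0) (hpq : (p : ℝ)⁻¹ - (n : ℝ)⁻¹ ≤ (q : ℝ)⁻¹) :
    ∃ C : ℝ≥0, ∀ φ : TestFun n, eLpNorm φ.1 q (torusMeasure n) ≤
      ENNReal.ofReal (C * sobolevNorm 1 (ofFun φ.1)) := by
  obtain ⟨M, hM⟩ := exists_norm_fderiv_cutoff_mul_le n
  set B := Metric.closedBall (fun _ : Fin n => (1 / 2 : ℝ)) 1
  set K := eLpNormLESNormFDerivOfLeConst ℝ (volume : Measure (Fin n → ℝ)) B p q
  have hBfin : (volume B : ℝ≥0∞) ≠ ⊤ := (isCompact_closedBall _ _).measure_ne_top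
  have hexp : (0 : ℝ) ≤ 1 / (p : ℝ≥0∞).toReal - 1 / (2 : ℝ≥0∞).toReal := by
    have h1 : (1 : ℝ) ≤ p := by exact_mod_cast hp
    have h2 : (p : ℝ) ≤ 2 := by exact_mod_cast hp2
    simp only [ENNReal.coe_toReal, ENNReal.toReal_ofNat]
    rw [sub_nonneg]
    exact one_div_le_one_div_of_le (by linarith) h2
  set V := (volume B) ^ (1 / (p : ℝ≥0∞).toReal - 1 / (2 : ℝ≥0∞).toReal)
  have hV : V ≠ ⊤ := ENNReal.rpow_ne_top_of_nonneg hexp hBfin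
  have hW : ((3 : ℝ≥0∞) ^ n) ^ (1 / 2 : ℝ) ≠ ⊤ :=
    ENNReal.rpow_ne_top_of_nonneg (by norm_num) (by finiteness)
  set W := ((3 : ℝ≥0∞) ^ n) ^ (1 / 2 : ℝ)
  obtain ⟨L, hL⟩ : ∃ L : ℝ≥0, (L : ℝ) = 1 + n * (2 * Real.pi) := ⟨⟨_, by positivity⟩, rfl⟩
  refine ⟨K * (M * W.toNNReal * V.toNNReal) * L, fun φ => ?_⟩
  set f : (Fin n → ℝ) → ℝ := fun x => cutoff n x * PeriodicOseen.lift φ.1 x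
  have hf : ContDiff ℝ ∞ f := (cutoff n).contDiff.mul φ.2
  have hsupp : Function.support f ⊆ B := by
    refine (Function.support_mul_subset_left _ _).trans ?_
    rw [(cutoff n).support_eq]
    exact Metric.ball_subset_closedBall
  have h1 : eLpNorm φ.1 q (torusMeasure n) ≤ eLpNorm f q volume := by
    rw [eLpNorm_eq_lintegral_rpow_enorm_toReal (by simpa using hq) (by simp),
      eLpNorm_eq_lintegral_rpow_enorm_toReal (by simpa using hq) (by simp),
      ← lintegral_unitBox _ 0]
    gcongr ?_ ^ _
    refine le_trans (le_of_eq ?_) (setLIntegral_le_lintegral (unitBox 0) _)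
    have hmeas : MeasurableSet (unitBox (0 : Fin n → ℝ)) := by
      have : unitBox (0 : Fin n → ℝ) = Set.pi Set.univ fun _ => Set.Ioc 0 (0 + 1) := by
        ext x
        simp [unitBox]
      rw [this]
      exact MeasurableSet.univ_pi fun _ => measurableSet_Ioc
    refine setLIntegral_congr_fun hmeas fun x hx => ?_
    simp only [f, (cutoff n).one_of_mem_closedBall (unitBox_zero_subset hx), one_mul]
    rfl
  have h2 : eLpNorm f q volume ≤ K * eLpNorm (fderiv ℝ f) p volume :=
    eLpNorm_le_eLpNorm_fderiv_of_le volume (hf.of_le (by simp)) hsupp hp (by simpa using hpn)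
      (by simpa using hpq) Metric.isBounded_closedBall
  have hsupp' : Function.support (fderiv ℝ f) ⊆ B :=
    (support_fderiv_subset ℝ).trans (closure_minimal hsupp Metric.isClosed_closedBall)
  have h3 : eLpNorm (fderiv ℝ f) p volume ≤ eLpNorm (fderiv ℝ f) 2 (volume.restrict B) * V := by
    rw [← eLpNorm_restrict_of_support_subset hsupp']
    have := eLpNorm_le_eLpNorm_mul_rpow_measure_univ (μ := volume.restrict B) (f := fderiv ℝ f)
      (p := p) (q := 2) (by exact_mod_cast hp2)
      (hf.continuous_fderiv (by simp)).aestronglyMeasurable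
    rwa [Measure.restrict_apply_univ] at this
  have h4 : eLpNorm (fderiv ℝ f) 2 (volume.restrict B) ≤
      M * (W * eLpNorm (gradSum φ) 2 (torusMeasure n)) := by
    have h5 : eLpNorm (fderiv ℝ f) 2 (volume.restrict B) ≤ M * eLpNorm
        (fun x : Fin n → ℝ => gradSum φ fun i => (x i : UnitAddCircle)) 2
        (volume.restrict B) := by
      have h6 := eLpNorm_le_nnreal_smul_eLpNorm_of_ae_le_mul (μ := volume.restrict B)
        (f := fderiv ℝ f) (g := fun x : Fin n → ℝ => gradSum φ fun i => (x i : UnitAddCircle))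
        (c := M) (Filter.Eventually.of_forall fun x => by
          have := hM φ x
          rw [← NNReal.coe_le_coe]
          simpa [Real.norm_eq_abs, abs_of_nonneg (gradSum_nonneg φ _)] using this) 2
      simpa [ENNReal.smul_def] using h6
    refine h5.trans ?_
    gcongr
    rw [eLpNorm_eq_lintegral_rpow_enorm_toReal (by simp) (by simp),
      eLpNorm_eq_lintegral_rpow_enorm_toReal (by simp) (by simp)]
    simp only [ENNReal.toReal_ofNat]
    rw [← ENNReal.mul_rpow_of_nonneg _ _ (by norm_num)]
    gcongr
    exact lintegral_closedBall_le fun t => ‖gradSum φ t‖ₑ ^ (2 : ℝ)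
  calc _ ≤ K * (M * (W * ENNReal.ofReal ((1 + n * (2 * Real.pi)) *
          sobolevNorm 1 (ofFun φ.1))) * V) := by
        refine h1.trans (h2.trans ?_)
        gcongr
        refine h3.trans ?_
        gcongr
        refine h4.trans ?_
        gcongr
        exact eLpNorm_gradSum_le φ
    _ = _ := by
        rw [ENNReal.ofReal_mul (by positivity), ENNReal.ofReal_mul (by positivity),
          ENNReal.ofReal_coe_nnreal]
        push_cast
        rw [ENNReal.coe_toNNReal hV, ENNReal.coe_toNNReal hW]
        rw [← hL, ENNReal.ofReal_coe_nnreal]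
        ring

/-- Multiplication by an `L_θ` function maps `H¹` into `L²`. -/
theorem exists_eLpNorm_mul_testFun_le (hn : 2 ≤ n) {θ : ℝ} (hθ2 : 2 < θ) (hθn : (n : ℝ) ≤ θ)
    {U : Torus n → ℝ} (hU : MemLp U (ENNReal.ofReal θ) (torusMeasure n)) :
    ∃ C : ℝ≥0, ∀ φ : TestFun n, MemLp (fun t => U t * φ.1 t) 2 (torusMeasure n) ∧
      eLpNorm (fun t => U t * φ.1 t) 2 (torusMeasure n) ≤
        ENNReal.ofReal (C * sobolevNorm 1 (ofFun φ.1)) := by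
  obtain ⟨p, hp, hp2, hpn, hpq⟩ := exists_sobolev_exponent hn hθ2 hθn
  have h1 : 0 < 1 / 2 - θ⁻¹ := by
    have : θ⁻¹ < 2⁻¹ := inv_strictAnti₀ two_pos hθ2
    norm_num at this ⊢
    linarith
  -- This `q` is the Hölder partner, `1/θ + 1/q = 1/2`, and it is the exponent supplied by the
  -- Sobolev inequality.
  obtain ⟨q, hqe⟩ : ∃ q : ℝ≥0, (q : ℝ) = (1 / 2 - θ⁻¹)⁻¹ := ⟨⟨_, by positivity⟩, rfl⟩
  have hq : q ≠ 0 := by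
    rw [← NNReal.coe_ne_zero]
    exact hqe ▸ (inv_pos.2 h1).ne'
  have hq' : (q : ℝ)⁻¹ = 1 / 2 - θ⁻¹ := by rw [hqe, inv_inv]
  obtain ⟨C, hC⟩ := exists_eLpNorm_testFun_le hp hp2 hpn hq (hpq.trans hq'.ge)
  have hθ0 : 0 < θ := by linarith
  have : ENNReal.HolderTriple (ENNReal.ofReal θ) q 2 := by
    constructor
    rw [← ENNReal.ofReal_inv_of_pos hθ0, ← ENNReal.ofReal_coe_nnreal,
      ← ENNReal.ofReal_inv_of_pos (hqe ▸ inv_pos.2 h1), hq', ← ENNReal.ofReal_add (by positivity) h1.le,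
      ← ENNReal.ofReal_ofNat, ← ENNReal.ofReal_inv_of_pos two_pos]
    congr 1
    ring
  refine ⟨(eLpNorm U (ENNReal.ofReal θ) (torusMeasure n)).toNNReal * C, fun φ => ⟨?_, ?_⟩⟩
  · exact MemLp.smul (memLp_testFun φ q) hU
  · refine (eLpNorm_smul_le_mul_eLpNorm (p := ENNReal.ofReal θ) (q := q)
      (memLp_testFun φ q).aestronglyMeasurable hU.aestronglyMeasurable).trans ?_
    rw [NNReal.coe_mul, mul_assoc, ENNReal.ofReal_mul (by positivity), ENNReal.ofReal_coe_nnreal,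
      ENNReal.coe_toNNReal hU.eLpNorm_ne_top]
    gcongr
    exact hC φ

/-! ### Bilinearity of the dual product -/

theorem dualPair_add_left {s : ℝ} {g h f : Distr n} (hg : MemSobolev (-s) g)
    (hh : MemSobolev (-s) h) (hf : MemSobolev s f) :
    dualPair (g + h) f = dualPair g f + dualPair h f := by
  refine (hasSum_dualPair (hg.add hh) hf).unique ?_
  refine ((hasSum_dualPair hg hf).add (hasSum_dualPair hh hf)).congr_fun fun ξ => ?_
  rw [fourierCoef_add, add_mul, Complex.add_re]

theorem dualPair_add_right {s : ℝ} {g f h : Distr n} (hg : MemSobolev (-s) g)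
    (hf : MemSobolev s f) (hh : MemSobolev s h) :
    dualPair g (f + h) = dualPair g f + dualPair g h := by
  refine (hasSum_dualPair hg (hf.add hh)).unique ?_
  refine ((hasSum_dualPair hg hf).add (hasSum_dualPair hg hh)).congr_fun fun ξ => ?_
  rw [fourierCoef_add, map_add, mul_add, Complex.add_re]

theorem MemSobolev.smul {s : ℝ} {T : Distr n} (c : ℝ) (hT : MemSobolev s T) :
    MemSobolev s (c • T) := by
  refine (Summable.mul_left (c ^ 2) hT).congr fun ξ => ?_
  rw [fourierCoef_smul, norm_mul, mul_pow, Complex.norm_real, Real.norm_eq_abs, sq_abs]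
  ring

theorem dualPair_smul_left (c : ℝ) (g f : Distr n) :
    dualPair (c • g) f = c * dualPair g f := by
  unfold dualPair
  simp_rw [fourierCoef_smul, mul_assoc]
  rw [tsum_mul_left, Complex.re_ofReal_mul]

theorem dualPair_smul_right (c : ℝ) (g f : Distr n) :
    dualPair g (c • f) = c * dualPair g f := by
  unfold dualPair
  simp_rw [fourierCoef_smul, mul_left_comm]
  rw [tsum_mul_left, Complex.re_ofReal_mul]

/-- Links the Fourier pairing to the action on test functions, so that identities proved by
integration carry over to `dualPair`. -/
theorem dualPair_testFun {g : Distr n} (hg : MemSobolev (-1) g) (φ : TestFun n) :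
    dualPair g (ofFun φ.1) = g.1 φ :=
  (hasSum_dualPair hg (memSobolev_one_testFun φ)).unique (hasSum_distr_apply g φ)

/-! ### The advection term -/

theorem norm_two_pi_I_mul (k : ℤ) (z : ℂ) :
    ‖2 * Real.pi * Complex.I * k * z‖ ^ 2 = (2 * Real.pi) ^ 2 * ((k : ℝ) ^ 2 * ‖z‖ ^ 2) := by
  simp only [norm_mul, Complex.norm_real, Complex.norm_I, Complex.norm_intCast,
    Complex.norm_ofNat, Real.norm_eq_abs, abs_of_pos Real.pi_pos, mul_one, mul_pow, sq_abs]
  ring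

theorem sq_le_rho_sq (ξ : Fin n → ℤ) (j : Fin n) : (ξ j : ℝ) ^ 2 ≤ rho ξ ^ 2 := by
  rw [rho_sq]
  have := Finset.single_le_sum (f := fun j => (ξ j : ℝ) ^ 2) (fun j _ => sq_nonneg _)
    (Finset.mem_univ j)
  linarith

theorem norm_sq_fourierCoef_pderiv_le (T : Distr n) (j : Fin n) (ξ : Fin n → ℤ) :
    ‖fourierCoef (Distr.pderiv j T) ξ‖ ^ 2 ≤
      (2 * Real.pi) ^ 2 * (rho ξ ^ 2 * ‖fourierCoef T ξ‖ ^ 2) := by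
  rw [fourierCoef_pderiv, norm_two_pi_I_mul]
  have := sq_le_rho_sq ξ j
  gcongr

theorem summable_pderiv {T : Distr n} (hT : MemSobolev 1 T) (j : Fin n) :
    Summable fun ξ => ‖fourierCoef (Distr.pderiv j T) ξ‖ ^ 2 :=
  Summable.of_nonneg_of_le (fun _ => by positivity) (norm_sq_fourierCoef_pderiv_le T j)
    ((memSobolev_one_iff.1 hT).mul_left _)

theorem norm_toL2_pderiv_le {T : Distr n} (hT : MemSobolev 1 T) (j : Fin n) :
    ‖toL2 (Distr.pderiv j T)‖ ≤ 2 * Real.pi * sobolevNorm 1 T := by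
  have h0 := sobolevNorm_nonneg 1 T
  refine le_of_sq_le_sq ?_ (by positivity)
  rw [norm_toL2_sq (summable_pderiv hT j), mul_pow, sobolevNorm_one_sq, ← tsum_mul_left]
  exact (summable_pderiv hT j).tsum_le_tsum (norm_sq_fourierCoef_pderiv_le T j)
    ((memSobolev_one_iff.1 hT).mul_left _)

/-- The distribution `(U·∇)v` for a scalar `v`. -/
def advectScalar (U : Fin n → Torus n → ℝ) (v : Distr n) : Distr n :=
  ofFun fun t => ∑ j, U j t * toL2 (Distr.pderiv j v) t

theorem advection_eq (U : Fin n → Torus n → ℝ) (u : Fin n → Distr n) (k : Fin n) :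
    advection U u k = advectScalar U (u k) := rfl

theorem integrable_advect {U : Fin n → Torus n → ℝ} (hU : ∀ j, MemLp (U j) 2 (torusMeasure n))
    (v : Distr n) (j : Fin n) :
    Integrable (fun t => U j t * toL2 (Distr.pderiv j v) t) (torusMeasure n) :=
  (hU j).integrable_mul (Lp.memLp _)

theorem integrable_sum_advect {U : Fin n → Torus n → ℝ}
    (hU : ∀ j, MemLp (U j) 2 (torusMeasure n)) (v : Distr n) :
    Integrable (fun t => ∑ j, U j t * toL2 (Distr.pderiv j v) t) (torusMeasure n) :=
  integrable_finsetSum _ fun j _ => integrable_advect hU v j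

/-- `U_j ∂_j v` is only known to be integrable, whereas `U_j φ` lies in `L²` with a norm controlled
by the `H¹` norm of `φ`. The integrand is therefore grouped as `∂_j v · (U_j φ)`. -/
theorem advectScalar_apply {U : Fin n → Torus n → ℝ}
    (hU : ∀ j, MemLp (U j) 2 (torusMeasure n)) (v : Distr n) (φ : TestFun n) :
    (advectScalar U v).1 φ =
      ∑ j, ∫ t, toL2 (Distr.pderiv j v) t * (U j t * φ.1 t) ∂torusMeasure n := by
  unfold advectScalar
  rw [ofFun_apply (integrable_sum_advect hU v), ← integral_finsetSum]
  · refine integral_congr_ae (Filter.Eventually.of_forall fun t => ?_)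
    simp only [Finset.sum_mul]
    exact Finset.sum_congr rfl fun j _ => by ring
  · intro j _
    refine (integrable_mul_testFun (integrable_advect hU v j) φ).congr
      (Filter.Eventually.of_forall fun t => ?_)
    simp only
    ring

theorem advectScalar_add {U : Fin n → Torus n → ℝ}
    (hU : ∀ j, MemLp (U j) 2 (torusMeasure n)) {v w : Distr n} (hv : MemSobolev 1 v)
    (hw : MemSobolev 1 w) : advectScalar U (v + w) = advectScalar U v + advectScalar U w := by
  unfold advectScalar
  rw [← ofFun_add (integrable_sum_advect hU v) (integrable_sum_advect hU w)]
  apply ofFun_congr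
  have h : ∀ j, (toL2 (Distr.pderiv j (v + w)) : Torus n → ℝ) =ᵐ[torusMeasure n]
      fun t => toL2 (Distr.pderiv j v) t + toL2 (Distr.pderiv j w) t := fun j => by
    rw [map_add, toL2_add (summable_pderiv hv j) (summable_pderiv hw j)]
    exact Lp.coeFn_add _ _
  filter_upwards [ae_all_iff.2 h] with t ht
  rw [← Finset.sum_add_distrib]
  exact Finset.sum_congr rfl fun j _ => by rw [ht j]; ring

theorem advectScalar_smul {U : Fin n → Torus n → ℝ}
    (hU : ∀ j, MemLp (U j) 2 (torusMeasure n)) (c : ℝ) {v : Distr n} (hv : MemSobolev 1 v) :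
    advectScalar U (c • v) = c • advectScalar U v := by
  unfold advectScalar
  rw [← ofFun_smul (integrable_sum_advect hU v)]
  apply ofFun_congr
  have h : ∀ j, (toL2 (Distr.pderiv j (c • v)) : Torus n → ℝ) =ᵐ[torusMeasure n]
      fun t => c * toL2 (Distr.pderiv j v) t := fun j => by
    rw [map_smul, toL2_smul c (summable_pderiv hv j)]
    exact Lp.coeFn_smul _ _
  filter_upwards [ae_all_iff.2 h] with t ht
  rw [Finset.mul_sum]
  exact Finset.sum_congr rfl fun j _ => by rw [ht j]; ring

theorem abs_integral_mul_le_norm_mul (w : Lp ℝ 2 (torusMeasure n)) {f : Torus n → ℝ}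
    (hf : MemLp f 2 (torusMeasure n)) :
    |∫ t, w t * f t ∂torusMeasure n| ≤ ‖w‖ * (eLpNorm f 2 (torusMeasure n)).toReal := by
  rw [← Lp.norm_toLp f hf]
  refine le_trans (le_of_eq ?_) (abs_real_inner_le_norm w (hf.toLp f))
  rw [L2.inner_def]
  congr 1
  refine integral_congr_ae ?_
  filter_upwards [hf.coeFn_toLp] with t ht
  rw [ht]
  simp [mul_comm]

/-- `C` bounds the products of the components of `U` with test functions in `L²` by `H¹` norms. -/
def IsMultiplierBound (U : Fin n → Torus n → ℝ) (C : ℝ) : Prop :=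
  ∀ (j : Fin n) (φ : TestFun n), MemLp (fun t => U j t * φ.1 t) 2 (torusMeasure n) ∧
    eLpNorm (fun t => U j t * φ.1 t) 2 (torusMeasure n) ≤
      ENNReal.ofReal (C * sobolevNorm 1 (ofFun φ.1))

theorem exists_isMultiplierBound (hn : 2 ≤ n) {θ : ℝ} (hθ2 : 2 < θ) (hθn : (n : ℝ) ≤ θ)
    {U : Fin n → Torus n → ℝ} (hU : ∀ j, MemLp (U j) (ENNReal.ofReal θ) (torusMeasure n)) :
    ∃ C, 0 ≤ C ∧ IsMultiplierBound U C := by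
  choose C hC using fun j => exists_eLpNorm_mul_testFun_le hn hθ2 hθn (hU j)
  refine ⟨∑ j, (C j : ℝ), Finset.sum_nonneg fun j _ => (C j).2, fun j φ => ⟨(hC j φ).1, ?_⟩⟩
  refine (hC j φ).2.trans (ENNReal.ofReal_le_ofReal ?_)
  refine mul_le_mul_of_nonneg_right ?_ (sobolevNorm_nonneg _ _)
  exact Finset.single_le_sum (f := fun j => (C j : ℝ)) (fun j _ => (C j).2) (Finset.mem_univ j)

/-- Cauchy–Schwarz on each `∫ ∂_j v (U_j φ)` bounds the action on test functions by the `H¹` norm of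
`φ`; the duality criterion `memSobolev_neg_one_of_forall_abs_le` concludes. -/
theorem advectScalar_bound {U : Fin n → Torus n → ℝ} (hU : ∀ j, MemLp (U j) 2 (torusMeasure n))
    {C : ℝ} (hC0 : 0 ≤ C) (hC : IsMultiplierBound U C) {v : Distr n} (hv : MemSobolev 1 v) :
    MemSobolev (-1) (advectScalar U v) ∧
      sobolevNorm (-1) (advectScalar U v) ≤ n * (2 * Real.pi * C) * sobolevNorm 1 v := by
  have h0 := sobolevNorm_nonneg 1 v
  refine memSobolev_neg_one_of_forall_abs_le (by positivity) fun φ => ?_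
  have hφ := sobolevNorm_nonneg 1 (ofFun φ.1)
  rw [advectScalar_apply hU]
  refine (Finset.abs_sum_le_sum_abs _ _).trans ?_
  have h1 : ∀ j ∈ Finset.univ, |∫ t, toL2 (Distr.pderiv j v) t * (U j t * φ.1 t) ∂torusMeasure n| ≤
      (2 * Real.pi * sobolevNorm 1 v) * (C * sobolevNorm 1 (ofFun φ.1)) := fun j _ => by
    refine (abs_integral_mul_le_norm_mul _ (hC j φ).1).trans ?_
    refine mul_le_mul (norm_toL2_pderiv_le hv j) ?_ ENNReal.toReal_nonneg (by positivity)
    exact ENNReal.toReal_le_of_le_ofReal (by positivity) (hC j φ).2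
  refine (Finset.sum_le_card_nsmul _ _ _ h1).trans (le_of_eq ?_)
  simp
  ring

theorem sum_mul_fourierCoef_of_divergence_eq_zero {u : Fin n → Distr n}
    (hu : divergence u = 0) (ξ : Fin n → ℤ) : ∑ j, (ξ j : ℂ) * fourierCoef (u j) ξ = 0 := by
  have h := congrArg (fun T => fourierCoef T ξ) hu
  simp only [divergence, fourierCoef_sum, fourierCoef_pderiv, fourierCoef_zero_distr] at h
  have h2 : (2 * Real.pi * Complex.I : ℂ) * ∑ j, (ξ j : ℂ) * fourierCoef (u j) ξ = 0 := by
    rw [← h, Finset.mul_sum]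
    exact Finset.sum_congr rfl fun j _ => by ring
  exact (mul_eq_zero.1 h2).resolve_left Complex.two_pi_I_ne_zero

/-- By Parseval the mean of `U_j ∂_j v` is a sum over `ξ` in which the factor `ξ · Û(ξ)` appears,
conjugated, at every frequency; it vanishes since `div U = 0`. Without zero mean the momentum
equation could not live in `Ḣ⁻¹`. -/
theorem fourierCoef_advectScalar_zero {U : Fin n → Torus n → ℝ}
    (hU : ∀ j, MemLp (U j) 2 (torusMeasure n)) (hdiv : divergence (fun j => ofFun (U j)) = 0)
    {v : Distr n} (hv : MemSobolev 1 v) : fourierCoef (advectScalar U v) 0 = 0 := by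
  unfold advectScalar
  rw [fourierCoef_zero_ofFun (integrable_sum_advect hU v),
    integral_finsetSum _ fun j _ => integrable_advect hU v j]
  have h1 := hasSum_sum (s := Finset.univ) fun j _ =>
    hasSum_conj_fourierCoef_mul (hU j) (Lp.memLp (toL2 (Distr.pderiv j v)))
  rw [← Complex.ofReal_sum] at h1
  refine h1.unique (hasSum_zero.congr_fun fun ξ => ?_)
  have h2 := sum_mul_fourierCoef_of_divergence_eq_zero hdiv ξ
  calc _ = ∑ j, conj ((ξ j : ℂ) * fourierCoef (ofFun (U j)) ξ) *
        (2 * Real.pi * Complex.I * fourierCoef v ξ) := by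
        refine Finset.sum_congr rfl fun j _ => ?_
        rw [ofFun_toL2 (summable_pderiv hv j), fourierCoef_pderiv, map_mul, map_intCast]
        ring
    _ = 0 := by
        rw [← Finset.sum_mul, ← map_sum, h2, map_zero, zero_mul]

theorem toL2_pderiv_testFun (φ : TestFun n) (j : Fin n) :
    (toL2 (Distr.pderiv j (ofFun φ.1)) : Torus n → ℝ) =ᵐ[torusMeasure n]
      (TestFun.pderiv j φ).1 := by
  have h := memLp_testFun (TestFun.pderiv j φ) 2
  rw [pderiv_ofFun, ← ofFun_congr h.coeFn_toLp, toL2_ofFun]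
  exact h.coeFn_toLp

/-- Since `2 φ ∂_j φ = ∂_j(φ²)` and `φ²` is a test function, twice the value is, up to sign, `div U`
applied to `φ²`. -/
theorem advectScalar_testFun_self {U : Fin n → Torus n → ℝ}
    (hU : ∀ j, MemLp (U j) 2 (torusMeasure n)) (hdiv : divergence (fun j => ofFun (U j)) = 0)
    (φ : TestFun n) : (advectScalar U (ofFun φ.1)).1 φ = 0 := by
  have h1 : (divergence (fun j => ofFun (U j))).1 (TestFun.mul φ φ) =
      ∑ j, -((ofFun (U j)).1 (TestFun.pderiv j (TestFun.mul φ φ))) := by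
    simp only [divergence, Submodule.coe_sum, LinearMap.sum_apply]
    rfl
  rw [hdiv] at h1
  rw [advectScalar_apply hU]
  have h2 : ∀ j, (ofFun (U j)).1 (TestFun.pderiv j (TestFun.mul φ φ)) =
      2 * ∫ t, toL2 (Distr.pderiv j (ofFun φ.1)) t * (U j t * φ.1 t) ∂torusMeasure n := fun j => by
    rw [ofFun_apply (integrable_of_memLp_two (hU j)), ← integral_const_mul]
    refine integral_congr_ae ?_
    filter_upwards [toL2_pderiv_testFun φ j] with t ht
    rw [ht]
    change U j t * torusDeriv j (φ.1 * φ.1) t = 2 * (torusDeriv j φ.1 t * (U j t * φ.1 t))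
    rw [torusDeriv_mul]
    ring
  simp_rw [h2] at h1
  rw [Finset.sum_neg_distrib, ← Finset.mul_sum] at h1
  have h3 : (0 : ℝ) = -(2 * _) := h1
  linarith

/-- The cancellation for test functions extends by density, because the pairing is continuous in
both arguments for the `H¹` norm. -/
theorem dualPair_advectScalar_self {U : Fin n → Torus n → ℝ}
    (hU : ∀ j, MemLp (U j) 2 (torusMeasure n)) (hdiv : divergence (fun j => ofFun (U j)) = 0)
    {C : ℝ} (hC0 : 0 ≤ C) (hC : IsMultiplierBound U C) {v : Distr n} (hv : MemSobolev 1 v) :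
    dualPair (advectScalar U v) v = 0 := by
  set K := n * (2 * Real.pi * C)
  have hK : 0 ≤ K := by positivity
  set N := sobolevNorm 1 v
  have hN : 0 ≤ N := sobolevNorm_nonneg _ _
  have key : ∀ ε > 0, |dualPair (advectScalar U v) v| ≤ ε * (2 * K * N) := by
    intro ε hε
    obtain ⟨φ, h1, h2, h3⟩ := exists_testFun_sobolevNorm_sub_le hv hε
    set w := v - ofFun φ.1 with hw
    have hwm : MemSobolev 1 w := by
      have : w = v + (-1 : ℝ) • ofFun φ.1 := by rw [hw]; module
      rw [this]
      exact hv.add (h2.smul _)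
    have hv' : v = w + ofFun φ.1 := by rw [hw]; module
    have hb := advectScalar_bound hU hC0 hC hv
    have hbw := advectScalar_bound hU hC0 hC hwm
    have hbφ := advectScalar_bound hU hC0 hC h2
    -- With `v = w + φ` and `w` small, the term in which `φ` occurs twice vanishes, and each
    -- remaining term contains `w`.
    have e1 : dualPair (advectScalar U v) v =
        dualPair (advectScalar U v) w + dualPair (advectScalar U w) (ofFun φ.1) := by
      have e2 : dualPair (advectScalar U v) v =
          dualPair (advectScalar U v) w + dualPair (advectScalar U v) (ofFun φ.1) := by
        conv_lhs => rw [hv']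
        rw [dualPair_add_right (s := 1) (by rw [← hv']; exact hb.1) hwm h2, ← hv']
      rw [e2]
      congr 1
      conv_lhs => rw [hv']
      rw [advectScalar_add hU hwm h2, dualPair_add_left (s := 1) hbw.1 hbφ.1 h2,
        dualPair_testFun hbφ.1, advectScalar_testFun_self hU hdiv, add_zero]
    rw [e1]
    refine (abs_add_le _ _).trans ?_
    have e3 : |dualPair (advectScalar U v) w| ≤ K * N * ε :=
      (abs_dualPair_le hb.1 hwm).trans
        (mul_le_mul hb.2 h1 (sobolevNorm_nonneg _ _) (by positivity))
    have e4 : |dualPair (advectScalar U w) (ofFun φ.1)| ≤ K * ε * N :=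
      (abs_dualPair_le hbw.1 h2).trans
        (mul_le_mul (hbw.2.trans (by gcongr)) h3 (sobolevNorm_nonneg _ _) (by positivity))
    linarith
  have h0 : |dualPair (advectScalar U v) v| ≤ 0 := by
    refine le_of_forall_pos_le_add fun ε hε => ?_
    have h1 := key (ε / (2 * K * N + 1)) (by positivity)
    refine h1.trans ?_
    rw [zero_add, div_mul_eq_mul_div, div_le_iff₀ (by positivity)]
    nlinarith
  exact abs_eq_zero.1 (le_antisymm h0 (abs_nonneg _))

/-! ### Norms of Sobolev spaces -/

theorem memSobolev_zero_distr (s : ℝ) : MemSobolev s (0 : Distr n) := by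
  simp [MemSobolev, fourierCoef_zero_distr, summable_zero]

theorem MemSobolev.neg {s : ℝ} {T : Distr n} (hT : MemSobolev s T) : MemSobolev s (-T) := by
  unfold MemSobolev at hT ⊢
  simpa only [fourierCoef_neg_distr, norm_neg] using hT

theorem MemSobolev.sub {s : ℝ} {S T : Distr n} (hS : MemSobolev s S) (hT : MemSobolev s T) :
    MemSobolev s (S - T) := by
  have : S - T = S + -T := by module
  rw [this]
  exact hS.add hT.neg

theorem memSobolev_sum {ι : Type*} {s : ℝ} (F : Finset ι) {T : ι → Distr n}
    (hT : ∀ i, MemSobolev s (T i)) : MemSobolev s (∑ i ∈ F, T i) := by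
  classical
  induction F using Finset.induction_on with
  | empty => simpa using memSobolev_zero_distr s
  | insert i F hi ih =>
    rw [Finset.sum_insert hi]
    exact (hT i).add ih

theorem rho_rpow_nonneg (ξ : Fin n → ℤ) (r : ℝ) : 0 ≤ rho ξ ^ r := Real.rpow_nonneg (rho_nonneg ξ) r

theorem sobolevNorm_sq (s : ℝ) (T : Distr n) :
    sobolevNorm s T ^ 2 = ∑' ξ, rho ξ ^ (2 * s) * ‖fourierCoef T ξ‖ ^ 2 :=
  Real.sq_sqrt (tsum_nonneg fun ξ => mul_nonneg (rho_rpow_nonneg ξ _) (sq_nonneg _))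

theorem rho_rpow_two_mul (ξ : Fin n → ℤ) (s : ℝ) : rho ξ ^ (2 * s) = (rho ξ ^ s) ^ 2 := by
  rw [← Real.rpow_natCast, ← Real.rpow_mul (rho_nonneg ξ)]
  congr 1
  push_cast
  ring

theorem sobolevNorm_add_le {s : ℝ} {S T : Distr n} (hS : MemSobolev s S) (hT : MemSobolev s T) :
    sobolevNorm s (S + T) ≤ sobolevNorm s S + sobolevNorm s T := by
  refine le_of_sq_le_sq ?_ (add_nonneg (sobolevNorm_nonneg _ _) (sobolevNorm_nonneg _ _))
  have hST := hS.add hT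
  rw [add_sq, sobolevNorm_sq, sobolevNorm_sq, sobolevNorm_sq]
  unfold sobolevNorm
  unfold MemSobolev at hS hT hST
  simp_rw [rho_rpow_two_mul, ← mul_pow] at hS hT hST ⊢
  have h1 := abs_tsum_mul_le hS hT
  have h2 := summable_mul_of_summable_sq hS hT
  have h3 : ∑' ξ, (rho ξ ^ s * ‖fourierCoef (S + T) ξ‖) ^ 2 ≤
      ∑' ξ, ((rho ξ ^ s * ‖fourierCoef S ξ‖) ^ 2 + 2 * ((rho ξ ^ s * ‖fourierCoef S ξ‖) *
        (rho ξ ^ s * ‖fourierCoef T ξ‖)) + (rho ξ ^ s * ‖fourierCoef T ξ‖) ^ 2) := by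
    refine hST.tsum_le_tsum (fun ξ => ?_) ((hS.add (h2.mul_left 2)).add hT)
    rw [fourierCoef_add]
    have h4 := rho_rpow_nonneg ξ s
    have h5 : rho ξ ^ s * ‖fourierCoef S ξ + fourierCoef T ξ‖ ≤
        rho ξ ^ s * ‖fourierCoef S ξ‖ + rho ξ ^ s * ‖fourierCoef T ξ‖ := by
      rw [← mul_add]
      exact mul_le_mul_of_nonneg_left (norm_add_le _ _) h4
    refine (pow_le_pow_left₀ (by positivity) h5 2).trans (le_of_eq ?_)
    ring
  rw [(hS.add (h2.mul_left 2)).tsum_add hT, hS.tsum_add (h2.mul_left 2), tsum_mul_left] at h3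
  have h6 := le_abs_self (∑' ξ, rho ξ ^ s * ‖fourierCoef S ξ‖ * (rho ξ ^ s * ‖fourierCoef T ξ‖))
  linarith

theorem sobolevNorm_smul (s c : ℝ) (T : Distr n) :
    sobolevNorm s (c • T) = |c| * sobolevNorm s T := by
  unfold sobolevNorm
  rw [← Real.sqrt_sq_eq_abs, ← Real.sqrt_mul (sq_nonneg c), ← tsum_mul_left]
  congr 1
  refine tsum_congr fun ξ => ?_
  rw [fourierCoef_smul, norm_mul, mul_pow, Complex.norm_real, Real.norm_eq_abs, sq_abs]
  ring

theorem sobolevNorm_neg (s : ℝ) (T : Distr n) : sobolevNorm s (-T) = sobolevNorm s T := by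
  unfold sobolevNorm
  simp only [fourierCoef_neg_distr, norm_neg]

theorem sobolevNorm_zero_distr (s : ℝ) : sobolevNorm s (0 : Distr n) = 0 := by
  simp [sobolevNorm, fourierCoef_zero_distr]

theorem sobolevNorm_sum_le {ι : Type*} {s : ℝ} (F : Finset ι) {T : ι → Distr n}
    (hT : ∀ i, MemSobolev s (T i)) :
    sobolevNorm s (∑ i ∈ F, T i) ≤ ∑ i ∈ F, sobolevNorm s (T i) := by
  classical
  induction F using Finset.induction_on with
  | empty => simp [sobolevNorm_zero_distr]
  | insert i F hi ih =>
    rw [Finset.sum_insert hi, Finset.sum_insert hi]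
    exact (sobolevNorm_add_le (hT i) (memSobolev_sum F hT)).trans (by gcongr)

theorem rpow_mul_norm_sq_pderiv_le {r s : ℝ} (hrs : r + 1 = s) (T : Distr n) (j : Fin n)
    (ξ : Fin n → ℤ) : rho ξ ^ (2 * r) * ‖fourierCoef (Distr.pderiv j T) ξ‖ ^ 2 ≤
      (2 * Real.pi) ^ 2 * (rho ξ ^ (2 * s) * ‖fourierCoef T ξ‖ ^ 2) := by
  have h1 : rho ξ ^ (2 * s) = rho ξ ^ (2 * r) * rho ξ ^ 2 := by
    rw [← Real.rpow_natCast, ← Real.rpow_add (rho_pos ξ), ← hrs]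
    congr 1
    push_cast
    ring
  have h2 := norm_sq_fourierCoef_pderiv_le T j ξ
  have h3 := rho_rpow_nonneg ξ (2 * r)
  calc _ ≤ rho ξ ^ (2 * r) * ((2 * Real.pi) ^ 2 * (rho ξ ^ 2 * ‖fourierCoef T ξ‖ ^ 2)) := by gcongr
    _ = _ := by rw [h1]; ring

theorem MemSobolev.pderiv {r s : ℝ} (hrs : r + 1 = s) {T : Distr n} (hT : MemSobolev s T)
    (j : Fin n) : MemSobolev r (Distr.pderiv j T) :=
  Summable.of_nonneg_of_le (fun ξ => mul_nonneg (rho_rpow_nonneg ξ _) (sq_nonneg _))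
    (rpow_mul_norm_sq_pderiv_le hrs T j) (Summable.mul_left _ hT)

theorem sobolevNorm_pderiv_le {r s : ℝ} (hrs : r + 1 = s) {T : Distr n} (hT : MemSobolev s T)
    (j : Fin n) : sobolevNorm r (Distr.pderiv j T) ≤ 2 * Real.pi * sobolevNorm s T := by
  have h0 := sobolevNorm_nonneg s T
  refine le_of_sq_le_sq ?_ (by positivity)
  rw [mul_pow, sobolevNorm_sq, sobolevNorm_sq, ← tsum_mul_left]
  exact (hT.pderiv hrs j).tsum_le_tsum (rpow_mul_norm_sq_pderiv_le hrs T j)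
    (Summable.mul_left _ hT)

theorem memSobolev_zero_iff {T : Distr n} :
    MemSobolev 0 T ↔ Summable fun ξ => ‖fourierCoef T ξ‖ ^ 2 := by
  simp [MemSobolev]

theorem memSobolev_l2Distr (p : L2Dot n) : MemSobolev 0 (l2Distr p) :=
  memSobolev_zero_iff.2 (hasSum_l2Distr p).summable

theorem sobolevNorm_l2Distr (p : L2Dot n) : sobolevNorm 0 (l2Distr p) = ‖p‖ := by
  unfold sobolevNorm
  simp only [mul_zero, Real.rpow_zero, one_mul]
  rw [(hasSum_l2Distr p).tsum_eq, Real.sqrt_sq (norm_nonneg _)]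

theorem sobolevNorm_eq_zero {s : ℝ} {T : Distr n} (hT : MemSobolev s T)
    (h : sobolevNorm s T = 0) : T = 0 := by
  have h1 := sobolevNorm_sq s T
  rw [h, zero_pow two_ne_zero] at h1
  have h2 : HasSum (fun ξ => rho ξ ^ (2 * s) * ‖fourierCoef T ξ‖ ^ 2) 0 := by
    rw [h1]
    exact hT.hasSum
  have h3 := (hasSum_zero_iff_of_nonneg fun ξ =>
    mul_nonneg (rho_rpow_nonneg ξ _) (sq_nonneg _)).1 h2
  refine distr_ext_fourierCoef fun ξ => ?_
  have h4 := congrFun h3 ξ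
  have h5 : 0 < rho ξ ^ (2 * s) := Real.rpow_pos_of_pos (rho_pos ξ) _
  rw [fourierCoef_zero_distr]
  simpa [h5.ne'] using h4

/-- The norm of vector fields whose components are distributions. -/
def fieldNorm (s : ℝ) (u : Fin n → Distr n) : ℝ := √(∑ k, sobolevNorm s (u k) ^ 2)

theorem vecNorm_eq_fieldNorm {s : ℝ} (u : Fin n → HDot n s) :
    vecNorm s u = fieldNorm s (comps u) := rfl

theorem fieldNorm_nonneg (s : ℝ) (u : Fin n → Distr n) : 0 ≤ fieldNorm s u := Real.sqrt_nonneg _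

theorem fieldNorm_sq (s : ℝ) (u : Fin n → Distr n) :
    fieldNorm s u ^ 2 = ∑ k, sobolevNorm s (u k) ^ 2 :=
  Real.sq_sqrt (Finset.sum_nonneg fun _ _ => sq_nonneg _)

theorem sobolevNorm_le_fieldNorm (s : ℝ) (u : Fin n → Distr n) (k : Fin n) :
    sobolevNorm s (u k) ≤ fieldNorm s u := by
  refine le_of_sq_le_sq ?_ (fieldNorm_nonneg _ _)
  rw [fieldNorm_sq]
  exact Finset.single_le_sum (f := fun k => sobolevNorm s (u k) ^ 2) (fun _ _ => sq_nonneg _)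
    (Finset.mem_univ k)

theorem fieldNorm_le_of_forall_le {s : ℝ} {u : Fin n → Distr n} {C : ℝ}
    (h : ∀ k, sobolevNorm s (u k) ≤ C) (hC : 0 ≤ C) : fieldNorm s u ≤ n * C := by
  refine le_of_sq_le_sq ?_ (by positivity)
  rw [fieldNorm_sq]
  have h1 : ∀ k ∈ Finset.univ, sobolevNorm s (u k) ^ 2 ≤ C ^ 2 := fun k _ =>
    pow_le_pow_left₀ (sobolevNorm_nonneg _ _) (h k) 2
  refine (Finset.sum_le_card_nsmul _ _ _ h1).trans ?_
  simp only [Finset.card_univ, Fintype.card_fin, nsmul_eq_mul, mul_pow]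
  refine mul_le_mul_of_nonneg_right ?_ (sq_nonneg _)
  exact_mod_cast Nat.le_self_pow two_ne_zero n

theorem fieldNorm_add_le {s : ℝ} {u v : Fin n → Distr n} (hu : ∀ k, MemSobolev s (u k))
    (hv : ∀ k, MemSobolev s (v k)) :
    fieldNorm s (fun k => u k + v k) ≤ fieldNorm s u + fieldNorm s v := by
  have h1 := norm_add_le (WithLp.toLp 2 fun k => sobolevNorm s (u k) : EuclideanSpace ℝ (Fin n))
    (WithLp.toLp 2 fun k => sobolevNorm s (v k))
  simp only [EuclideanSpace.norm_eq, PiLp.add_apply, Real.norm_eq_abs, sq_abs] at h1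
  refine le_trans (Real.sqrt_le_sqrt (Finset.sum_le_sum fun k _ => ?_)) h1
  exact pow_le_pow_left₀ (sobolevNorm_nonneg _ _) (sobolevNorm_add_le (hu k) (hv k)) 2

theorem fieldNorm_neg (s : ℝ) (u : Fin n → Distr n) :
    fieldNorm s (fun k => -u k) = fieldNorm s u := by
  unfold fieldNorm
  simp only [sobolevNorm_neg]

theorem fieldNorm_sub_le {s : ℝ} {u v : Fin n → Distr n} (hu : ∀ k, MemSobolev s (u k))
    (hv : ∀ k, MemSobolev s (v k)) :
    fieldNorm s (fun k => u k - v k) ≤ fieldNorm s u + fieldNorm s v := by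
  have h := fieldNorm_add_le hu fun k => (hv k).neg
  rw [fieldNorm_neg] at h
  convert! h using 2

theorem abs_sum_dualPair_le {f v : Fin n → Distr n} (hf : ∀ k, MemSobolev (-1) (f k))
    (hv : ∀ k, MemSobolev 1 (v k)) :
    |∑ k, dualPair (f k) (v k)| ≤ fieldNorm (-1) f * fieldNorm 1 v := by
  refine (Finset.abs_sum_le_sum_abs _ _).trans ?_
  refine (Finset.sum_le_sum fun k _ => abs_dualPair_le (hf k) (hv k)).trans ?_
  exact Real.sum_mul_le_sqrt_mul_sqrt _ _ _

theorem hasSum_fieldNorm_sq {s : ℝ} {u : Fin n → Distr n} (hu : ∀ k, MemSobolev s (u k)) :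
    HasSum (fun ξ => rho ξ ^ (2 * s) * ∑ k, ‖fourierCoef (u k) ξ‖ ^ 2) (fieldNorm s u ^ 2) := by
  rw [fieldNorm_sq]
  simp_rw [Finset.mul_sum, sobolevNorm_sq]
  exact hasSum_sum fun k _ => (hu k).hasSum

/-! ### Integration by parts -/

theorem dualPair_comm (g f : Distr n) : dualPair g f = dualPair f g := by
  unfold dualPair
  rw [← (Equiv.neg (Fin n → ℤ)).tsum_eq]
  simp [mul_comm]

/-- The sign comes from the second factor being evaluated at `-ξ`. The identity holds term by term,
so no summability is required. -/
theorem dualPair_pderiv_left (j : Fin n) (g f : Distr n) :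
    dualPair (Distr.pderiv j g) f = -dualPair g (Distr.pderiv j f) := by
  unfold dualPair
  rw [← Complex.neg_re, ← tsum_neg]
  congr 1
  refine tsum_congr fun ξ => ?_
  rw [fourierCoef_pderiv, fourierCoef_pderiv]
  push_cast [Pi.neg_apply]
  ring

theorem dualPair_zero_left (f : Distr n) : dualPair 0 f = 0 := by
  simp [dualPair, fourierCoef_zero_distr]

theorem dualPair_neg_left (g f : Distr n) : dualPair (-g) f = -dualPair g f := by
  unfold dualPair
  simp_rw [fourierCoef_neg_distr, neg_mul, tsum_neg, Complex.neg_re]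

theorem dualPair_sum_left {ι : Type*} {s : ℝ} (F : Finset ι) {g : ι → Distr n} {f : Distr n}
    (hg : ∀ i, MemSobolev (-s) (g i)) (hf : MemSobolev s f) :
    dualPair (∑ i ∈ F, g i) f = ∑ i ∈ F, dualPair (g i) f := by
  classical
  induction F using Finset.induction_on with
  | empty => simpa using dualPair_zero_left f
  | insert i F hi ih =>
    rw [Finset.sum_insert hi, Finset.sum_insert hi,
      dualPair_add_left (hg i) (memSobolev_sum F hg) hf, ih]

theorem dualPair_sub_left {s : ℝ} {g h f : Distr n} (hg : MemSobolev (-s) g)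
    (hh : MemSobolev (-s) h) (hf : MemSobolev s f) :
    dualPair (g - h) f = dualPair g f - dualPair h f := by
  have : g - h = g + -h := by module
  rw [this, dualPair_add_left hg hh.neg hf, dualPair_neg_left, sub_eq_add_neg]

/-! ### The Oseen operator without pressure -/

theorem MemSobolev.strain {u : Fin n → Distr n} (hu : ∀ k, MemSobolev 1 (u k)) (j β : Fin n) :
    MemSobolev 0 (strain u j β) :=
  (((hu β).pderiv (zero_add 1) j).add ((hu j).pderiv (zero_add 1) β)).smul _

theorem sobolevNorm_strain_le {u : Fin n → Distr n} (hu : ∀ k, MemSobolev 1 (u k))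
    (j β : Fin n) : sobolevNorm 0 (strain u j β) ≤ 2 * Real.pi * fieldNorm 1 u := by
  unfold PeriodicOseen.strain
  rw [sobolevNorm_smul, abs_of_pos (by norm_num : (0 : ℝ) < 1 / 2)]
  have h1 := sobolevNorm_add_le ((hu β).pderiv (zero_add 1) j) ((hu j).pderiv (zero_add 1) β)
  have h2 := sobolevNorm_pderiv_le (zero_add 1) (hu β) j
  have h3 := sobolevNorm_pderiv_le (zero_add 1) (hu j) β
  have h4 : 2 * Real.pi * sobolevNorm 1 (u β) ≤ 2 * Real.pi * fieldNorm 1 u :=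
    mul_le_mul_of_nonneg_left (sobolevNorm_le_fieldNorm 1 u β) (by positivity)
  have h5 : 2 * Real.pi * sobolevNorm 1 (u j) ≤ 2 * Real.pi * fieldNorm 1 u :=
    mul_le_mul_of_nonneg_left (sobolevNorm_le_fieldNorm 1 u j) (by positivity)
  linarith

theorem strain_add (u v : Fin n → Distr n) (j β : Fin n) :
    strain (fun k => u k + v k) j β = strain u j β + strain v j β := by
  unfold PeriodicOseen.strain
  simp only [map_add]
  module

theorem strain_smul (c : ℝ) (u : Fin n → Distr n) (j β : Fin n) :
    strain (fun k => c • u k) j β = c • strain u j β := by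
  unfold PeriodicOseen.strain
  simp only [map_smul]
  module

/-- The stress tensor `a_{kj}^{αβ} E_{jβ}(u)`. -/
def stress (A : Tensor n) (u : Fin n → Distr n) (k α : Fin n) : Distr n :=
  ∑ j, ∑ β, A k j α β • strain u j β

theorem viscosityOp_eq (A : Tensor n) (u : Fin n → Distr n) (k : Fin n) :
    viscosityOp A u k = ∑ α, Distr.pderiv α (stress A u k α) := rfl

theorem stress_add (A : Tensor n) (u v : Fin n → Distr n) (k α : Fin n) :
    stress A (fun k => u k + v k) k α = stress A u k α + stress A v k α := by
  unfold stress
  simp only [strain_add, smul_add, Finset.sum_add_distrib]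

theorem stress_smul (A : Tensor n) (c : ℝ) (u : Fin n → Distr n) (k α : Fin n) :
    stress A (fun k => c • u k) k α = c • stress A u k α := by
  unfold stress
  simp only [strain_smul, Finset.smul_sum, smul_comm c]

theorem memSobolev_stress (A : Tensor n) {u : Fin n → Distr n} (hu : ∀ k, MemSobolev 1 (u k))
    (k α : Fin n) : MemSobolev 0 (stress A u k α) :=
  memSobolev_sum _ fun j => memSobolev_sum _ fun β => (MemSobolev.strain hu j β).smul _

theorem sobolevNorm_sum_le_nat_mul {s C : ℝ} {T : Fin n → Distr n}
    (hT : ∀ i, MemSobolev s (T i)) (h : ∀ i, sobolevNorm s (T i) ≤ C) :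
    sobolevNorm s (∑ i, T i) ≤ n * C :=
  (sobolevNorm_sum_le _ hT).trans
    ((Finset.sum_le_card_nsmul _ _ _ fun i _ => h i).trans (by simp))

theorem sobolevNorm_stress_le {A : Tensor n} {a : ℝ} (hA : ∀ k j α β, |A k j α β| ≤ a)
    {u : Fin n → Distr n} (hu : ∀ k, MemSobolev 1 (u k)) (k α : Fin n) :
    sobolevNorm 0 (stress A u k α) ≤ n * (n * (a * (2 * Real.pi * fieldNorm 1 u))) := by
  refine sobolevNorm_sum_le_nat_mul
    (fun j => memSobolev_sum _ fun β => (MemSobolev.strain hu j β).smul _) fun j => ?_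
  refine sobolevNorm_sum_le_nat_mul (fun β => (MemSobolev.strain hu j β).smul _) fun β => ?_
  rw [sobolevNorm_smul]
  exact mul_le_mul (hA _ _ _ _) (sobolevNorm_strain_le hu j β) (sobolevNorm_nonneg _ _)
    ((abs_nonneg _).trans (hA k j α β))

/-- The properties of the advecting field that are used: it is solenoidal and square integrable,
and it maps `H¹` into `L²` by multiplication. -/
structure IsAdvectingField (U : Fin n → Torus n → ℝ) (C : ℝ) : Prop where
  memLp : ∀ j, MemLp (U j) 2 (torusMeasure n)
  div_eq_zero : divergence (fun j => ofFun (U j)) = 0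
  nonneg : 0 ≤ C
  bound : IsMultiplierBound U C

/-- The operator `-𝔏 u + (U·∇)u`. -/
def oseenOp (A : Tensor n) (U : Fin n → Torus n → ℝ) (u : Fin n → Distr n) (k : Fin n) : Distr n :=
  -viscosityOp A u k + advectScalar U (u k)

theorem oseenMomentum_eq (A : Tensor n) (U : Fin n → Torus n → ℝ) (u : Fin n → HDot n 1)
    (p : L2Dot n) (k : Fin n) :
    oseenMomentum A U u p k = oseenOp A U (comps u) k + Distr.pderiv k (l2Distr p) := by
  unfold oseenMomentum oseenOp
  rw [advection_eq]
  exact add_right_comm _ _ _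

theorem memSobolev_viscosityOp (A : Tensor n) {u : Fin n → Distr n}
    (hu : ∀ k, MemSobolev 1 (u k)) (k : Fin n) : MemSobolev (-1) (viscosityOp A u k) :=
  memSobolev_sum _ fun α => (memSobolev_stress A hu k α).pderiv (by norm_num) α

theorem memSobolev_oseenOp (A : Tensor n) {U : Fin n → Torus n → ℝ} {C : ℝ}
    (hU : IsAdvectingField U C) {u : Fin n → Distr n} (hu : ∀ k, MemSobolev 1 (u k)) (k : Fin n) :
    MemSobolev (-1) (oseenOp A U u k) :=
  (memSobolev_viscosityOp A hu k).neg.add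
    (advectScalar_bound hU.memLp hU.nonneg hU.bound (hu k)).1

/-- A bound for the norm of `oseenOp`. -/
def oseenBound (n : ℕ) (a C : ℝ) : ℝ :=
  n * (n * (2 * Real.pi * (n * (n * (a * (2 * Real.pi))))) + n * (2 * Real.pi * C))

theorem oseenBound_nonneg (n : ℕ) {a C : ℝ} (ha : 0 ≤ a) (hC : 0 ≤ C) : 0 ≤ oseenBound n a C := by
  unfold oseenBound
  positivity

theorem fieldNorm_oseenOp_le {A : Tensor n} {a : ℝ} (ha : 0 ≤ a) (hA : ∀ k j α β, |A k j α β| ≤ a)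
    {U : Fin n → Torus n → ℝ} {C : ℝ} (hU : IsAdvectingField U C) {u : Fin n → Distr n}
    (hu : ∀ k, MemSobolev 1 (u k)) :
    fieldNorm (-1) (oseenOp A U u) ≤ oseenBound n a C * fieldNorm 1 u := by
  have hN := fieldNorm_nonneg 1 u
  have hC := hU.nonneg
  unfold oseenBound
  rw [mul_assoc]
  refine fieldNorm_le_of_forall_le (fun k => ?_) (by positivity)
  have hadv := advectScalar_bound hU.memLp hU.nonneg hU.bound (hu k)
  refine (sobolevNorm_add_le (memSobolev_viscosityOp A hu k).neg hadv.1).trans ?_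
  rw [sobolevNorm_neg, add_mul]
  refine add_le_add ?_ (hadv.2.trans ?_)
  · rw [viscosityOp_eq, mul_assoc]
    refine sobolevNorm_sum_le_nat_mul
      (fun α => (memSobolev_stress A hu k α).pderiv (by norm_num) α) fun α => ?_
    refine (sobolevNorm_pderiv_le (by norm_num) (memSobolev_stress A hu k α) α).trans ?_
    have := sobolevNorm_stress_le hA hu k α
    calc _ ≤ 2 * Real.pi * (n * (n * (a * (2 * Real.pi * fieldNorm 1 u)))) := by gcongr
      _ = _ := by ring
  · gcongr
    exact sobolevNorm_le_fieldNorm 1 u k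

theorem oseenOp_add (A : Tensor n) {U : Fin n → Torus n → ℝ} {C : ℝ} (hU : IsAdvectingField U C)
    {u v : Fin n → Distr n} (hu : ∀ k, MemSobolev 1 (u k)) (hv : ∀ k, MemSobolev 1 (v k))
    (k : Fin n) :
    oseenOp A U (fun k => u k + v k) k = oseenOp A U u k + oseenOp A U v k := by
  unfold oseenOp
  simp only [viscosityOp_eq, stress_add, map_add, Finset.sum_add_distrib,
    advectScalar_add hU.memLp (hu k) (hv k)]
  module

theorem oseenOp_smul (A : Tensor n) {U : Fin n → Torus n → ℝ} {C : ℝ} (hU : IsAdvectingField U C)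
    (c : ℝ) {u : Fin n → Distr n} (hu : ∀ k, MemSobolev 1 (u k)) (k : Fin n) :
    oseenOp A U (fun k => c • u k) k = c • oseenOp A U u k := by
  unfold oseenOp
  simp only [viscosityOp_eq, stress_smul, map_smul, ← Finset.smul_sum,
    advectScalar_smul hU.memLp c (hu k)]
  module

theorem fourierCoef_pderiv_zero (j : Fin n) (T : Distr n) :
    fourierCoef (Distr.pderiv j T) 0 = 0 := by
  simp [fourierCoef_pderiv]

theorem fourierCoef_oseenOp_zero (A : Tensor n) {U : Fin n → Torus n → ℝ} {C : ℝ}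
    (hU : IsAdvectingField U C) {u : Fin n → Distr n} (hu : ∀ k, MemSobolev 1 (u k)) (k : Fin n) :
    fourierCoef (oseenOp A U u k) 0 = 0 := by
  unfold oseenOp
  rw [fourierCoef_add, fourierCoef_neg_distr, viscosityOp_eq, fourierCoef_sum,
    fourierCoef_advectScalar_zero hU.memLp hU.div_eq_zero (hu k)]
  simp [fourierCoef_pderiv_zero]

/-! ### The bilinear forms -/

theorem memSobolev_comps {s : ℝ} (u : Fin n → HDot n s) (k : Fin n) :
    MemSobolev s (comps u k) := (u k).2.1

theorem fourierCoef_comps_zero {s : ℝ} (u : Fin n → HDot n s) (k : Fin n) :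
    fourierCoef (comps u k) 0 = 0 := (u k).2.2

theorem stress_comm {A : Tensor n} (hA : A.IsSymm) (u : Fin n → Distr n) (k α : Fin n) :
    stress A u k α = stress A u α k := by
  unfold stress
  exact Finset.sum_congr rfl fun j _ => Finset.sum_congr rfl fun β _ => by rw [(hA k j α β).1]

theorem memSobolev_pderiv_l2Distr (p : L2Dot n) (k : Fin n) :
    MemSobolev (-1) (Distr.pderiv k (l2Distr p)) :=
  (memSobolev_l2Distr p).pderiv (by norm_num) k

theorem dualPair_stress_strain {A : Tensor n} {u v : Fin n → Distr n}
    (hu : ∀ k, MemSobolev 1 (u k)) (hv : ∀ k, MemSobolev 1 (v k)) (i α : Fin n) :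
    dualPair (stress A u i α) (strain v i α) =
      1 / 2 * (dualPair (stress A u i α) (Distr.pderiv i (v α)) +
        dualPair (stress A u i α) (Distr.pderiv α (v i))) := by
  have h0 : MemSobolev (-0) (stress A u i α) := by
    rw [neg_zero]
    exact memSobolev_stress A hu i α
  unfold PeriodicOseen.strain
  rw [dualPair_smul_right, dualPair_add_right h0 ((hv α).pderiv (zero_add 1) i)
    ((hv i).pderiv (zero_add 1) α)]

/-- The symmetry of the tensor makes the stress symmetric, so the two halves of the strain of `v`
contribute equally and only `∂_α v_i` remains. Integration by parts moves this derivative onto the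
stress. -/
theorem sum_dualPair_stress_strain {A : Tensor n} (hA : A.IsSymm) {u v : Fin n → Distr n}
    (hu : ∀ k, MemSobolev 1 (u k)) (hv : ∀ k, MemSobolev 1 (v k)) :
    ∑ i, ∑ α, dualPair (stress A u i α) (strain v i α) =
      ∑ k, dualPair (-viscosityOp A u k) (v k) := by
  have h1 : ∑ i, ∑ α, dualPair (stress A u i α) (Distr.pderiv i (v α)) =
      ∑ i, ∑ α, dualPair (stress A u i α) (Distr.pderiv α (v i)) := by
    rw [Finset.sum_comm]
    exact Finset.sum_congr rfl fun i _ => Finset.sum_congr rfl fun α _ => by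
      rw [stress_comm hA]
  have h2 : ∀ k, dualPair (-viscosityOp A u k) (v k) =
      ∑ α, dualPair (stress A u k α) (Distr.pderiv α (v k)) := fun k => by
    rw [dualPair_neg_left, viscosityOp_eq, dualPair_sum_left _
      (fun α => (memSobolev_stress A hu k α).pderiv (by norm_num) α) (hv k),
      ← Finset.sum_neg_distrib]
    exact Finset.sum_congr rfl fun α _ => by rw [dualPair_pderiv_left, neg_neg]
  simp_rw [h2, dualPair_stress_strain hu hv, ← Finset.mul_sum, Finset.sum_add_distrib]
  rw [h1]
  ring

theorem formA_eq {A : Tensor n} (hA : A.IsSymm) {U : Fin n → Torus n → ℝ} {C : ℝ}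
    (hU : IsAdvectingField U C) (u v : Fin n → HDot n 1) :
    formA A U u v = ∑ k, dualPair (oseenOp A U (comps u) k) (comps v k) := by
  have hu := memSobolev_comps u
  have hv := memSobolev_comps v
  have h1 := sum_dualPair_stress_strain hA hu hv
  unfold formA
  change ∑ i, ∑ α, dualPair (stress A (comps u) i α) (strain (comps v) i α) + _ = _
  rw [h1, ← Finset.sum_add_distrib]
  refine Finset.sum_congr rfl fun k _ => ?_
  unfold oseenOp
  rw [advection_eq, dualPair_add_left (memSobolev_viscosityOp A hu k).neg
    (advectScalar_bound hU.memLp hU.nonneg hU.bound (hu k)).1 (hv k)]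

theorem formB_eq (v : Fin n → HDot n 1) (p : L2Dot n) :
    formB v p = ∑ k, dualPair (Distr.pderiv k (l2Distr p)) (comps v k) := by
  unfold formB divergence
  rw [dualPair_sum_left (s := 0) _ (fun k => (by
    rw [neg_zero]
    exact (memSobolev_comps v k).pderiv (zero_add 1) k)) (memSobolev_l2Distr p),
    ← Finset.sum_neg_distrib]
  refine Finset.sum_congr rfl fun k _ => ?_
  rw [dualPair_pderiv_left, neg_neg, dualPair_comm]

/-- The variational equation now says that the momentum residual is annihilated by every `v` in
`Ḣ¹`, which makes it comparable with the distributional one. -/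
theorem formA_add_formB {A : Tensor n} (hA : A.IsSymm) {U : Fin n → Torus n → ℝ} {C : ℝ}
    (hU : IsAdvectingField U C) (u v : Fin n → HDot n 1) (p : L2Dot n) :
    formA A U u v + formB v p = ∑ k, dualPair (oseenMomentum A U u p k) (comps v k) := by
  rw [formA_eq hA hU, formB_eq, ← Finset.sum_add_distrib]
  refine Finset.sum_congr rfl fun k _ => ?_
  rw [oseenMomentum_eq, dualPair_add_left (memSobolev_oseenOp A hU (memSobolev_comps u) k)
    (memSobolev_pderiv_l2Distr p k) (memSobolev_comps v k)]

/-! ### Equivalence of the two formulations -/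

/-- The Riesz representation of an element of `Ḣ⁻¹`. -/
theorem exists_riesz {T : Distr n} (hT : MemSobolev (-1) T) (h0 : fourierCoef T 0 = 0) :
    ∃ v : HDot n 1, ∀ ξ, fourierCoef (v : Distr n) ξ =
      (((rho ξ ^ 2)⁻¹ : ℝ) : ℂ) * fourierCoef T ξ := by
  refine exists_HDot_one (fun ξ => ?_) (by rw [h0, mul_zero]) ?_
  · simp [rho_neg, fourierCoef_neg]
  · refine (memSobolev_neg_one_iff.1 hT).congr fun ξ => ?_
    rw [norm_mul, mul_pow, Complex.norm_real, Real.norm_eq_abs, sq_abs]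
    have := (rho_pos ξ).ne'
    field_simp

/-- The pairing is the weighted sum of squares `∑ c(ξ)|T̂(ξ)|²`. It is used with `c = ρ⁻²`, where
`v` is the Riesz representative, and with `c = 1`, where it is the `L²` norm. -/
theorem dualPair_self_nonneg_and_eq_zero {s : ℝ} {T v : Distr n} {c : (Fin n → ℤ) → ℝ}
    (hc : ∀ ξ, 0 < c ξ) (hT : MemSobolev (-s) T) (hv : MemSobolev s v)
    (hTv : ∀ ξ, fourierCoef v ξ = (c ξ : ℂ) * fourierCoef T ξ) :
    0 ≤ dualPair T v ∧ (dualPair T v = 0 → T = 0) := by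
  have h := hasSum_dualPair hT hv
  have h1 : ∀ ξ, (fourierCoef T ξ * conj (fourierCoef v ξ)).re = c ξ * ‖fourierCoef T ξ‖ ^ 2 := by
    intro ξ
    rw [hTv, map_mul, Complex.conj_ofReal, mul_left_comm, Complex.mul_conj, ← Complex.ofReal_mul,
      Complex.ofReal_re, Complex.normSq_eq_norm_sq]
  simp_rw [h1] at h
  have hnn : ∀ ξ, 0 ≤ c ξ * ‖fourierCoef T ξ‖ ^ 2 := fun ξ =>
    mul_nonneg (hc ξ).le (sq_nonneg _)
  refine ⟨h.nonneg hnn, fun h0 => distr_ext_fourierCoef fun ξ => ?_⟩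
  rw [h0] at h
  have h2 := congrFun ((hasSum_zero_iff_of_nonneg hnn).1 h) ξ
  rw [fourierCoef_zero_distr]
  simpa [(hc ξ).ne'] using h2

/-- Test with the Riesz representatives of the components. They belong to `Ḣ¹` because every `R k`
has zero mean, and then a sum of nonnegative terms vanishes. -/
theorem eq_zero_of_forall_sum_dualPair {R : Fin n → Distr n} (hR : ∀ k, MemSobolev (-1) (R k))
    (h0 : ∀ k, fourierCoef (R k) 0 = 0)
    (h : ∀ v : Fin n → HDot n 1, ∑ k, dualPair (R k) (comps v k) = 0) (k : Fin n) : R k = 0 := by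
  choose v hv using fun k => exists_riesz (hR k) (h0 k)
  have h1 := fun k => dualPair_self_nonneg_and_eq_zero (c := fun ξ => (rho ξ ^ 2)⁻¹)
    (fun ξ => by have := rho_pos ξ; positivity) (hR k) (memSobolev_comps v k) (hv k)
  exact (h1 k).2 ((Finset.sum_eq_zero_iff_of_nonneg fun k _ => (h1 k).1).1 (h v) k
    (Finset.mem_univ k))

theorem memSobolev_divergence {u : Fin n → Distr n} (hu : ∀ k, MemSobolev 1 (u k)) :
    MemSobolev 0 (divergence u) :=
  memSobolev_sum _ fun k => (hu k).pderiv (zero_add 1) k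

theorem fourierCoef_divergence_zero (u : Fin n → Distr n) : fourierCoef (divergence u) 0 = 0 := by
  simp [divergence, fourierCoef_sum, fourierCoef_pderiv_zero]

theorem exists_l2Distr_eq_divergence (u : Fin n → HDot n 1) :
    ∃ g : L2Dot n, l2Distr g = divergence (comps u) :=
  exists_l2Distr_eq (fourierCoef_divergence_zero _)
    (memSobolev_zero_iff.1 (memSobolev_divergence (memSobolev_comps u)))

theorem memSobolev_oseenMomentum (A : Tensor n) {U : Fin n → Torus n → ℝ} {C : ℝ}
    (hU : IsAdvectingField U C) (u : Fin n → HDot n 1) (p : L2Dot n) (k : Fin n) :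
    MemSobolev (-1) (oseenMomentum A U u p k) := by
  rw [oseenMomentum_eq]
  exact (memSobolev_oseenOp A hU (memSobolev_comps u) k).add (memSobolev_pderiv_l2Distr p k)

theorem fourierCoef_oseenMomentum_zero (A : Tensor n) {U : Fin n → Torus n → ℝ} {C : ℝ}
    (hU : IsAdvectingField U C) (u : Fin n → HDot n 1) (p : L2Dot n) (k : Fin n) :
    fourierCoef (oseenMomentum A U u p k) 0 = 0 := by
  rw [oseenMomentum_eq, fourierCoef_add, fourierCoef_oseenOp_zero A hU (memSobolev_comps u),
    fourierCoef_pderiv_zero, add_zero]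

theorem isOseenSolution_iff_isVariationalSolution {A : Tensor n} (hA : A.IsSymm)
    {U : Fin n → Torus n → ℝ} {C : ℝ} (hU : IsAdvectingField U C) (f : Fin n → HDot n (-1))
    (g : L2Dot n) (u : Fin n → HDot n 1) (p : L2Dot n) :
    IsOseenSolution A U f g u p ↔ IsVariationalSolution A U f g u p := by
  constructor
  · rintro ⟨h1, h2⟩
    refine ⟨fun v => ?_, fun q => ?_⟩
    · rw [formA_add_formB hA hU]
      simp_rw [h1]
    · unfold formB
      rw [h2]
  · rintro ⟨h1, h2⟩
    refine ⟨fun k => sub_eq_zero.1 ?_, ?_⟩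
    · refine eq_zero_of_forall_sum_dualPair (R := fun k => oseenMomentum A U u p k - comps f k)
        (fun k => (memSobolev_oseenMomentum A hU u p k).sub (memSobolev_comps f k))
        (fun k => ?_) (fun v => ?_) k
      · rw [fourierCoef_sub, fourierCoef_oseenMomentum_zero A hU, fourierCoef_comps_zero, sub_zero]
      · have h3 := h1 v
        rw [formA_add_formB hA hU] at h3
        rw [← sub_eq_zero, ← Finset.sum_sub_distrib] at h3
        rw [← h3]
        exact Finset.sum_congr rfl fun k _ => dualPair_sub_left
          (memSobolev_oseenMomentum A hU u p k) (memSobolev_comps f k) (memSobolev_comps v k)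
    · obtain ⟨d, hd⟩ := exists_l2Distr_eq_divergence u
      -- The test function `q = div u - g` is available because `div u` is represented in `L²` with
      -- zero mean; it gives `‖div u - g‖² = 0`.
      have h3 := h2 (d - g)
      have h4 : l2Distr (d - g) = l2Distr d - l2Distr g := ofFun_sub_Lp _ _
      have hm : ∀ p : L2Dot n, MemSobolev (-0) (l2Distr p) := fun p => by
        rw [neg_zero]
        exact memSobolev_l2Distr p
      have h5 : dualPair (l2Distr (d - g)) (l2Distr (d - g)) = 0 := by
        have h6 := dualPair_sub_left (hm d) (hm g) (memSobolev_l2Distr (d - g))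
        rw [← h4] at h6
        rw [h6]
        unfold formB at h3
        rw [← hd] at h3
        linarith
      have h6 := (dualPair_self_nonneg_and_eq_zero (s := 0) (c := fun _ => 1) (fun _ => one_pos)
        (hm (d - g)) (memSobolev_l2Distr _) (by simp)).2 h5
      rw [h4] at h6
      rw [← hd]
      exact sub_eq_zero.1 h6

/-! ### Coercivity on solenoidal fields -/

theorem fourierCoef_strain (u : Fin n → Distr n) (j β : Fin n) (ξ : Fin n → ℤ) :
    fourierCoef (strain u j β) ξ =
      Real.pi * Complex.I * (ξ j * fourierCoef (u β) ξ + ξ β * fourierCoef (u j) ξ) := by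
  unfold strain
  rw [fourierCoef_smul, fourierCoef_add, fourierCoef_pderiv, fourierCoef_pderiv]
  push_cast
  ring

theorem fourierCoef_stress (A : Tensor n) (u : Fin n → Distr n) (k α : Fin n) (ξ : Fin n → ℤ) :
    fourierCoef (stress A u k α) ξ = ∑ j, ∑ β, (A k j α β : ℂ) * fourierCoef (strain u j β) ξ := by
  unfold stress
  simp only [fourierCoef_sum, fourierCoef_smul]

/-- The ellipticity condition for complex matrices. -/
theorem Tensor.IsElliptic.complex {A : Tensor n} {CA : ℝ} (hA : A.IsElliptic CA)
    {ζ : Fin n → Fin n → ℂ} (hs : ∀ k α, ζ k α = ζ α k) (ht : ∑ k, ζ k k = 0) :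
    ∑ k, ∑ α, ‖ζ k α‖ ^ 2 ≤
      CA * ∑ k, ∑ α, ((∑ j, ∑ β, (A k j α β : ℂ) * ζ j β) * conj (ζ k α)).re := by
  -- The tensor is real, so the real part of the Hermitian form is the sum of the quadratic forms of
  -- `Re ζ` and `Im ζ`, and both matrices are symmetric and trace-free.
  have h1 := hA (Matrix.of fun k α => (ζ k α).re) (by ext k α; simp [hs k α])
    (by simpa [Matrix.trace] using congrArg Complex.re ht)
  have h2 := hA (Matrix.of fun k α => (ζ k α).im) (by ext k α; simp [hs k α])
    (by simpa [Matrix.trace] using congrArg Complex.im ht)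
  simp only [Matrix.of_apply] at h1 h2
  calc ∑ k, ∑ α, ‖ζ k α‖ ^ 2
      = ∑ k, ∑ α, (ζ k α).re ^ 2 + ∑ k, ∑ α, (ζ k α).im ^ 2 := by
        simp only [← Finset.sum_add_distrib]
        refine Finset.sum_congr rfl fun k _ => Finset.sum_congr rfl fun α _ => ?_
        rw [← Complex.normSq_eq_norm_sq, Complex.normSq_apply]
        ring
    _ ≤ _ := add_le_add h1 h2
    _ = _ := by
        rw [← mul_add, ← Finset.sum_add_distrib]
        congr 1
        refine Finset.sum_congr rfl fun k _ => ?_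
        simp only [← Finset.sum_add_distrib, Finset.sum_mul, Complex.re_sum]
        rw [Finset.sum_comm]
        refine Finset.sum_congr rfl fun α _ => Finset.sum_congr rfl fun j _ =>
          Finset.sum_congr rfl fun β _ => ?_
        simp
        ring

/-- Korn's identity at a frequency. -/
theorem sum_norm_sq_symm {c : Fin n → ℂ} {ξ : Fin n → ℤ} (h : ∑ k, (ξ k : ℂ) * c k = 0) :
    ∑ k, ∑ α, ‖(ξ k : ℂ) * c α + ξ α * c k‖ ^ 2 =
      2 * ((∑ k, (ξ k : ℝ) ^ 2) * ∑ k, ‖c k‖ ^ 2) := by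
  have h1 : ∀ k α, ‖(ξ k : ℂ) * c α + ξ α * c k‖ ^ 2 = (ξ k : ℝ) ^ 2 * ‖c α‖ ^ 2 +
      (ξ α : ℝ) ^ 2 * ‖c k‖ ^ 2 + 2 * (((ξ α : ℂ) * c α) * conj ((ξ k : ℂ) * c k)).re := by
    intro k α
    rw [← Complex.normSq_eq_norm_sq, Complex.normSq_add]
    simp only [Complex.normSq_intCast, ← Complex.normSq_eq_norm_sq, map_mul,
      map_intCast]
    rw [show (ξ k : ℂ) * c α * ((ξ α : ℂ) * conj (c k)) =
      (ξ α : ℂ) * c α * ((ξ k : ℂ) * conj (c k)) by ring]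
    ring
  simp_rw [h1, Finset.sum_add_distrib, ← Finset.mul_sum, ← Complex.re_sum]
  -- The cross terms contain `ξ · c`, which is zero by solenoidality.
  have h2 : ∀ k, ∑ α, ((ξ α : ℂ) * c α) * conj ((ξ k : ℂ) * c k) = 0 := fun k => by
    rw [← Finset.sum_mul, h, zero_mul]
  simp_rw [h2, ← Finset.sum_mul]
  simp only [Complex.zero_re, Finset.sum_const_zero, mul_zero, add_zero, ← Finset.mul_sum]
  ring

theorem one_le_sum_sq {ξ : Fin n → ℤ} (hξ : ξ ≠ 0) : (1 : ℝ) ≤ ∑ k, (ξ k : ℝ) ^ 2 := by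
  obtain ⟨k, hk⟩ := Function.ne_iff.1 hξ
  have h1 : (1 : ℝ) ≤ (ξ k : ℝ) ^ 2 := by
    have hk' : ξ k ≠ 0 := hk
    have : 0 < ξ k ^ 2 := by positivity
    exact_mod_cast this
  exact h1.trans (Finset.single_le_sum (f := fun k => (ξ k : ℝ) ^ 2) (fun _ _ => sq_nonneg _)
    (Finset.mem_univ k))

/-- The advection term drops out by skew-symmetry. The two series are then compared termwise: the
strain coefficient is trace-free as `div u = 0`, so ellipticity and Korn's identity give
`2π²|ξ|²|û|²` as a lower bound for `C_A` times the energy density. This dominates `π²(1 + |ξ|²)|û|²`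
when `ξ ≠ 0`, and the zero frequency is absent. -/
theorem pi_sq_mul_fieldNorm_sq_le {A : Tensor n} {CA : ℝ} (hA : A.IsElliptic CA)
    {U : Fin n → Torus n → ℝ} {C : ℝ} (hU : IsAdvectingField U C) {u : Fin n → HDot n 1}
    (hu : divergence (comps u) = 0) :
    Real.pi ^ 2 * fieldNorm 1 (comps u) ^ 2 ≤ CA * formA A U u u := by
  have hm := memSobolev_comps u
  have hadv : ∑ k, dualPair (advection U (comps u) k) (comps u k) = 0 :=
    Finset.sum_eq_zero fun k _ =>
      dualPair_advectScalar_self hU.memLp hU.div_eq_zero hU.nonneg hU.bound (hm k)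
  unfold formA
  rw [hadv, add_zero]
  have h1 : HasSum (fun ξ => ∑ i, ∑ α, (fourierCoef (stress A (comps u) i α) ξ *
      conj (fourierCoef (strain (comps u) i α) ξ)).re)
      (∑ i, ∑ α, dualPair (stress A (comps u) i α) (strain (comps u) i α)) := by
    refine hasSum_sum fun i _ => hasSum_sum fun α _ => hasSum_dualPair (s := 0) ?_ ?_
    · rw [neg_zero]
      exact memSobolev_stress A hm i α
    · exact MemSobolev.strain hm i α
  refine hasSum_le (fun ξ => ?_) ((hasSum_fieldNorm_sq hm).mul_left (Real.pi ^ 2))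
    (h1.mul_left CA)
  have hdiv := sum_mul_fourierCoef_of_divergence_eq_zero hu ξ
  have h2 := hA.complex (ζ := fun k α => fourierCoef (strain (comps u) k α) ξ)
    (fun k α => by rw [fourierCoef_strain, fourierCoef_strain, add_comm]) (by
      simp only [fourierCoef_strain, ← two_mul, ← Finset.mul_sum]
      rw [hdiv]
      simp)
  simp only [fourierCoef_stress]
  refine le_trans ?_ h2
  simp only [fourierCoef_strain, norm_mul, mul_pow, Complex.norm_real, Complex.norm_I,
    Real.norm_eq_abs, sq_abs, mul_one, ← Finset.mul_sum]
  rw [sum_norm_sq_symm hdiv]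
  refine mul_le_mul_of_nonneg_left ?_ (sq_nonneg _)
  by_cases hξ : ξ = 0
  · subst hξ
    simp [fourierCoef_comps_zero]
  · rw [Real.rpow_ofNat, rho_sq, ← mul_assoc]
    have := one_le_sum_sq hξ
    refine mul_le_mul_of_nonneg_right (by linarith) (Finset.sum_nonneg fun _ _ => sq_nonneg _)

/-! ### The Hilbert space of solenoidal coefficient sequences -/

/-- Square summable sequences of complex vectors. -/
abbrev CoefSpace (n : ℕ) : Type := PiLp 2 fun _ : Fin n => lp (fun _ : Fin n → ℤ => ℂ) 2

/-- The evaluation of a component at a frequency. -/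
def coefEval (k : Fin n) (ξ : Fin n → ℤ) : CoefSpace n →L[ℝ] ℂ :=
  (lp.evalCLM ℝ (fun _ : Fin n → ℤ => ℂ) 2 ξ).comp
    (PiLp.proj 2 (fun _ : Fin n => lp (fun _ : Fin n → ℤ => ℂ) 2) k)

theorem coefEval_apply (k : Fin n) (ξ : Fin n → ℤ) (a : CoefSpace n) :
    coefEval k ξ a = a k ξ := rfl

/-- The sequences of weighted Fourier coefficients of real solenoidal fields of zero mean. -/
def solenoidal (n : ℕ) : Submodule ℝ (CoefSpace n) where
  carrier := {a | (∀ k ξ, coefEval k (-ξ) a = conj (coefEval k ξ a)) ∧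
    (∀ k, coefEval k 0 a = 0) ∧ ∀ ξ : Fin n → ℤ, ∑ k, (ξ k : ℂ) * coefEval k ξ a = 0}
  add_mem' := fun {a b} ha hb => by
    refine ⟨fun k ξ => ?_, fun k => ?_, fun ξ => ?_⟩
    · rw [map_add, map_add, ha.1, hb.1, map_add]
    · rw [map_add, ha.2.1, hb.2.1, add_zero]
    · simp only [map_add, mul_add, Finset.sum_add_distrib, ha.2.2, hb.2.2, add_zero]
  zero_mem' := by simp
  smul_mem' := fun c a ha => by
    refine ⟨fun k ξ => ?_, fun k => ?_, fun ξ => ?_⟩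
    · rw [map_smul, map_smul, ha.1]
      simp
    · rw [map_smul, ha.2.1, smul_zero]
    · simp only [map_smul, mul_smul_comm, ← Finset.smul_sum, ha.2.2, smul_zero]

/-- The defining conditions involve only continuous coordinate evaluations. Closedness gives
completeness, which the Lax–Milgram theorem requires; sequences are used because their Hilbert space
structure is at hand, unlike that of the spaces of distributions. -/
theorem isClosed_solenoidal (n : ℕ) : IsClosed (solenoidal n : Set (CoefSpace n)) := by
  have h : (solenoidal n : Set (CoefSpace n)) =
      {a | ∀ k ξ, coefEval k (-ξ) a = conj (coefEval k ξ a)} ∩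
        ({a | ∀ k, coefEval k 0 a = 0} ∩
          {a | ∀ ξ : Fin n → ℤ, ∑ k, (ξ k : ℂ) * coefEval k ξ a = 0}) := rfl
  rw [h]
  refine IsClosed.inter ?_ (IsClosed.inter ?_ ?_)
  · simp only [Set.ofPred_forall]
    exact isClosed_iInter fun k => isClosed_iInter fun ξ => isClosed_eq
      (coefEval k (-ξ)).continuous (Complex.continuous_conj.comp (coefEval k ξ).continuous)
  · simp only [Set.ofPred_forall]
    exact isClosed_iInter fun k => isClosed_eq (coefEval k 0).continuous continuous_const
  · simp only [Set.ofPred_forall]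
    exact isClosed_iInter fun ξ => isClosed_eq
      (continuous_finsetSum _ fun k _ => continuous_const.mul (coefEval k ξ).continuous)
      continuous_const

instance (n : ℕ) : CompleteSpace (solenoidal n) := (isClosed_solenoidal n).completeSpace_coe

theorem norm_sq_coefSpace (a : CoefSpace n) : ‖a‖ ^ 2 = ∑ k, ∑' ξ, ‖a k ξ‖ ^ 2 := by
  rw [PiLp.norm_sq_eq_of_L2]
  refine Finset.sum_congr rfl fun k _ => ?_
  have h := lp.norm_rpow_eq_tsum (p := 2) (by norm_num) (a k)
  simpa using h

theorem summable_coefSpace (a : CoefSpace n) (k : Fin n) : Summable fun ξ => ‖a k ξ‖ ^ 2 := by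
  have h := (lp.memℓp (a k)).summable (by norm_num)
  simpa using h

theorem exists_field_of_solenoidal (a : solenoidal n) : ∃ u : Fin n → HDot n 1, ∀ k ξ,
    fourierCoef (comps u k) ξ = ((rho ξ)⁻¹ : ℝ) * a.1 k ξ := by
  have h : ∀ k, ∃ u : HDot n 1, ∀ ξ, fourierCoef (u : Distr n) ξ = ((rho ξ)⁻¹ : ℝ) * a.1 k ξ := by
    intro k
    refine exists_HDot_one (fun ξ => ?_) ?_ ?_
    · have := a.2.1 k ξ
      simp only [coefEval_apply] at this
      rw [this, rho_neg, map_mul, Complex.conj_ofReal]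
    · have := a.2.2.1 k
      simp only [coefEval_apply] at this
      rw [this, mul_zero]
    · refine (summable_coefSpace a.1 k).congr fun ξ => ?_
      rw [norm_mul, mul_pow, Complex.norm_real, Real.norm_eq_abs, sq_abs]
      have := (rho_pos ξ).ne'
      field_simp
  choose u hu using h
  exact ⟨u, hu⟩

theorem HDot_ext {s : ℝ} {u v : Fin n → HDot n s}
    (h : ∀ k ξ, fourierCoef (comps u k) ξ = fourierCoef (comps v k) ξ) : u = v :=
  funext fun k => Subtype.ext (distr_ext_fourierCoef (h k))

/-- The solenoidal vector field with given weighted Fourier coefficients. -/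
def toField (n : ℕ) : solenoidal n →ₗ[ℝ] (Fin n → HDot n 1) where
  toFun a := (exists_field_of_solenoidal a).choose
  map_add' a b := HDot_ext fun k ξ => by
    rw [(exists_field_of_solenoidal (a + b)).choose_spec]
    change _ = fourierCoef (comps (exists_field_of_solenoidal a).choose k +
      comps (exists_field_of_solenoidal b).choose k) ξ
    rw [fourierCoef_add, (exists_field_of_solenoidal a).choose_spec,
      (exists_field_of_solenoidal b).choose_spec, ← mul_add]
    rfl
  map_smul' c a := HDot_ext fun k ξ => by
    rw [(exists_field_of_solenoidal (c • a)).choose_spec]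
    change _ = fourierCoef (c • comps (exists_field_of_solenoidal a).choose k) ξ
    rw [fourierCoef_smul, (exists_field_of_solenoidal a).choose_spec, mul_left_comm]
    rfl

theorem fourierCoef_toField (a : solenoidal n) (k : Fin n) (ξ : Fin n → ℤ) :
    fourierCoef (comps (toField n a) k) ξ = ((rho ξ)⁻¹ : ℝ) * a.1 k ξ :=
  (exists_field_of_solenoidal a).choose_spec k ξ

theorem divergence_eq_zero_iff {u : Fin n → Distr n} :
    divergence u = 0 ↔ ∀ ξ : Fin n → ℤ, ∑ k, (ξ k : ℂ) * fourierCoef (u k) ξ = 0 := by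
  refine ⟨sum_mul_fourierCoef_of_divergence_eq_zero, fun h => distr_ext_fourierCoef fun ξ => ?_⟩
  simp only [divergence, fourierCoef_sum, fourierCoef_pderiv, fourierCoef_zero_distr, mul_assoc,
    ← Finset.mul_sum]
  rw [h]
  simp

theorem divergence_toField (a : solenoidal n) : divergence (comps (toField n a)) = 0 := by
  rw [divergence_eq_zero_iff]
  intro ξ
  have h := a.2.2.2 ξ
  simp only [coefEval_apply] at h
  simp only [fourierCoef_toField, mul_left_comm _ (((rho ξ)⁻¹ : ℝ) : ℂ), ← Finset.mul_sum]
  rw [h, mul_zero]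

theorem fieldNorm_toField (a : solenoidal n) : fieldNorm 1 (comps (toField n a)) = ‖a‖ := by
  refine (pow_left_inj₀ (fieldNorm_nonneg _ _) (norm_nonneg _) two_ne_zero).1 ?_
  rw [fieldNorm_sq, show ‖a‖ = ‖a.1‖ from rfl, norm_sq_coefSpace]
  refine Finset.sum_congr rfl fun k _ => ?_
  rw [sobolevNorm_one_sq]
  refine tsum_congr fun ξ => ?_
  rw [fourierCoef_toField, norm_mul, mul_pow, Complex.norm_real, Real.norm_eq_abs, sq_abs]
  have := (rho_pos ξ).ne'
  field_simp

/-- The sequence is `ρ û`. Together with `fieldNorm_toField` this makes `toField` an isometric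
parametrisation of all solenoidal fields in `Ḣ¹`, so testing against sequences is testing against
every such field. -/
theorem exists_toField_eq {u : Fin n → HDot n 1} (hu : divergence (comps u) = 0) :
    ∃ a, toField n a = u := by
  let c : Fin n → (Fin n → ℤ) → ℂ := fun k ξ => (rho ξ : ℂ) * fourierCoef (comps u k) ξ
  have hc : ∀ k, Memℓp (c k) 2 := fun k => memℓp_gen (by
    refine (memSobolev_one_iff.1 (memSobolev_comps u k)).congr fun ξ => ?_
    simp [c, mul_pow])
  refine ⟨⟨WithLp.toLp 2 fun k => ⟨c k, hc k⟩, fun k ξ => ?_, fun k => ?_, fun ξ => ?_⟩,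
    HDot_ext fun k ξ => ?_⟩
  · change c k (-ξ) = conj (c k ξ)
    simp [c, rho_neg, fourierCoef_neg]
  · change c k 0 = 0
    simp [c, fourierCoef_comps_zero]
  · change ∑ k, (ξ k : ℂ) * ((rho ξ : ℂ) * fourierCoef (comps u k) ξ) = 0
    simp only [mul_left_comm _ (rho ξ : ℂ), ← Finset.mul_sum]
    rw [divergence_eq_zero_iff.1 hu, mul_zero]
  · rw [fourierCoef_toField]
    change (((rho ξ)⁻¹ : ℝ) : ℂ) * ((rho ξ : ℂ) * fourierCoef (comps u k) ξ) = _
    rw [← mul_assoc, ← Complex.ofReal_mul, inv_mul_cancel₀ (rho_pos ξ).ne', Complex.ofReal_one,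
      one_mul]

/-! ### Existence of solenoidal solutions -/

theorem comps_add {s : ℝ} (u v : Fin n → HDot n s) :
    comps (u + v) = fun k => comps u k + comps v k := rfl

theorem comps_smul {s : ℝ} (c : ℝ) (u : Fin n → HDot n s) :
    comps (c • u) = fun k => c • comps u k := rfl

/-- The bilinear form of the Oseen operator on solenoidal fields. -/
def solenoidalForm (A : Tensor n) {U : Fin n → Torus n → ℝ} {C : ℝ} (hU : IsAdvectingField U C) :
    solenoidal n →ₗ[ℝ] solenoidal n →ₗ[ℝ] ℝ :=
  LinearMap.mk₂ ℝ
    (fun a b => ∑ k, dualPair (oseenOp A U (comps (toField n a)) k) (comps (toField n b) k))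
    (fun a a' b => by
      rw [← Finset.sum_add_distrib]
      refine Finset.sum_congr rfl fun k _ => ?_
      rw [map_add, comps_add, oseenOp_add A hU (memSobolev_comps _) (memSobolev_comps _),
        dualPair_add_left (memSobolev_oseenOp A hU (memSobolev_comps _) k)
          (memSobolev_oseenOp A hU (memSobolev_comps _) k) (memSobolev_comps _ k)])
    (fun c a b => by
      rw [smul_eq_mul, Finset.mul_sum]
      refine Finset.sum_congr rfl fun k _ => ?_
      rw [map_smul, comps_smul, oseenOp_smul A hU c (memSobolev_comps _), dualPair_smul_left])
    (fun a b b' => by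
      rw [← Finset.sum_add_distrib]
      refine Finset.sum_congr rfl fun k _ => ?_
      rw [map_add, comps_add, dualPair_add_right (memSobolev_oseenOp A hU (memSobolev_comps _) k)
        (memSobolev_comps _ k) (memSobolev_comps _ k)])
    (fun c a b => by
      rw [smul_eq_mul, Finset.mul_sum]
      refine Finset.sum_congr rfl fun k _ => ?_
      rw [map_smul, comps_smul, dualPair_smul_right])

/-- A functional on solenoidal fields. -/
def solenoidalFunctional {F : Fin n → Distr n} (hF : ∀ k, MemSobolev (-1) (F k)) :
    solenoidal n →ₗ[ℝ] ℝ where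
  toFun b := ∑ k, dualPair (F k) (comps (toField n b) k)
  map_add' b b' := by
    rw [← Finset.sum_add_distrib]
    refine Finset.sum_congr rfl fun k _ => ?_
    rw [map_add, comps_add, dualPair_add_right (hF k) (memSobolev_comps _ k)
      (memSobolev_comps _ k)]
  map_smul' c b := by
    rw [RingHom.id_apply, smul_eq_mul, Finset.mul_sum]
    refine Finset.sum_congr rfl fun k _ => ?_
    rw [map_smul, comps_smul, dualPair_smul_right]

/-- Lax–Milgram on the space of solenoidal sequences: the form is bounded by `oseenBound` and
coercive with constant `π² / C_A`. -/
theorem exists_solenoidal_solution {A : Tensor n} {CA a : ℝ} (hs : A.IsSymm)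
    (hA : A.IsElliptic CA) (hCA : 0 < CA) (ha : 0 ≤ a) (hAa : ∀ k j α β, |A k j α β| ≤ a)
    {U : Fin n → Torus n → ℝ} {C : ℝ} (hU : IsAdvectingField U C)
    {F : Fin n → Distr n} (hF : ∀ k, MemSobolev (-1) (F k)) :
    ∃ u : Fin n → HDot n 1, divergence (comps u) = 0 ∧ ∀ v : Fin n → HDot n 1,
      divergence (comps v) = 0 → ∑ k, dualPair (oseenOp A U (comps u) k) (comps v k) =
        ∑ k, dualPair (F k) (comps v k) := by
  have hb : ∀ a' b, ‖solenoidalForm A hU a' b‖ ≤ oseenBound n a C * ‖a'‖ * ‖b‖ := by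
    intro a' b
    rw [← fieldNorm_toField a', ← fieldNorm_toField b, Real.norm_eq_abs]
    refine (abs_sum_dualPair_le (memSobolev_oseenOp A hU (memSobolev_comps _))
      (memSobolev_comps _)).trans ?_
    exact mul_le_mul_of_nonneg_right (fieldNorm_oseenOp_le ha hAa hU (memSobolev_comps _))
      (fieldNorm_nonneg _ _)
  let B : solenoidal n →L[ℝ] solenoidal n →L[ℝ] ℝ :=
    (solenoidalForm A hU).mkContinuous₂ (oseenBound n a C) hb
  have hB : IsCoercive B := by
    refine ⟨Real.pi ^ 2 / CA, by positivity, fun b => ?_⟩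
    have h := pi_sq_mul_fieldNorm_sq_le hA hU (divergence_toField b)
    rw [formA_eq hs hU, fieldNorm_toField] at h
    change _ ≤ ∑ k, dualPair (oseenOp A U (comps (toField n b)) k) (comps (toField n b) k)
    rw [div_mul_eq_mul_div, div_mul_eq_mul_div, div_le_iff₀ hCA]
    linarith
  let L : solenoidal n →L[ℝ] ℝ :=
    (solenoidalFunctional hF).mkContinuous (fieldNorm (-1) F) fun b => by
      rw [← fieldNorm_toField b, Real.norm_eq_abs]
      exact abs_sum_dualPair_le hF (memSobolev_comps _)
  -- Represent `L` by the Riesz theorem and invert the operator attached to the coercive form.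
  let b := hB.continuousLinearEquivOfBilin.symm ((InnerProductSpace.toDual ℝ (solenoidal n)).symm L)
  refine ⟨toField n b, divergence_toField b, fun v hv => ?_⟩
  obtain ⟨c, rfl⟩ := exists_toField_eq hv
  have h1 := hB.continuousLinearEquivOfBilin_apply b c
  rw [ContinuousLinearEquiv.apply_symm_apply, InnerProductSpace.toDual_symm_apply] at h1
  exact h1.symm

/-! ### Right inverse of the divergence and the pressure -/

/-- `|ξ|²`. -/
def freqSq (ξ : Fin n → ℤ) : ℝ := ∑ k, (ξ k : ℝ) ^ 2

theorem freqSq_neg (ξ : Fin n → ℤ) : freqSq (-ξ) = freqSq ξ := by simp [freqSq]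

/-- Since `|ξ| ≥ 1`, one has `1 + |ξ|² ≤ 2|ξ|² ≤ 4π²|ξ|²`. This is why the right inverse of the
divergence and the pressure bound both come with constant one. -/
theorem rho_sq_le_four_pi_sq {ξ : Fin n → ℤ} (hξ : ξ ≠ 0) :
    rho ξ ^ 2 ≤ (2 * Real.pi) ^ 2 * freqSq ξ := by
  have h1 := one_le_sum_sq hξ
  rw [rho_sq]
  change 1 + freqSq ξ ≤ _
  have h2 : 1 ≤ freqSq ξ := h1
  have h3 : 2 ≤ (2 * Real.pi) ^ 2 := by nlinarith [Real.pi_gt_three]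
  nlinarith

theorem norm_sq_sum_mul_le (ξ : Fin n → ℤ) (c : Fin n → ℂ) :
    ‖∑ k, (ξ k : ℂ) * c k‖ ^ 2 ≤ freqSq ξ * ∑ k, ‖c k‖ ^ 2 := by
  have h1 : ‖∑ k, (ξ k : ℂ) * c k‖ ≤ ∑ k, |(ξ k : ℝ)| * ‖c k‖ :=
    (norm_sum_le _ _).trans (by simp)
  refine (pow_le_pow_left₀ (norm_nonneg _) h1 2).trans ?_
  refine (Finset.sum_mul_sq_le_sq_mul_sq _ _ _).trans (le_of_eq ?_)
  simp [freqSq]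

/-- Take `w = ∇Δ⁻¹g`, with coefficients `-i ξ_k ĝ(ξ) / (2π|ξ|²)`. At `ξ = 0` the formula gives zero,
in agreement with the zero mean of `g`. -/
theorem exists_divergence_eq (g : L2Dot n) : ∃ w : Fin n → HDot n 1,
    divergence (comps w) = l2Distr g ∧ fieldNorm 1 (comps w) ≤ ‖g‖ := by
  let c : Fin n → (Fin n → ℤ) → ℂ := fun k ξ =>
    (((2 * Real.pi)⁻¹ * (freqSq ξ)⁻¹ * ξ k : ℝ) : ℂ) * (-Complex.I * fourierCoef (l2Distr g) ξ)
  have hnorm : ∀ k ξ, ‖c k ξ‖ ^ 2 = ((2 * Real.pi) ^ 2)⁻¹ * ((freqSq ξ)⁻¹ ^ 2 *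
      ‖fourierCoef (l2Distr g) ξ‖ ^ 2) * (ξ k : ℝ) ^ 2 := fun k ξ => by
    simp only [c]
    rw [norm_mul, norm_mul, norm_neg, Complex.norm_I, one_mul, mul_pow, Complex.norm_real,
      Real.norm_eq_abs, sq_abs]
    ring
  have hle : ∀ ξ, rho ξ ^ 2 * ∑ k, ‖c k ξ‖ ^ 2 ≤ ‖fourierCoef (l2Distr g) ξ‖ ^ 2 := by
    intro ξ
    simp_rw [hnorm, ← Finset.mul_sum]
    by_cases hξ : ξ = 0
    · subst hξ
      simp [fourierCoef_l2Distr_zero]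
    · have h1 := rho_sq_le_four_pi_sq hξ
      have h2 : 1 ≤ freqSq ξ := one_le_sum_sq hξ
      change rho ξ ^ 2 * (_ * freqSq ξ) ≤ _
      have h3 : 0 < freqSq ξ := by linarith
      have h4 := Real.pi_pos
      calc _ ≤ (2 * Real.pi) ^ 2 * freqSq ξ * (((2 * Real.pi) ^ 2)⁻¹ * ((freqSq ξ)⁻¹ ^ 2 *
            ‖fourierCoef (l2Distr g) ξ‖ ^ 2) * freqSq ξ) := by gcongr
        _ = _ := by field_simp
  have hw : ∀ k, ∃ w : HDot n 1, ∀ ξ, fourierCoef (w : Distr n) ξ = c k ξ := fun k => by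
    refine exists_HDot_one (fun ξ => ?_) ?_ ?_
    · simp only [c, freqSq_neg, fourierCoef_neg, Pi.neg_apply, Int.cast_neg, mul_neg,
        Complex.ofReal_neg, map_mul, Complex.conj_ofReal, map_neg, Complex.conj_I]
      ring
    · simp [c]
    · refine Summable.of_nonneg_of_le (fun ξ => by positivity) (fun ξ => ?_)
        (hasSum_l2Distr g).summable
      refine le_trans (mul_le_mul_of_nonneg_left ?_ (sq_nonneg _)) (hle ξ)
      exact Finset.single_le_sum (f := fun k => ‖c k ξ‖ ^ 2) (fun _ _ => sq_nonneg _)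
        (Finset.mem_univ k)
  choose w hw using hw
  have hw' : ∀ k ξ, fourierCoef (comps w k) ξ = c k ξ := hw
  refine ⟨w, distr_ext_fourierCoef fun ξ => ?_, ?_⟩
  · simp only [divergence, fourierCoef_sum, fourierCoef_pderiv, hw']
    by_cases hξ : ξ = 0
    · subst hξ
      simp [fourierCoef_l2Distr_zero]
    · have h2 : 1 ≤ freqSq ξ := one_le_sum_sq hξ
      have h3 : (freqSq ξ : ℂ) ≠ 0 := by
        have : freqSq ξ ≠ 0 := by linarith
        exact_mod_cast this
      have h4 : (Real.pi : ℂ) ≠ 0 := by exact_mod_cast Real.pi_ne_zero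
      have h5 : ∀ k, 2 * Real.pi * Complex.I * ξ k * c k ξ =
          (freqSq ξ : ℂ)⁻¹ * fourierCoef (l2Distr g) ξ * (ξ k : ℂ) ^ 2 := fun k => by
        simp only [c]
        push_cast
        field_simp
        linear_combination (-(ξ k : ℂ) ^ 2 * fourierCoef (l2Distr g) ξ) * Complex.I_sq
      simp_rw [h5, ← Finset.mul_sum]
      have h6 : ∑ k, (ξ k : ℂ) ^ 2 = (freqSq ξ : ℂ) := by simp [freqSq]
      rw [h6]
      field_simp
  · refine le_of_sq_le_sq ?_ (norm_nonneg _)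
    refine hasSum_le (fun ξ => ?_) (hasSum_fieldNorm_sq (memSobolev_comps w)) (hasSum_l2Distr g)
    simp only [hw', mul_one, Real.rpow_ofNat]
    exact hle ξ

/-- The gradient has squared size `4π²|ξ|²|p̂|²` at frequency `ξ`, and dividing by `1 + |ξ|²` leaves
at least `|p̂|²`; the zero frequency is excluded by the zero mean. This plays the role of the
inf-sup condition. -/
theorem norm_le_fieldNorm_pderiv (p : L2Dot n) :
    ‖p‖ ≤ fieldNorm (-1) fun k => Distr.pderiv k (l2Distr p) := by
  refine le_of_sq_le_sq ?_ (fieldNorm_nonneg _ _)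
  refine hasSum_le (fun ξ => ?_) (hasSum_l2Distr p)
    (hasSum_fieldNorm_sq (memSobolev_pderiv_l2Distr p))
  rw [rho_rpow_neg_one]
  by_cases hξ : ξ = 0
  · subst hξ
    simp [fourierCoef_l2Distr_zero, fourierCoef_pderiv_zero]
  · have h1 := rho_sq_le_four_pi_sq hξ
    have h2 : 0 < rho ξ ^ 2 := by have := rho_pos ξ; positivity
    simp_rw [fourierCoef_pderiv, norm_two_pi_I_mul, ← Finset.mul_sum, ← Finset.sum_mul]
    change _ ≤ (rho ξ ^ 2)⁻¹ * ((2 * Real.pi) ^ 2 * (freqSq ξ * _))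
    rw [inv_mul_eq_div, le_div_iff₀ h2, ← mul_assoc, mul_comm]
    exact mul_le_mul_of_nonneg_right h1 (sq_nonneg _)

theorem sum_dualPair_pderiv_of_divergence_eq_zero {v : Fin n → HDot n 1}
    (hv : divergence (comps v) = 0) (p : L2Dot n) :
    ∑ k, dualPair (Distr.pderiv k (l2Distr p)) (comps v k) = 0 := by
  rw [← formB_eq, formB, hv, dualPair_zero_left, neg_zero]

/-- A functional that vanishes on solenoidal fields is a pressure gradient. -/
theorem exists_pressure {R : Fin n → Distr n} (hR : ∀ k, MemSobolev (-1) (R k))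
    (h0 : ∀ k, fourierCoef (R k) 0 = 0)
    (h : ∀ v : Fin n → HDot n 1, divergence (comps v) = 0 → ∑ k, dualPair (R k) (comps v k) = 0) :
    ∃ p : L2Dot n, ∀ k, Distr.pderiv k (l2Distr p) = R k := by
  -- The candidate is `p = Δ⁻¹ div R`, obtained by taking the divergence of `∇p = R`.
  let c : (Fin n → ℤ) → ℂ := fun ξ =>
    (((2 * Real.pi)⁻¹ * (freqSq ξ)⁻¹ : ℝ) : ℂ) * (-Complex.I * ∑ k, (ξ k : ℂ) * fourierCoef (R k) ξ)
  have hle : ∀ ξ, ‖c ξ‖ ^ 2 ≤ rho ξ ^ (2 * (-1) : ℝ) * ∑ k, ‖fourierCoef (R k) ξ‖ ^ 2 := by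
    intro ξ
    simp only [c]
    rw [rho_rpow_neg_one]
    by_cases hξ : ξ = 0
    · subst hξ
      simp [h0]
    · have h1 := rho_sq_le_four_pi_sq hξ
      have h2 : 1 ≤ freqSq ξ := one_le_sum_sq hξ
      have h3 : 0 < freqSq ξ := by linarith
      have h4 := Real.pi_pos
      have h5 := norm_sq_sum_mul_le ξ fun k => fourierCoef (R k) ξ
      have h6 := rho_pos ξ
      rw [norm_mul, norm_mul, norm_neg, Complex.norm_I, one_mul, mul_pow, Complex.norm_real,
        Real.norm_eq_abs, sq_abs]
      calc _ ≤ ((2 * Real.pi)⁻¹ * (freqSq ξ)⁻¹) ^ 2 *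
            (freqSq ξ * ∑ k, ‖fourierCoef (R k) ξ‖ ^ 2) := by gcongr
        _ = ((2 * Real.pi) ^ 2 * freqSq ξ)⁻¹ * ∑ k, ‖fourierCoef (R k) ξ‖ ^ 2 := by field_simp
        _ ≤ _ := by gcongr
  obtain ⟨p, hp⟩ := exists_L2Dot (c := c) (fun ξ => by
      simp only [c, freqSq_neg, fourierCoef_neg, Pi.neg_apply, Int.cast_neg, neg_mul, mul_neg,
        map_mul, Complex.conj_ofReal, map_neg, Complex.conj_I, map_sum, map_intCast,
        Finset.sum_neg_distrib])
    (by simp [c]) (Summable.of_nonneg_of_le (fun ξ => sq_nonneg _) hle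
      (hasSum_fieldNorm_sq hR).summable)
  refine ⟨p, fun k => ?_⟩
  have hG : ∀ k, MemSobolev (-1) (R k - Distr.pderiv k (l2Distr p)) := fun k =>
    (hR k).sub (memSobolev_pderiv_l2Distr p k)
  choose v hv using fun k => exists_riesz (hG k) (by
    rw [fourierCoef_sub, h0, fourierCoef_pderiv_zero, sub_zero])
  -- The choice of `p` makes `R - ∇p` solenoidal, and its Riesz representative `v` differs from it
  -- by a scalar factor at each frequency. So `v` is an admissible test field, annihilated by both
  -- `R` and `∇p`, and this forces `R - ∇p = 0`.
  have hdiv : divergence (comps v) = 0 := by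
    rw [divergence_eq_zero_iff]
    intro ξ
    have hv' : ∀ k, fourierCoef (comps v k) ξ = _ := fun k => hv k ξ
    simp only [hv', mul_left_comm _ (((rho ξ ^ 2)⁻¹ : ℝ) : ℂ), ← Finset.mul_sum]
    by_cases hξ : ξ = 0
    · subst hξ
      simp
    · have h2 : 1 ≤ freqSq ξ := one_le_sum_sq hξ
      have h3 : (freqSq ξ : ℂ) ≠ 0 := by
        have : freqSq ξ ≠ 0 := by linarith
        exact_mod_cast this
      have h4 : (Real.pi : ℂ) ≠ 0 := by exact_mod_cast Real.pi_ne_zero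
      have h5 : ∀ k, (ξ k : ℂ) * fourierCoef (R k - Distr.pderiv k (l2Distr p)) ξ =
          (ξ k : ℂ) * fourierCoef (R k) ξ - 2 * Real.pi * Complex.I * c ξ * (ξ k : ℂ) ^ 2 :=
        fun k => by
          rw [fourierCoef_sub, fourierCoef_pderiv, hp]
          ring
      have h6 : ∑ k, (ξ k : ℂ) ^ 2 = (freqSq ξ : ℂ) := by simp [freqSq]
      simp_rw [h5, Finset.sum_sub_distrib, ← Finset.mul_sum]
      rw [h6]
      simp only [c]
      push_cast
      field_simp
      rw [Complex.I_sq]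
      ring
  have h1 := fun k => dualPair_self_nonneg_and_eq_zero (c := fun ξ => (rho ξ ^ 2)⁻¹)
    (fun ξ => by have := rho_pos ξ; positivity) (hG k) (memSobolev_comps v k) (hv k)
  have h2 : ∑ k, dualPair (R k - Distr.pderiv k (l2Distr p)) (comps v k) = 0 := by
    rw [← sub_zero (0 : ℝ)]
    nth_rewrite 1 [← h v hdiv]
    rw [← sum_dualPair_pderiv_of_divergence_eq_zero hdiv p, ← Finset.sum_sub_distrib]
    exact Finset.sum_congr rfl fun k _ =>
      dualPair_sub_left (hR k) (memSobolev_pderiv_l2Distr p k) (memSobolev_comps v k)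
  have h3 := (h1 k).2 ((Finset.sum_eq_zero_iff_of_nonneg fun k _ => (h1 k).1).1 h2 k
    (Finset.mem_univ k))
  exact (sub_eq_zero.1 h3).symm

/-! ### A priori estimates and solvability -/

/-- Split `u = v + w` with `div w = g` and `‖w‖ ≤ ‖g‖`. Testing with the solenoidal `v` removes the
pressure and leaves `a_U(v, v)` equal to the pairing of `f` minus the Oseen operator at `w` with
`v`. Coercivity bounds `‖v‖`, and the `1` in the factor of `‖g‖` is the contribution of `w`. -/
theorem fieldNorm_le_of_isOseenSolution {A : Tensor n} {CA a : ℝ} (hs : A.IsSymm)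
    (hA : A.IsElliptic CA) (hCA : 0 < CA) (ha : 0 ≤ a) (hAa : ∀ k j α β, |A k j α β| ≤ a)
    {U : Fin n → Torus n → ℝ} {C : ℝ} (hU : IsAdvectingField U C) {f : Fin n → HDot n (-1)}
    {g : L2Dot n} {u : Fin n → HDot n 1} {p : L2Dot n} (h : IsOseenSolution A U f g u p) :
    vecNorm 1 u ≤ (Real.pi ^ 2)⁻¹ * CA * vecNorm (-1) f +
      (1 + (Real.pi ^ 2)⁻¹ * CA * oseenBound n a C) * ‖g‖ := by
  simp only [vecNorm_eq_fieldNorm]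
  obtain ⟨w, hw, hwg⟩ := exists_divergence_eq g
  set v : Fin n → HDot n 1 := u + (-1 : ℝ) • w with hv
  have huv : comps u = fun k => comps v k + comps w k := by
    funext k
    simp only [hv, comps_add, comps_smul]
    module
  have hu := memSobolev_comps u
  have hvm := memSobolev_comps v
  have hwm := memSobolev_comps w
  have hf := memSobolev_comps f
  have hdiv : divergence (comps v) = 0 := by
    rw [divergence_eq_zero_iff]
    intro ξ
    have h1 := congrArg (fun T => fourierCoef T ξ) (h.2.trans hw.symm)
    simp only [divergence, fourierCoef_sum, fourierCoef_pderiv, huv, fourierCoef_add, mul_add,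
      Finset.sum_add_distrib, add_eq_right, mul_assoc, ← Finset.mul_sum] at h1
    have h2 : (2 * Real.pi * Complex.I : ℂ) * ∑ j, (ξ j : ℂ) * fourierCoef (comps v j) ξ = 0 := by
      rw [← h1]
      ring
    exact (mul_eq_zero.1 h2).resolve_left Complex.two_pi_I_ne_zero
  have hN0 := oseenBound_nonneg n ha hU.nonneg
  have hform : formA A U v v =
      ∑ k, dualPair (comps f k - oseenOp A U (comps w) k) (comps v k) := by
    rw [formA_eq hs hU, ← add_zero (∑ k, _),
      ← sum_dualPair_pderiv_of_divergence_eq_zero hdiv p, ← Finset.sum_add_distrib]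
    refine Finset.sum_congr rfl fun k _ => ?_
    rw [← dualPair_add_left (memSobolev_oseenOp A hU hvm k) (memSobolev_pderiv_l2Distr p k)
      (hvm k), ← h.1 k, oseenMomentum_eq, huv, oseenOp_add A hU hvm hwm]
    congr 1
    module
  have hb : formA A U v v ≤
      (fieldNorm (-1) (comps f) + oseenBound n a C * ‖g‖) * fieldNorm 1 (comps v) := by
    rw [hform]
    refine (le_abs_self _).trans ((abs_sum_dualPair_le
      (fun k => (hf k).sub (memSobolev_oseenOp A hU hwm k)) hvm).trans ?_)
    refine mul_le_mul_of_nonneg_right ?_ (fieldNorm_nonneg _ _)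
    refine (fieldNorm_sub_le hf (memSobolev_oseenOp A hU hwm)).trans ?_
    gcongr
    exact (fieldNorm_oseenOp_le ha hAa hU hwm).trans (by gcongr)
  have hc := pi_sq_mul_fieldNorm_sq_le hA hU hdiv
  have hpi : 0 < Real.pi ^ 2 := by positivity
  have hvn := fieldNorm_nonneg 1 (comps v)
  have hfn := fieldNorm_nonneg (-1) (comps f)
  have hvb : fieldNorm 1 (comps v) ≤
      (Real.pi ^ 2)⁻¹ * CA * (fieldNorm (-1) (comps f) + oseenBound n a C * ‖g‖) := by
    rw [mul_assoc, inv_mul_eq_div, le_div_iff₀ hpi]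
    -- The inequality is quadratic in `‖v‖` on the left and linear on the right, so a factor `‖v‖`
    -- is cancelled when it is positive.
    rcases hvn.eq_or_lt with h0 | h0
    · rw [← h0, zero_mul]
      positivity
    · have := hc.trans (mul_le_mul_of_nonneg_left hb hCA.le)
      nlinarith
  have htri : fieldNorm 1 (comps u) ≤ fieldNorm 1 (comps v) + fieldNorm 1 (comps w) := by
    rw [huv]
    exact fieldNorm_add_le hvm hwm
  linarith

/-- The momentum equation expresses `∇p` through `f` and `u`, and `‖p‖` is bounded by the `H⁻¹` norm
of `∇p`. -/
theorem norm_pressure_le_of_isOseenSolution {A : Tensor n} {a : ℝ}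
    (ha : 0 ≤ a) (hAa : ∀ k j α β, |A k j α β| ≤ a)
    {U : Fin n → Torus n → ℝ} {C : ℝ} (hU : IsAdvectingField U C) {f : Fin n → HDot n (-1)}
    {g : L2Dot n} {u : Fin n → HDot n 1} {p : L2Dot n} (h : IsOseenSolution A U f g u p) :
    ‖p‖ ≤ vecNorm (-1) f + oseenBound n a C * vecNorm 1 u := by
  simp only [vecNorm_eq_fieldNorm]
  have hu := memSobolev_comps u
  refine (norm_le_fieldNorm_pderiv p).trans ?_
  have h1 : (fun k => Distr.pderiv k (l2Distr p)) =
      fun k => comps f k - oseenOp A U (comps u) k := by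
    funext k
    rw [← h.1 k, oseenMomentum_eq]
    module
  rw [h1]
  exact (fieldNorm_sub_le (memSobolev_comps f) (memSobolev_oseenOp A hU hu)).trans
    (by gcongr; exact fieldNorm_oseenOp_le ha hAa hU hu)

/-- A field `w` with `div w = g` is subtracted, the solenoidal problem is solved for `v`, and the
remaining residual, which annihilates solenoidal fields, is the gradient of the pressure. -/
theorem exists_isOseenSolution {A : Tensor n} {CA a : ℝ} (hs : A.IsSymm)
    (hA : A.IsElliptic CA) (hCA : 0 < CA) (ha : 0 ≤ a) (hAa : ∀ k j α β, |A k j α β| ≤ a)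
    {U : Fin n → Torus n → ℝ} {C : ℝ} (hU : IsAdvectingField U C) (f : Fin n → HDot n (-1))
    (g : L2Dot n) : ∃ (u : Fin n → HDot n 1) (p : L2Dot n), IsOseenSolution A U f g u p := by
  obtain ⟨w, hw, -⟩ := exists_divergence_eq g
  have hwm := memSobolev_comps w
  have hF : ∀ k, MemSobolev (-1) (comps f k - oseenOp A U (comps w) k) := fun k =>
    (memSobolev_comps f k).sub (memSobolev_oseenOp A hU hwm k)
  obtain ⟨v, hv, hsol⟩ := exists_solenoidal_solution hs hA hCA ha hAa hU hF
  have hvm := memSobolev_comps v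
  obtain ⟨p, hp⟩ := exists_pressure
    (R := fun k => comps f k - oseenOp A U (comps w) k - oseenOp A U (comps v) k)
    (fun k => (hF k).sub (memSobolev_oseenOp A hU hvm k)) (fun k => by
      rw [fourierCoef_sub, fourierCoef_sub, fourierCoef_comps_zero,
        fourierCoef_oseenOp_zero A hU hwm, fourierCoef_oseenOp_zero A hU hvm]
      simp) (fun z hz => by
      rw [Finset.sum_congr rfl fun k _ => dualPair_sub_left (hF k)
        (memSobolev_oseenOp A hU hvm k) (memSobolev_comps z k), Finset.sum_sub_distrib,
        hsol z hz, sub_self])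
  refine ⟨v + w, p, fun k => ?_, ?_⟩
  · rw [oseenMomentum_eq, hp, comps_add, oseenOp_add A hU hvm hwm]
    module
  · rw [← hw]
    refine distr_ext_fourierCoef fun ξ => ?_
    have h1 := congrArg (fun T => fourierCoef T ξ) hv
    simp only [divergence, fourierCoef_sum, fourierCoef_pderiv, fourierCoef_zero_distr] at h1
    simp only [divergence, fourierCoef_sum, fourierCoef_pderiv, comps_add, fourierCoef_add, mul_add,
      Finset.sum_add_distrib, h1, zero_add]

/-! ### The Oseen operator as a linear map -/

theorem HDot.eq_of_add_neg_one_smul_eq_zero {s : ℝ} {x y : HDot n s} (h : x + (-1 : ℝ) • y = 0) :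
    x = y := by
  refine Subtype.ext (distr_ext_fourierCoef fun ξ => ?_)
  have h1 := congrArg (fun T : HDot n s => fourierCoef (T : Distr n) ξ) h
  change fourierCoef ((x : Distr n) + (-1 : ℝ) • (y : Distr n)) ξ =
    fourierCoef (0 : Distr n) ξ at h1
  rw [fourierCoef_add, fourierCoef_smul, fourierCoef_zero_distr] at h1
  push_cast at h1
  linear_combination h1

theorem divergence_add (u v : Fin n → HDot n 1) :
    divergence (comps (u + v)) = divergence (comps u) + divergence (comps v) := by
  unfold divergence
  simp only [comps_add, map_add, Finset.sum_add_distrib]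

theorem divergence_smul (c : ℝ) (u : Fin n → HDot n 1) :
    divergence (comps (c • u)) = c • divergence (comps u) := by
  unfold divergence
  simp only [comps_smul, map_smul, Finset.smul_sum]

/-- The Oseen operator `(u, p) ↦ (-𝔏 u + ∇p + (U·∇)u, div u)`. -/
def oseenMap (A : Tensor n) {U : Fin n → Torus n → ℝ} {C : ℝ} (hU : IsAdvectingField U C) :
    ((Fin n → HDot n 1) × L2Dot n) →ₗ[ℝ] ((Fin n → HDot n (-1)) × L2Dot n) where
  toFun up := (fun k => ⟨oseenMomentum A U up.1 up.2 k, memSobolev_oseenMomentum A hU up.1 up.2 k,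
    fourierCoef_oseenMomentum_zero A hU up.1 up.2 k⟩, (exists_l2Distr_eq_divergence up.1).choose)
  map_add' x y := by
    refine Prod.ext (funext fun k => Subtype.ext ?_) (l2Distr_injective ?_)
    · change oseenMomentum A U (x.1 + y.1) (x.2 + y.2) k =
        oseenMomentum A U x.1 x.2 k + oseenMomentum A U y.1 y.2 k
      simp only [oseenMomentum_eq, comps_add, l2Distr_add, map_add,
        oseenOp_add A hU (memSobolev_comps x.1) (memSobolev_comps y.1)]
      module
    · change l2Distr (exists_l2Distr_eq_divergence (x.1 + y.1)).choose =
        l2Distr ((exists_l2Distr_eq_divergence x.1).choose +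
          (exists_l2Distr_eq_divergence y.1).choose)
      rw [l2Distr_add, (exists_l2Distr_eq_divergence (x.1 + y.1)).choose_spec,
        (exists_l2Distr_eq_divergence x.1).choose_spec,
        (exists_l2Distr_eq_divergence y.1).choose_spec, divergence_add]
  map_smul' c x := by
    refine Prod.ext (funext fun k => Subtype.ext ?_) (l2Distr_injective ?_)
    · change oseenMomentum A U (c • x.1) (c • x.2) k = c • oseenMomentum A U x.1 x.2 k
      simp only [oseenMomentum_eq, comps_smul, l2Distr_smul, map_smul,
        oseenOp_smul A hU c (memSobolev_comps x.1)]
      module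
    · change l2Distr (exists_l2Distr_eq_divergence (c • x.1)).choose =
        l2Distr (c • (exists_l2Distr_eq_divergence x.1).choose)
      rw [l2Distr_smul, (exists_l2Distr_eq_divergence (c • x.1)).choose_spec,
        (exists_l2Distr_eq_divergence x.1).choose_spec, divergence_smul]

theorem oseenMap_fst (A : Tensor n) {U : Fin n → Torus n → ℝ} {C : ℝ} (hU : IsAdvectingField U C)
    (u : Fin n → HDot n 1) (p : L2Dot n) (k : Fin n) :
    ((oseenMap A hU (u, p)).1 k : Distr n) = oseenMomentum A U u p k := rfl

theorem l2Distr_oseenMap_snd (A : Tensor n) {U : Fin n → Torus n → ℝ} {C : ℝ}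
    (hU : IsAdvectingField U C) (u : Fin n → HDot n 1) (p : L2Dot n) :
    l2Distr (oseenMap A hU (u, p)).2 = divergence (comps u) :=
  (exists_l2Distr_eq_divergence u).choose_spec

theorem isOseenSolution_iff_oseenMap_eq (A : Tensor n) {U : Fin n → Torus n → ℝ} {C : ℝ}
    (hU : IsAdvectingField U C) {f : Fin n → HDot n (-1)} {g : L2Dot n} {u : Fin n → HDot n 1}
    {p : L2Dot n} : IsOseenSolution A U f g u p ↔ oseenMap A hU (u, p) = (f, g) := by
  refine ⟨fun h => Prod.ext (funext fun k => Subtype.ext (h.1 k)) (l2Distr_injective ?_),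
    fun h => ⟨fun k => ?_, ?_⟩⟩
  · rw [l2Distr_oseenMap_snd]
    exact h.2
  · rw [← oseenMap_fst A hU, h]
    rfl
  · rw [← l2Distr_oseenMap_snd A hU u p, h]

theorem fieldNorm_eq_zero {s : ℝ} {u : Fin n → HDot n s} (h : fieldNorm s (comps u) = 0) :
    u = 0 := by
  funext k
  refine Subtype.ext (sobolevNorm_eq_zero (memSobolev_comps u k) (le_antisymm ?_
    (sobolevNorm_nonneg _ _)))
  rw [← h]
  exact sobolevNorm_le_fieldNorm s (comps u) k

theorem fieldNorm_comps_zero (s : ℝ) : fieldNorm s (comps (0 : Fin n → HDot n s)) = 0 := by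
  simp [fieldNorm, comps, sobolevNorm_zero_distr]

/-- Injectivity is the a priori estimates with zero data, applied to a difference; surjectivity is
`exists_isOseenSolution`. -/
theorem bijective_oseenMap {A : Tensor n} {CA a : ℝ} (hs : A.IsSymm)
    (hA : A.IsElliptic CA) (hCA : 0 < CA) (ha : 0 ≤ a) (hAa : ∀ k j α β, |A k j α β| ≤ a)
    {U : Fin n → Torus n → ℝ} {C : ℝ} (hU : IsAdvectingField U C) :
    Function.Bijective (oseenMap A hU) := by
  constructor
  · intro x y hxy
    set u := x.1 + (-1 : ℝ) • y.1
    set p := x.2 + (-1 : ℝ) • y.2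
    have h : oseenMap A hU (u, p) = (0, 0) := by
      change oseenMap A hU (x + (-1 : ℝ) • y) = 0
      rw [map_add, map_smul, hxy, ← one_smul ℝ (oseenMap A hU y), smul_smul, ← add_smul]
      norm_num
    have hsol := (isOseenSolution_iff_oseenMap_eq A hU (f := 0) (g := 0)).2 h
    have h1 := fieldNorm_le_of_isOseenSolution hs hA hCA ha hAa hU hsol
    have h2 := norm_pressure_le_of_isOseenSolution ha hAa hU hsol
    simp only [vecNorm_eq_fieldNorm, fieldNorm_comps_zero, norm_zero, mul_zero, add_zero] at h1 h2
    have h3 : fieldNorm 1 (comps u) = 0 := le_antisymm h1 (fieldNorm_nonneg _ _)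
    rw [h3, mul_zero, add_zero] at h2
    have h4 : p = 0 := norm_le_zero_iff.1 h2
    rw [show p = x.2 + (-1 : ℝ) • y.2 from rfl, neg_one_smul] at h4
    exact Prod.ext (funext fun k =>
      HDot.eq_of_add_neg_one_smul_eq_zero (congrFun (fieldNorm_eq_zero h3) k))
      (add_neg_eq_zero.1 h4)
  · rintro ⟨f, g⟩
    obtain ⟨u, p, h⟩ := exists_isOseenSolution hs hA hCA ha hAa hU f g
    exact ⟨(u, p), (isOseenSolution_iff_oseenMap_eq A hU).1 h⟩

theorem norm_oseenMap_le {A : Tensor n} {a : ℝ} (ha : 0 ≤ a) (hAa : ∀ k j α β, |A k j α β| ≤ a)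
    {U : Fin n → Torus n → ℝ} {C : ℝ} (hU : IsAdvectingField U C) (u : Fin n → HDot n 1)
    (p : L2Dot n) :
    vecNorm (-1) (oseenMap A hU (u, p)).1 + ‖(oseenMap A hU (u, p)).2‖ ≤
      (oseenBound n a C + n * (2 * Real.pi)) * (vecNorm 1 u + ‖p‖) := by
  simp only [vecNorm_eq_fieldNorm]
  have hu := memSobolev_comps u
  have hun := fieldNorm_nonneg 1 (comps u)
  have hN0 := oseenBound_nonneg n ha hU.nonneg
  have h1 : comps (oseenMap A hU (u, p)).1 =
      fun k => oseenOp A U (comps u) k + Distr.pderiv k (l2Distr p) :=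
    funext fun k => oseenMomentum_eq A U u p k
  have h2 : fieldNorm (-1) (fun k => Distr.pderiv k (l2Distr p)) ≤ n * (2 * Real.pi * ‖p‖) := by
    refine fieldNorm_le_of_forall_le (fun k => ?_) (by positivity)
    rw [← sobolevNorm_l2Distr]
    exact sobolevNorm_pderiv_le (by norm_num) (memSobolev_l2Distr p) k
  have h3 : ‖(oseenMap A hU (u, p)).2‖ ≤ n * (2 * Real.pi * fieldNorm 1 (comps u)) := by
    rw [← sobolevNorm_l2Distr, l2Distr_oseenMap_snd]
    refine sobolevNorm_sum_le_nat_mul (fun k => (hu k).pderiv (zero_add 1) k) fun k => ?_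
    refine (sobolevNorm_pderiv_le (zero_add 1) (hu k) k).trans ?_
    gcongr
    exact sobolevNorm_le_fieldNorm 1 (comps u) k
  rw [h1]
  have h4 := fieldNorm_add_le (memSobolev_oseenOp A hU hu) (memSobolev_pderiv_l2Distr p)
  have h5 := fieldNorm_oseenOp_le ha hAa hU hu
  have h6 : 0 ≤ oseenBound n a C * ‖p‖ := by positivity
  linarith

/-- A single constant for both directions: the bound `N + M` of the operator plus a number
dominating the total coefficients of `x` and of `y` in the sum of the two a priori estimates. -/
theorem two_sided_bound_of_estimates {κ N M x y u p : ℝ} (hκ : 0 ≤ κ) (hN : 0 ≤ N) (hM : 0 ≤ M) (hx : 0 ≤ x)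
    (hy : 0 ≤ y) (hu : 0 ≤ u) (hp : 0 ≤ p) (h1 : x + y ≤ (N + M) * (u + p))
    (h2 : u ≤ κ * x + (1 + κ * N) * y) (h3 : p ≤ (1 + κ * N) * x + N * (1 + κ * N) * y) :
    x + y ≤ (N + M + (1 + κ + κ * N + N * (1 + κ * N))) * (u + p) ∧
      u + p ≤ (N + M + (1 + κ + κ * N + N * (1 + κ * N))) * (x + y) := by
  have hκN : 0 ≤ κ * N := by positivity
  have hL : 0 ≤ 1 + κ + κ * N + N * (1 + κ * N) := by positivity
  constructor
  · have := mul_nonneg hL (add_nonneg hu hp)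
    linarith
  · have h4 : 0 ≤ (N + M) * (x + y) := by positivity
    have h5 : 0 ≤ N * (1 + κ * N) * x := by positivity
    have h6 : 0 ≤ κ * y := by positivity
    linarith

theorem Tensor.abs_le_maxNorm (A : Tensor n) (k j α β : Fin n) : |A k j α β| ≤ A.maxNorm :=
  le_ciSup (f := fun i : Fin n × Fin n × Fin n × Fin n => |A i.1 i.2.1 i.2.2.1 i.2.2.2|)
    (Set.finite_range _).bddAbove (k, j, α, β)

theorem IsSolenoidalLp.exists_isAdvectingField (hn : 2 ≤ n) {θ : ℝ} (hθ2 : 2 < θ)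
    (hθn : (n : ℝ) ≤ θ) {U : Fin n → Torus n → ℝ} (hU : IsSolenoidalLp θ U) :
    ∃ C, IsAdvectingField U C := by
  obtain ⟨C, hC0, hC⟩ := exists_isMultiplierBound hn hθ2 hθn hU.1
  refine ⟨C, fun j => (hU.1 j).mono_exponent ?_, hU.2, hC0, hC⟩
  rw [← ENNReal.ofReal_ofNat]
  exact ENNReal.ofReal_le_ofReal hθ2.le

end PeriodicOseen

end

theorem mainTheorem8 (n : ℕ) (hn : 2 ≤ n) (θ : ℝ) (hθ_two : n = 2 → 2 < θ)
    (hθ_ge : 3 ≤ n → (n : ℝ) ≤ θ) (U : Fin n → Torus n → ℝ) (hU : IsSolenoidalLp θ U)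
    (CA : ℝ) (hCA : 0 < CA) (normA : ℝ) :
    -- The constants depend only on `n`, `U`, `CA` and `‖A‖`.
    ∃ C₁ C₂ : ℝ, ∀ A : Tensor n, A.IsSymm → A.IsElliptic CA → A.maxNorm = normA →
      -- (i) the variational problem
      (∀ (f : Fin n → HDot n (-1)) (g : L2Dot n),
        (∃! up : (Fin n → HDot n 1) × L2Dot n, IsVariationalSolution A U f g up.1 up.2) ∧
        ∀ (u : Fin n → HDot n 1) (p : L2Dot n), IsVariationalSolution A U f g u p →
          vecNorm 1 u ≤ (Real.pi ^ 2)⁻¹ * CA * vecNorm (-1) f + C₁ * ‖g‖ ∧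
          ‖p‖ ≤ C₁ * vecNorm (-1) f + C₂ * ‖g‖) ∧
      -- (ii) well-posedness of the Oseen system in the sense of distributions
      (∀ (f : Fin n → HDot n (-1)) (g : L2Dot n),
        (∃! up : (Fin n → HDot n 1) × L2Dot n, IsOseenSolution A U f g up.1 up.2) ∧
        ∀ (u : Fin n → HDot n 1) (p : L2Dot n),
          (IsOseenSolution A U f g u p ↔ IsVariationalSolution A U f g u p) ∧
          (IsOseenSolution A U f g u p →
            vecNorm 1 u ≤ (Real.pi ^ 2)⁻¹ * CA * vecNorm (-1) f + C₁ * ‖g‖ ∧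
            ‖p‖ ≤ C₁ * vecNorm (-1) f + C₂ * ‖g‖)) ∧
      -- (iii) the Oseen operator is an isomorphism of normed spaces
      (∃ S : ((Fin n → HDot n 1) × L2Dot n) ≃ₗ[ℝ] ((Fin n → HDot n (-1)) × L2Dot n),
        (∀ (u : Fin n → HDot n 1) (p : L2Dot n),
          (∀ k, ((S (u, p)).1 k : Distr n) = oseenMomentum A U u p k) ∧
          l2Distr (S (u, p)).2 = divergence (comps u)) ∧
        ∃ K : ℝ, ∀ (u : Fin n → HDot n 1) (p : L2Dot n),
          vecNorm (-1) (S (u, p)).1 + ‖(S (u, p)).2‖ ≤ K * (vecNorm 1 u + ‖p‖) ∧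
          vecNorm 1 u + ‖p‖ ≤ K * (vecNorm (-1) (S (u, p)).1 + ‖(S (u, p)).2‖)) := by
  -- Both cases for `θ` are merged into `2 < θ` and `n ≤ θ`, as `θ ≥ n ≥ 3` in higher dimensions.
  have hθ2 : 2 < θ := by
    rcases hn.eq_or_lt with h | h
    · exact hθ_two h.symm
    · have h1 : (3 : ℝ) ≤ n := by exact_mod_cast h
      linarith [hθ_ge h]
  have hθn : (n : ℝ) ≤ θ := by
    rcases hn.eq_or_lt with h | h
    · rw [← h]
      exact_mod_cast hθ2.le
    · exact hθ_ge h
  obtain ⟨C, hUC⟩ := hU.exists_isAdvectingField hn hθ2 hθn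
  set κ : ℝ := (Real.pi ^ 2)⁻¹ * CA with hκ
  have hκ0 : 0 ≤ κ := by positivity
  set N : ℝ := oseenBound n normA C
  -- Inserting the estimate of `u` into `‖p‖ ≤ ‖f‖ + N‖u‖` gives the factor `1 + Nκ` for `‖f‖`, the
  -- same as the factor of `‖g‖` in the estimate of `u`. The tensor enters `N` only through `normA`,
  -- so the constants are fixed before `A`.
  refine ⟨1 + κ * N, N * (1 + κ * N), fun A hs hA hnorm => ?_⟩
  have hAa : ∀ k j α β, |A k j α β| ≤ normA := fun k j α β => hnorm ▸ A.abs_le_maxNorm k j α β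
  have ha : 0 ≤ normA := (abs_nonneg _).trans (hAa ⟨0, by omega⟩ ⟨0, by omega⟩ ⟨0, by omega⟩
    ⟨0, by omega⟩)
  have hN0 : 0 ≤ N := oseenBound_nonneg n ha hUC.nonneg
  have hiff : ∀ f g u p, IsOseenSolution A U f g u p ↔ IsVariationalSolution A U f g u p :=
    isOseenSolution_iff_isVariationalSolution hs hUC
  have hbij : Function.Bijective (oseenMap A hUC) :=
    bijective_oseenMap hs hA hCA ha hAa hUC
  have hest : ∀ f g u p, IsOseenSolution A U f g u p →
      vecNorm 1 u ≤ κ * vecNorm (-1) f + (1 + κ * N) * ‖g‖ ∧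
      ‖p‖ ≤ (1 + κ * N) * vecNorm (-1) f + N * (1 + κ * N) * ‖g‖ := by
    intro f g u p h
    have h1 := fieldNorm_le_of_isOseenSolution hs hA hCA ha hAa hUC h
    have h2 := norm_pressure_le_of_isOseenSolution ha hAa hUC h
    have h3 := mul_le_mul_of_nonneg_left h1 hN0
    refine ⟨h1, h2.trans ?_⟩
    linarith
  have hex : ∀ f g, ∃! up : (Fin n → HDot n 1) × L2Dot n,
      IsOseenSolution A U f g up.1 up.2 := by
    intro f g
    obtain ⟨up, h, huniq⟩ := hbij.existsUnique (f, g)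
    exact ⟨up, (isOseenSolution_iff_oseenMap_eq A hUC).2 h,
      fun y hy => huniq y ((isOseenSolution_iff_oseenMap_eq A hUC).1 hy)⟩
  refine ⟨fun f g => ⟨?_, fun u p h => hest f g u p ((hiff f g u p).2 h)⟩,
    fun f g => ⟨hex f g, fun u p => ⟨hiff f g u p, hest f g u p⟩⟩, ?_⟩
  · simpa only [hiff] using hex f g
  · refine ⟨LinearEquiv.ofBijective (oseenMap A hUC) hbij,
      fun u p => ⟨oseenMap_fst A hUC u p, l2Distr_oseenMap_snd A hUC u p⟩, ?_⟩
    refine ⟨N + n * (2 * Real.pi) + (1 + κ + κ * N + N * (1 + κ * N)), fun u p => ?_⟩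
    -- Every pair solves the system whose data are its own image, so the a priori estimates bound
    -- the inverse.
    obtain ⟨h1, h2⟩ := hest (oseenMap A hUC (u, p)).1 (oseenMap A hUC (u, p)).2 u p
      ((isOseenSolution_iff_oseenMap_eq A hUC).2 (Prod.mk.eta).symm)
    exact two_sided_bound_of_estimates hκ0 hN0 (by positivity) (Real.sqrt_nonneg _)
      (norm_nonneg _) (Real.sqrt_nonneg _) (norm_nonneg _)
      (norm_oseenMap_le ha hAa hUC u p) h1 h2
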